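/- **Setting.** For $N\ge 1$ let $J=(J_{ij})_{1\le i<j\le N}$ be independent centered unit Gaussians and, for $\sigma\in\{-1,1\}^N$, let $$H_N(\sigma,h,J)=-\frac1{\sqrt N}\sum_{i<j}J_{ij}\sigma_i\sigma_j-h\sum_i\sigma_i,\qquad Z_N(\beta,h,J)=\sum_\sigma e^{-\beta H_N(\sigma,h,J)},$$ $$\alpha_N(\beta,h)=\frac1N E\log Z_N(\beta,h,J),\qquad \Omega_N(A)=Z_N^{-1}\sum_\sigma A(\sigma)e^{-\beta H_N(\sigma,h,J)}$$ be the Sherrington–Kirkpatrick Hamiltonian, partition function, normalised log-partition function and (random) Boltzmann state. Put $\alpha(\beta,h)=\sup_{N\ge1}\alpha_N(\beta,h)$. Let $q(\sigma,\tau)=N^{-1}\sum_i\sigma_i\tau_i$ be the overlap, and let $\langle q_{12}^2\rangle_N$ be the average over $J$ of the expectation of $q(\sigma,\tau)^2$ for two replicas $\sigma,\tau$ distributed according to the product of two copies of $\Omega_N$ with the same $J$. For a cavity of size $K$ with configurations $\tau\in\{-1,1\}^K$ let $\eta_0,\eta_1,\eta_2,\dots$ and $\kappa,\kappa'$ be independent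 (of each other and of $J$) centered Gaussian fields indexed by $\tau$, with $$E(\eta_j(\tau)\eta_j(\tau'))=q(\tau,\tau'),\qquad E(\kappa(\tau)\kappa(\tau'))=E(\kappa'(\tau)\kappa'(\tau'))=q(\tau,\tau')^2,$$ and let $c_j=2\cosh\beta(h+\eta_j)$. In $E\log\Omega_K(\cdots)$ below, $E$ is the average over $J$, all these fields, and an integer $K$ uniformly distributed on $\{1,\dots,N\}$. **Theorem.** Let $\beta,h\in\mathbb R$ be such that the limit $\langle q_{12}^2\rangle=\lim_{N\to\infty}\langle q_{12}^2\rangle_N$ exists. Then $\lim_{N\to\infty}\alpha_N(\beta,h)=\alpha(\beta,h)$, and for every integer $M\ge0$ and every real $\lambda$: 1. (limit formula) $$\lim_{N\to\infty}E\log\Omega_K(c_1c_2\cdots c_Me^{\lambda\kappa})=M\Bigl(\alpha(\beta,h)+\frac{\beta^2}{4}\bigl(1-\langle q_{12}^2\rangle\bigr)\Bigr)+\frac{\lambda^2}{2}\bigl(1-\langle q_{12}^2\rangle\bigr);$$ 2. (factorization) $$\lim_{N\to\infty}\Bigl[E\log\Omega_K(c_1\cdots c_Me^{\lambda\kappa})-\sum_{j=1}^M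 E\log\Omega_K(c_j)-E\log\Omega_K(e^{\lambda\kappa})\Bigr]=0;$$ 3. (invariance) for the transformed states $\Omega'_K(\cdot)=\Omega_K(c_0\,\cdot)/\Omega_K(c_0)$ and, for every real $\mu$, $\Omega''_K(\cdot)=\Omega_K(e^{\mu\kappa'}\,\cdot)/\Omega_K(e^{\mu\kappa'})$, $$\lim_{N\to\infty}\Bigl[E\log\Omega'_K(c_1\cdots c_Me^{\lambda\kappa})-E\log\Omega_K(c_1\cdots c_Me^{\lambda\kappa})\Bigr]=0,$$ and the same with $\Omega''_K$ in place of $\Omega'_K$. -/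

import Mathlib

open MeasureTheory ProbabilityTheory Filter Topology

noncomputable section

namespace SpinGlass

/-- Configurations of `N` Ising spins, each spin being a unit of `ℤ`, that is `1` or `-1`. -/
abbrev Config (N : ℕ) : Type := Fin N → ℤˣ

/-- The real value `±1` of a spin. -/
def spin (s : ℤˣ) : ℝ := ((s : ℤ) : ℝ)

/-- The `N(N-1)/2` unordered couples of distinct sites, each listed once as `(i, j)`, `i < j`. -/
abbrev Couple (N : ℕ) : Type := {p : Fin N × Fin N // p.1 < p.2}

/-- A sample `J` of the external quenched noise. -/
abbrev Couplings (N : ℕ) : Type := Couple N → ℝ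

/-- The law of the noise: the `J_{ij}` are independent centered unit Gaussians. -/
def couplingLaw (N : ℕ) : Measure (Couplings N) :=
  Measure.pi fun _ => gaussianReal 0 1

/-- `H_N(σ,h,J) = -(1/√N) ∑_{(i,j)} J_{ij} σ_i σ_j - h ∑_i σ_i`. -/
def hamiltonian (N : ℕ) (h : ℝ) (J : Couplings N) (σ : Config N) : ℝ :=
  -(1 / Real.sqrt N) * ∑ p : Couple N, J p * spin (σ p.1.1) * spin (σ p.1.2)
    - h * ∑ i, spin (σ i)

/-- `Z_N(β,h,J)`. -/
def partitionFunction (N : ℕ) (β h : ℝ) (J : Couplings N) : ℝ :=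
  ∑ σ : Config N, Real.exp (-β * hamiltonian N h J σ)

/-- `α_N(β,h) = N⁻¹ E log Z_N(β,h,J)`. -/
def alphaN (N : ℕ) (β h : ℝ) : ℝ :=
  (N : ℝ)⁻¹ * ∫ J, Real.log (partitionFunction N β h J) ∂couplingLaw N

/-- `α(β,h) = sup_{N ≥ 1} α_N(β,h)`. -/
def alpha (β h : ℝ) : ℝ := ⨆ N : ℕ, alphaN (N + 1) β h

/-- States, acting on functions of the configuration. -/
abbrev State (N : ℕ) : Type := (Config N → ℝ) → ℝ

/-- The Boltzmann state. -/
def boltzmann (N : ℕ) (β h : ℝ) (J : Couplings N) : State N := fun A =>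
  (partitionFunction N β h J)⁻¹ *
    ∑ σ : Config N, A σ * Real.exp (-β * hamiltonian N h J σ)

/-- The overlap `q(σ,τ) = N⁻¹ ∑_i σ_i τ_i`. -/
def overlap {N : ℕ} (σ τ : Config N) : ℝ :=
  (N : ℝ)⁻¹ * ∑ i, spin (σ i) * spin (τ i)

/-- `⟨q₁₂²⟩_N`: the noise average of the square of the overlap of two replicas, distributed
according to the product of two copies of the Boltzmann state with the same noise. -/
def meanSqOverlap (N : ℕ) (β h : ℝ) : ℝ :=
  ∫ J, boltzmann N β h J (fun σ => boltzmann N β h J (fun τ => overlap σ τ ^ 2))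
    ∂couplingLaw N

/-- The matrix `q(τ,τ')`. -/
def overlapMatrix (K : ℕ) : Matrix (Config K) (Config K) ℝ :=
  Matrix.of fun τ τ' => overlap τ τ'

/-- The matrix `q(τ,τ')²`. -/
def sqOverlapMatrix (K : ℕ) : Matrix (Config K) (Config K) ℝ :=
  Matrix.of fun τ τ' => overlap τ τ' ^ 2

/-- The overlap matrix is a covariance matrix. -/
theorem posSemidef_overlapMatrix (K : ℕ) : (overlapMatrix K).PosSemidef := by
  have : overlapMatrix K = (K : ℝ)⁻¹ •
      ((Matrix.of fun τ i => spin (τ i) : Matrix (Config K) (Fin K) ℝ) *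
        (Matrix.of fun τ i => spin (τ i) : Matrix (Config K) (Fin K) ℝ).conjTranspose) := by
    ext τ τ'
    simp [overlapMatrix, overlap, Matrix.mul_apply]
  rw [this]
  exact (Matrix.posSemidef_self_mul_conjTranspose _).smul (by positivity)

/-- The matrix of squared overlaps is a covariance matrix. -/
theorem posSemidef_sqOverlapMatrix (K : ℕ) : (sqOverlapMatrix K).PosSemidef := by
  have : sqOverlapMatrix K = ((K : ℝ)⁻¹ ^ 2) •
      ((Matrix.of fun τ p => spin (τ p.1) * spin (τ p.2) :
          Matrix (Config K) (Fin K × Fin K) ℝ) *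
        (Matrix.of fun τ p => spin (τ p.1) * spin (τ p.2) :
          Matrix (Config K) (Fin K × Fin K) ℝ).conjTranspose) := by
    ext τ τ'
    simp only [sqOverlapMatrix, overlap, Matrix.mul_apply, Matrix.of_apply, Matrix.smul_apply,
      Matrix.conjTranspose_apply, star_trivial, smul_eq_mul, mul_pow]
    rw [sq (∑ i, _), Finset.sum_mul_sum, Fintype.sum_prod_type]
    congr 1
    refine Finset.sum_congr rfl fun i _ => Finset.sum_congr rfl fun j _ => ?_
    ring
  rw [this]
  exact (Matrix.posSemidef_self_mul_conjTranspose _).smul (by positivity)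

/-- A random field indexed by the configurations of a cavity of size `K`. -/
abbrev Field (K : ℕ) : Type := EuclideanSpace ℝ (Config K)

/-- All the randomness attached to a cavity of size `K`: the noise `J` of the cavity, the fields
`η_0, η_1, …`, the field `κ`, and a copy `κ'` of `κ`. -/
structure Sample (K : ℕ) where
  J : Couplings K
  η : ℕ → Field K
  κ : Field K
  κ' : Field K

/-- A sample as a tuple, which carries the product σ-algebra. -/
def Sample.ofTuple {K : ℕ} (x : Couplings K × (ℕ → Field K) × Field K × Field K) : Sample K :=
  ⟨x.1, x.2.1, x.2.2.1, x.2.2.2⟩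

/-- The joint law: `J`, the `η_j`, `κ` and `κ'` are all independent; every `η_j` is a centered
Gaussian field with covariance `q(τ,τ')`; `κ` and `κ'` are centered Gaussian fields with covariance
`q(τ,τ')²`. -/
def sampleLaw (K : ℕ) : Measure (Couplings K × (ℕ → Field K) × Field K × Field K) :=
  (couplingLaw K).prod
    ((Measure.infinitePi fun _ : ℕ => multivariateGaussian 0 (overlapMatrix K)).prod
      ((multivariateGaussian 0 (sqOverlapMatrix K)).prod
        (multivariateGaussian 0 (sqOverlapMatrix K))))

/-- `E log Ω(A)`, for a random state `Ω` and a random function `A` on a cavity of size `K`. -/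
def ELog (K : ℕ) (Ω : Sample K → State K) (A : Sample K → Config K → ℝ) : ℝ :=
  ∫ x, Real.log (Ω (Sample.ofTuple x) (A (Sample.ofTuple x))) ∂sampleLaw K

/-- The additional average over a size `K` uniformly distributed on `1, …, N`. -/
def sizeAverage (F : ℕ → ℝ) (N : ℕ) : ℝ :=
  (N : ℝ)⁻¹ * ∑ K ∈ Finset.Icc 1 N, F K

/-- The random Boltzmann state `Ω_K` of the cavity. -/
def cavityState (β h : ℝ) (K : ℕ) : Sample K → State K := fun s => boltzmann K β h s.J

/-- `c_j = 2 cosh β(h + η_j)`. -/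
def c (β h : ℝ) {K : ℕ} (j : ℕ) : Sample K → Config K → ℝ :=
  fun s τ => 2 * Real.cosh (β * (h + s.η j τ))

/-- `exp(lam κ)`. -/
def expκ (lam : ℝ) {K : ℕ} : Sample K → Config K → ℝ :=
  fun s τ => Real.exp (lam * s.κ τ)

/-- `exp(μ κ')`. -/
def expκ' (μ : ℝ) {K : ℕ} : Sample K → Config K → ℝ :=
  fun s τ => Real.exp (μ * s.κ' τ)

/-- The random observable `c_1 c_2 ⋯ c_M exp(lam κ)`. -/
def cavityObs (β h : ℝ) (M : ℕ) (lam : ℝ) {K : ℕ} : Sample K → Config K → ℝ :=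
  (∏ j ∈ Finset.Icc 1 M, c β h j) * expκ lam

/-- The random transformation `Ω(·) ↦ Ω(B ·) / Ω(B)` of a random state. -/
def transform {K : ℕ} (B : Sample K → Config K → ℝ) (Ω : Sample K → State K) :
    Sample K → State K :=
  fun s A => Ω s (B s * A) / Ω s (B s)

end SpinGlass

end

/-! Every quantity in the theorem is a difference of free energies of Gaussian spin systems. Since
`2 cosh y` is the sum of `exp (± y)`, each factor `c_j` is the partial trace over one further spin
coupled to the cavity through `η_j`. Hence `E log Ω_K(c_1 ⋯ c_m e^{λκ})` is the free energy of a
system with `K + m` spins and an extra field, minus that of the cavity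
(`integral_log_boltzmann_fieldObs`). It depends only on `m` and the total variance `x` of the extra
fields (`cavityGain`). A transformed state produces a difference of two such gains. So everything
follows once the size average of the gain is shown to converge to an expression linear in `m` and
`x`.

The covariance of the enlarged system agrees, up to a constant and an error `O(1/K)`, with that of
the original model on `n = K + m` sites at inverse temperature `u_n` with `u_n² = β² + (2x +
mβ²)/n`. Gaussian interpolation (`freeEnergy_le`) turns this into an `O(1/K)` comparison of free
energies (`abs_cavityFree_sub_skFree_le`). The gain then splits into two parts. The increments in
size, `skFree (K + m) - skFree K` at fixed `β`, telescope under the size average and yield `m α`,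
the limit of the free energy per site existing by superadditivity. The response to the temperature
shift, `skFree n u_n - skFree n β`, must be shown to converge to `(2x + mβ²)/4 * (1 - Q)`.

The response is the delicate part: the free energy is of order `n` and `u_n - β` of order `1/n`, so
the increment is of order one and convergence of derivatives per site at `β` does not suffice.
`skFree n` is convex in the temperature with derivative `t n/2 * (1 - ⟨q²⟩)`, so its deviation from
the tangent is at most `|u_n - β|/s` times the second difference with step `s`. That second
difference, divided by `n`, converges to the one of the limiting free energy. The latter is `O(s²)`
(`skLimit_add_le`), and `s` can then be taken small.

The bound `O(s²)` is the almost midpoint concavity `skFree_add_skFree_le`. Two independent systems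
of size `n` at `t + s` and `t - s` are joined, at cost `n s²/2`, into one system of `2n` sites with
two species. The weights are then averaged over one pair of sites after another. Exchanging the two
sites makes the free energy even in the transferred weight, so the first order vanishes and each
pair costs only `O(s²)`.

At `β = 0` the relevant window is of width `1/√n` instead, and a second moment computation around
infinite temperature replaces the convexity argument (`skFree_sub_zero_bounds`). -/

noncomputable section

/-! ### Gaussian integration by parts and derivatives of Gaussian averages. -/

namespace SpinGlass

/-- Gaussian integration by parts on the line. -/
theorem integral_mul_gaussianReal_eq {f f' : ℝ → ℝ} {B : ℝ}
    (hd : ∀ x, HasDerivAt f (f' x) x) (hf' : Continuous f') (hfB : ∀ x, |f x| ≤ B)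
    (hfB' : ∀ x, |f' x| ≤ B) :
    ∫ x, x * f x ∂gaussianReal 0 1 = ∫ x, f' x ∂gaussianReal 0 1 := by
  have hf : Continuous f := continuous_iff_continuousAt.2 fun x => (hd x).continuousAt
  rw [integral_gaussianReal_eq_integral_smul one_ne_zero,
    integral_gaussianReal_eq_integral_smul one_ne_zero]
  set p : ℝ → ℝ := gaussianPDFReal 0 1 with hp
  -- The Gaussian density satisfies `p' = -x p`, so the factor `x` in the left integral is a
  -- derivative to be moved onto `f`.
  have hpd : ∀ x, HasDerivAt p (-x * p x) x := by
    intro x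
    have h1 : HasDerivAt (fun x : ℝ => -(x - 0) ^ 2 / (2 * ((1 : NNReal) : ℝ))) (-x) x := by
      have := (((hasDerivAt_id x).sub_const 0).pow 2).neg.div_const (2 * ((1 : NNReal) : ℝ))
      refine this.congr_deriv ?_
      simp
      ring
    have h2 := (h1.exp).const_mul ((Real.sqrt (2 * Real.pi * ((1 : NNReal) : ℝ)))⁻¹)
    refine h2.congr_deriv ?_
    simp only [hp, gaussianPDFReal]
    ring
  have hpi : Integrable p := integrable_gaussianPDFReal 0 1
  have hpc : Continuous p := continuous_iff_continuousAt.2 fun x => (hpd x).continuousAt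
  have hxp : Integrable fun x => x * p x := by
    have h0 : Integrable (fun x : ℝ => x) (gaussianReal 0 1) :=
      (memLp_id_gaussianReal 1).integrable le_rfl
    rw [gaussianReal_of_var_ne_zero _ one_ne_zero,
      integrable_withDensity_iff_integrable_smul' (measurable_gaussianPDF 0 1)
        (Filter.Eventually.of_forall fun x => gaussianPDF_lt_top)] at h0
    refine h0.congr (Filter.Eventually.of_forall fun x => ?_)
    simp [hp, toReal_gaussianPDF, mul_comm]
  have hbd : ∀ {u v : ℝ → ℝ}, Continuous u → (∀ x, |u x| ≤ B) → Integrable v →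
      Integrable fun x => u x * v x := by
    intro u v hu hB hv
    exact hv.bdd_mul (c := B) hu.aestronglyMeasurable
      (Filter.Eventually.of_forall fun x => by simpa using hB x)
  have key := integral_mul_deriv_eq_deriv_mul_of_integrable (u := f) (v := p) (u' := f')
    (v' := fun x => -x * p x) (fun x _ => hd x) (fun x _ => hpd x)
    (by simpa [Pi.mul_def] using hbd hf hfB hxp.neg) (hbd hf' hfB' hpi) (hbd hf hfB hpi)
  simp only [smul_eq_mul]
  have e1 : ∫ x, p x * (x * f x) = -∫ x, f x * (-x * p x) := by
    rw [← integral_neg]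
    congr 1 with x
    ring
  have e2 : ∫ x, p x * f' x = ∫ x, f' x * p x := by
    congr 1 with x
    ring
  rw [e1, e2, key, neg_neg]

variable {I : Type*} [Fintype I]

/-- The standard Gaussian law on `ℝ^I`. -/
abbrev stdGauss (I : Type*) [Fintype I] : Measure (I → ℝ) := Measure.pi fun _ => gaussianReal 0 1

/-- Resampling one coordinate does not change the law. By Fubini this reduces integration by parts
in coordinate `k` to the line, with the other coordinates frozen. -/
theorem measurePreserving_update [DecidableEq I] (k : I) :
    MeasurePreserving (fun z : ℝ × (I → ℝ) => Function.update z.2 k z.1)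
      ((gaussianReal 0 1).prod (stdGauss I)) (stdGauss I) := by
  have hm : Measurable fun z : ℝ × (I → ℝ) => Function.update z.2 k z.1 := by
    rw [measurable_pi_iff]
    intro i
    by_cases h : i = k
    · subst h; simpa using measurable_fst
    · simp only [Function.update_of_ne h]
      exact (measurable_pi_apply i).comp measurable_snd
  refine ⟨hm, ?_⟩
  symm
  refine Measure.pi_eq fun s hs => ?_
  rw [Measure.map_apply hm (MeasurableSet.univ_pi hs)]
  have : (fun z : ℝ × (I → ℝ) => Function.update z.2 k z.1) ⁻¹' Set.univ.pi s =
      s k ×ˢ Set.univ.pi (Function.update s k Set.univ) := by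
    ext z
    simp only [Set.mem_preimage, Set.mem_pi, Set.mem_univ, true_implies, Set.mem_prod]
    constructor
    · intro h
      refine ⟨by simpa using h k, fun i => ?_⟩
      by_cases hi : i = k
      · subst hi; simp
      · simpa [Function.update_of_ne hi] using h i
    · rintro ⟨h1, h2⟩ i
      by_cases hi : i = k
      · subst hi; simpa using h1
      · simpa [Function.update_of_ne hi] using h2 i
  rw [this, Measure.prod_prod, Measure.pi_pi, ← Finset.mul_prod_erase _ _ (Finset.mem_univ k),
    ← Finset.mul_prod_erase (Finset.univ) (fun i => gaussianReal 0 1 (s i)) (Finset.mem_univ k)]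
  simp only [Function.update_self, measure_univ, one_mul]
  congr 1
  refine Finset.prod_congr rfl fun i hi => ?_
  rw [Function.update_of_ne (Finset.ne_of_mem_erase hi)]

theorem integrable_abs_eval_stdGauss (k : I) :
    Integrable (fun g : I → ℝ => g k) (stdGauss I) := by
  have h0 : Integrable (fun x : ℝ => x) (gaussianReal 0 1) :=
    (memLp_id_gaussianReal 1).integrable le_rfl
  exact (measurePreserving_eval (fun _ : I => gaussianReal 0 1) k).integrable_comp_of_integrable h0

/-- Gaussian integration by parts in one coordinate. -/
theorem integral_mul_stdGauss_eq [DecidableEq I] (k : I) {f f' : (I → ℝ) → ℝ} {B : ℝ}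
    (hd : ∀ g x, HasDerivAt (fun y => f (Function.update g k y)) (f' (Function.update g k x)) x)
    (hf : Continuous f) (hf' : Continuous f') (hfB : ∀ x, |f x| ≤ B) (hfB' : ∀ x, |f' x| ≤ B) :
    ∫ g, g k * f g ∂stdGauss I = ∫ g, f' g ∂stdGauss I := by
  have hmp := measurePreserving_update k
  have hi1 : Integrable (fun g : I → ℝ => g k * f g) (stdGauss I) :=
    (integrable_abs_eval_stdGauss k).mul_bdd (c := B) hf.aestronglyMeasurable
      (Filter.Eventually.of_forall fun x => by simpa using hfB x)
  have hi2 : Integrable f' (stdGauss I) :=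
    Integrable.of_bound hf'.aestronglyMeasurable B
      (Filter.Eventually.of_forall fun x => by simpa using hfB' x)
  have hu : ∀ z : I → ℝ, Continuous fun y : ℝ => Function.update z k y := fun z =>
    continuous_const.update k continuous_id
  have hj1 : Integrable (fun z : ℝ × (I → ℝ) => Function.update z.2 k z.1 k *
      f (Function.update z.2 k z.1)) ((gaussianReal 0 1).prod (stdGauss I)) :=
    hmp.integrable_comp_of_integrable hi1
  have hj2 : Integrable (fun z : ℝ × (I → ℝ) => f' (Function.update z.2 k z.1))
      ((gaussianReal 0 1).prod (stdGauss I)) := hmp.integrable_comp_of_integrable hi2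
  rw [← hmp.map_eq, integral_map hmp.measurable.aemeasurable
      (by rw [hmp.map_eq]; exact hi1.aestronglyMeasurable),
    integral_map hmp.measurable.aemeasurable (by rw [hmp.map_eq]; exact hi2.aestronglyMeasurable),
    integral_prod_symm _ hj1, integral_prod_symm _ hj2]
  congr 1 with z
  simp only [Function.update_self]
  exact integral_mul_gaussianReal_eq (fun x => hd z x) (hf'.comp (hu z)) (fun x => hfB _)
    (fun x => hfB' _)

variable {S : Type*} [Fintype S]

/-- `Φ` has directional derivatives `Φ₁ v` and second directional derivatives `Φ₂ v`, which are
bounded and continuous. -/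
structure HasBoundedDerivs (Φ : (S → ℝ) → ℝ) (Φ₁ Φ₂ : (S → ℝ) → (S → ℝ) → ℝ) : Prop where
  deriv₁ : ∀ (Y : ℝ → S → ℝ) (Y' : S → ℝ) (x : ℝ), HasDerivAt Y Y' x →
    HasDerivAt (fun s => Φ (Y s)) (Φ₁ Y' (Y x)) x
  deriv₂ : ∀ (v Y : S → ℝ) (x : ℝ),
    HasDerivAt (fun s : ℝ => Φ₁ v (Y + s • v)) (Φ₂ v (Y + x • v)) x
  add : ∀ v w Y, Φ₁ (v + w) Y = Φ₁ v Y + Φ₁ w Y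
  smul : ∀ (r : ℝ) v Y, Φ₁ (r • v) Y = r * Φ₁ v Y
  cont : Continuous Φ
  cont₁ : ∀ v, Continuous (Φ₁ v)
  cont₂ : ∀ v, Continuous (Φ₂ v)
  growth : ∃ B, ∀ Y, |Φ Y| ≤ B * (1 + ∑ σ, |Y σ|)
  bdd₁ : ∀ v, ∃ B, ∀ Y, |Φ₁ v Y| ≤ B
  bdd₂ : ∀ v, ∃ B, ∀ Y, |Φ₂ v Y| ≤ B

theorem HasBoundedDerivs.map_sum {Φ : (S → ℝ) → ℝ} {Φ₁ Φ₂ : (S → ℝ) → (S → ℝ) → ℝ}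
    (h : HasBoundedDerivs Φ Φ₁ Φ₂) {L : Type*} (s : Finset L) (r : L → ℝ) (v : L → S → ℝ)
    (Y : S → ℝ) : Φ₁ (∑ l ∈ s, r l • v l) Y = ∑ l ∈ s, r l * Φ₁ (v l) Y := by
  classical
  induction s using Finset.induction_on with
  | empty => simpa using h.smul 0 0 Y
  | insert l s hl ih => rw [Finset.sum_insert hl, Finset.sum_insert hl, h.add, h.smul, ih]

/-- The random field with features `φ`, coefficients `a` and bias `b`. -/
def featureField {L : Type*} [Fintype L] (b : S → ℝ) (φ : L → S → ℝ) (a g : L → ℝ) : S → ℝ :=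
  b + ∑ l, (a l * g l) • φ l

theorem continuous_featureField {S L : Type*} [Fintype L] (b : S → ℝ) (φ : L → S → ℝ) (a : L → ℝ) :
    Continuous (featureField b φ a) := by
  unfold featureField
  fun_prop

theorem HasBoundedDerivs.integrable_featureField {Φ : (S → ℝ) → ℝ}
    {Φ₁ Φ₂ : (S → ℝ) → (S → ℝ) → ℝ}
    (h : HasBoundedDerivs Φ Φ₁ Φ₂) {L : Type*} [Fintype L] (b : S → ℝ)
    (φ : L → S → ℝ) (a : L → ℝ) :
    Integrable (fun g => Φ (featureField b φ a g)) (stdGauss L) := by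
  obtain ⟨B, hB⟩ := h.growth
  have hint : Integrable (fun g : L → ℝ =>
      |B| * (1 + ∑ σ, (|b σ| + ∑ l, |a l * φ l σ| * |g l|))) (stdGauss L) := by
    refine Integrable.const_mul (Integrable.add (integrable_const _)
      (integrable_finsetSum _ fun σ _ => Integrable.add (integrable_const _)
        (integrable_finsetSum _ fun l _ => ?_))) _
    exact ((integrable_abs_eval_stdGauss l).abs).const_mul _
  refine hint.mono' (h.cont.comp (continuous_featureField b φ a)).aestronglyMeasurable
    (Filter.Eventually.of_forall fun g => ?_)
  rw [Real.norm_eq_abs]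
  have hpos : 0 ≤ ∑ σ, |featureField b φ a g σ| := Finset.sum_nonneg fun _ _ => abs_nonneg _
  refine (hB _).trans ((mul_le_mul_of_nonneg_right (le_abs_self B) (by positivity)).trans ?_)
  gcongr with σ
  simp only [featureField, Pi.add_apply, Finset.sum_apply, Pi.smul_apply, smul_eq_mul]
  refine (abs_add_le _ _).trans ?_
  gcongr
  refine (Finset.abs_sum_le_sum_abs _ _).trans (Finset.sum_le_sum fun l _ => ?_)
  rw [← abs_mul]
  apply le_of_eq
  congr 1
  ring

/-- Derivative of a Gaussian average along a path of coefficients of the features. -/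
theorem HasBoundedDerivs.hasDerivAt_integral {Φ : (S → ℝ) → ℝ} {Φ₁ Φ₂ : (S → ℝ) → (S → ℝ) → ℝ}
    (h : HasBoundedDerivs Φ Φ₁ Φ₂) {L : Type*} [Fintype L] (b : S → ℝ) (φ : L → S → ℝ)
    (a a' : ℝ → L → ℝ) (u₀ A : ℝ)
    (ha : ∀ᶠ u in 𝓝 u₀, ∀ l, HasDerivAt (fun u => a u l) (a' u l) u ∧ |a' u l| ≤ A) :
    HasDerivAt (fun u => ∫ g, Φ (featureField b φ (a u) g) ∂stdGauss L)
      (∑ l, a u₀ l * a' u₀ l * ∫ g, Φ₂ (φ l) (featureField b φ (a u₀) g) ∂stdGauss L) u₀ := by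
  classical
  choose B₁ hB₁ using fun l => h.bdd₁ (φ l)
  choose B₂ hB₂ using fun l => h.bdd₂ (φ l)
  have hcont : ∀ (l : L) (u : ℝ), Continuous fun g => Φ₁ (φ l) (featureField b φ (a u) g) :=
    fun l u => (h.cont₁ _).comp (continuous_featureField b φ _)
  have key := (hasDerivAt_integral_of_dominated_loc_of_deriv_le (μ := stdGauss L)
    (F := fun u g => Φ (featureField b φ (a u) g))
    (F' := fun u g => ∑ l, (a' u l * g l) * Φ₁ (φ l) (featureField b φ (a u) g))
    (bound := fun g => ∑ l, A * |g l| * B₁ l) (x₀ := u₀) ha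
    (Filter.Eventually.of_forall fun u =>
      (h.cont.comp (continuous_featureField b φ _)).aestronglyMeasurable)
    (h.integrable_featureField b φ _)
    (Continuous.aestronglyMeasurable (by
      refine continuous_finsetSum _ fun l _ => ?_
      exact ((continuous_const.mul (continuous_apply l)).mul (hcont l u₀))))
    (Filter.Eventually.of_forall fun g u hu => by
      rw [Real.norm_eq_abs]
      refine (Finset.abs_sum_le_sum_abs _ _).trans (Finset.sum_le_sum fun l _ => ?_)
      rw [abs_mul, abs_mul]
      have := (hu l).2
      have hA : 0 ≤ A := (abs_nonneg _).trans this
      gcongr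
      exact hB₁ l _)
    (integrable_finsetSum _ fun l _ =>
      (((integrable_abs_eval_stdGauss l).abs).const_mul A).mul_const _)
    (Filter.Eventually.of_forall fun g u hu => by
      have hY : HasDerivAt (fun u => featureField b φ (a u) g)
          (∑ l, (a' u l * g l) • φ l) u := by
        unfold featureField
        exact (HasDerivAt.fun_sum fun l _ =>
          (((hu l).1).mul_const (g l)).smul_const (φ l)).const_add b
      have := h.deriv₁ _ _ u hY
      rwa [h.map_sum] at this)).2
  refine key.congr_deriv ?_
  rw [integral_finsetSum]
  · refine Finset.sum_congr rfl fun l _ => ?_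
    -- Integration by parts trades the factor `g l` for a derivative in `g l`. The field being
    -- affine in `g l` with slope `a u₀ l • φ l`, this produces `a u₀ l * Φ₂ (φ l)`, hence the
    -- weight `a * a'`.
    have hst := integral_mul_stdGauss_eq l
      (f := fun g => Φ₁ (φ l) (featureField b φ (a u₀) g))
      (f' := fun g => a u₀ l * Φ₂ (φ l) (featureField b φ (a u₀) g))
      (B := max (B₁ l) (|a u₀ l| * B₂ l)) ?_ (hcont l u₀)
      (continuous_const.mul ((h.cont₂ _).comp (continuous_featureField b φ _)))
      (fun g => (hB₁ l _).trans (le_max_left _ _))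
      (fun g => by
        rw [abs_mul]
        exact (mul_le_mul_of_nonneg_left (hB₂ l _) (abs_nonneg _)).trans (le_max_right _ _))
    · simp only [mul_assoc]
      rw [integral_const_mul, hst, integral_const_mul]
      ring
    · intro g x
      have hf : ∀ y, featureField b φ (a u₀) (Function.update g l y) =
          featureField b φ (a u₀) (Function.update g l 0) + (a u₀ l * y) • φ l := by
        intro y
        simp only [featureField, ← Finset.add_sum_erase _ _ (Finset.mem_univ l),
          Function.update_self, mul_zero, zero_smul, zero_add]
        have hs : ∑ i ∈ Finset.univ.erase l, (a u₀ i * Function.update g l y i) • φ i =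
            ∑ i ∈ Finset.univ.erase l, (a u₀ i * Function.update g l 0 i) • φ i :=
          Finset.sum_congr rfl fun i hi => by
            rw [Function.update_of_ne (Finset.ne_of_mem_erase hi),
              Function.update_of_ne (Finset.ne_of_mem_erase hi)]
        rw [hs]
        abel
      have hf' : (fun y => Φ₁ (φ l) (featureField b φ (a u₀) (Function.update g l y))) =
          fun y => Φ₁ (φ l) (featureField b φ (a u₀) (Function.update g l 0) +
            (a u₀ l * y) • φ l) := funext fun y => by rw [hf y]
      rw [hf', hf x]
      have h1 := h.deriv₂ (φ l) (featureField b φ (a u₀) (Function.update g l 0)) (a u₀ l * x)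
      have h2 : HasDerivAt (fun y => a u₀ l * y) (a u₀ l) x := by
        simpa using (hasDerivAt_id x).const_mul (a u₀ l)
      have := HasDerivAt.comp x h1 h2
      rw [mul_comm]
      exact this
  · intro l _
    exact (((integrable_abs_eval_stdGauss l).const_mul _)).mul_bdd (c := B₁ l)
      (hcont l u₀).aestronglyMeasurable
      (Filter.Eventually.of_forall fun x => by simpa using hB₁ l _)

end SpinGlass

/-! ### Gaussian fields on a finite index set. -/

namespace SpinGlass

/-- `X` is a centered Gaussian field, indexed by the finite set `S`, with covariance `C`. -/
structure IsGaussianField {Ω S : Type*} [MeasurableSpace Ω] [Fintype S] (μ : Measure Ω)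
    (X : Ω → S → ℝ) (C : Matrix S S ℝ) : Prop where
  measurable : Measurable X
  posSemidef : C.PosSemidef
  integral_cexp : ∀ c : S → ℝ, ∫ ω, Complex.exp (((∑ σ, c σ * X ω σ : ℝ) : ℂ) * Complex.I) ∂μ =
    Complex.exp ((-(∑ σ, ∑ τ, c σ * c τ * C σ τ) / 2 : ℝ) : ℂ)

variable {Ω Ω' S T : Type*} [MeasurableSpace Ω] [MeasurableSpace Ω'] [Fintype S] [Fintype T]
  {μ : Measure Ω} {ν : Measure Ω'}

theorem isGaussianField_multivariateGaussian [DecidableEq S] {C : Matrix S S ℝ}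
    (hC : C.PosSemidef) :
    IsGaussianField (multivariateGaussian 0 C) (fun x σ => x σ) C := by
  refine ⟨by fun_prop, hC, fun c => ?_⟩
  have h := charFun_multivariateGaussian (μ := 0) hC (WithLp.toLp 2 c)
  rw [charFun_apply] at h
  have e1 : ∀ x : EuclideanSpace ℝ S,
      inner ℝ x (WithLp.toLp 2 c) = ∑ σ, c σ * x σ := fun x => by
    simp [PiLp.inner_apply]
  simp only [e1] at h
  rw [h]
  congr 1
  simp only [inner_zero_right, Complex.ofReal_zero, zero_mul, zero_sub, dotProduct,
    Matrix.mulVec, neg_div]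
  push_cast
  congr 2
  refine Finset.sum_congr rfl fun σ _ => ?_
  rw [Finset.mul_sum]
  refine Finset.sum_congr rfl fun τ _ => ?_
  ring

/-- The characteristic function involves only the covariance. Averages can therefore be computed
with whichever realisation of the field is convenient, in particular with features and independent
standard Gaussian coefficients. -/
theorem IsGaussianField.map_eq [IsFiniteMeasure μ] [IsFiniteMeasure ν] {X : Ω → S → ℝ}
    {Y : Ω' → S → ℝ} {C : Matrix S S ℝ}
    (hX : IsGaussianField μ X C) (hY : IsGaussianField ν Y C) : μ.map X = ν.map Y := by
  have hm : Measurable (WithLp.toLp 2 : (S → ℝ) → EuclideanSpace ℝ S) := by fun_prop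
  have hm' : Measurable (WithLp.ofLp : EuclideanSpace ℝ S → (S → ℝ)) := by fun_prop
  have key : (μ.map X).map (WithLp.toLp 2 : (S → ℝ) → EuclideanSpace ℝ S) =
      (ν.map Y).map (WithLp.toLp 2 : (S → ℝ) → EuclideanSpace ℝ S) := by
    apply Measure.ext_of_charFun
    ext t
    rw [charFun_apply, charFun_apply, Measure.map_map hm hX.measurable,
      Measure.map_map hm hY.measurable,
      integral_map (hm.comp hX.measurable).aemeasurable (by fun_prop),
      integral_map (hm.comp hY.measurable).aemeasurable (by fun_prop)]
    have e1 : ∀ x : S → ℝ,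
        inner ℝ (WithLp.toLp 2 x) t = ∑ σ, t σ * x σ := fun x => by
      simp [PiLp.inner_apply]
    simp only [Function.comp_apply, e1]
    rw [hX.integral_cexp, hY.integral_cexp]
  have := congrArg (fun m => m.map (WithLp.ofLp : EuclideanSpace ℝ S → (S → ℝ))) key
  simpa only [Measure.map_map hm' hm, Function.comp_def, Measure.map_id'] using this

theorem IsGaussianField.integral_eq [IsFiniteMeasure μ] [IsFiniteMeasure ν] {X : Ω → S → ℝ}
    {Y : Ω' → S → ℝ} {C : Matrix S S ℝ}
    (hX : IsGaussianField μ X C) (hY : IsGaussianField ν Y C) {Φ : (S → ℝ) → ℝ}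
    (hΦ : Measurable Φ) : ∫ ω, Φ (X ω) ∂μ = ∫ ω, Φ (Y ω) ∂ν := by
  rw [← integral_map hX.measurable.aemeasurable hΦ.aestronglyMeasurable,
    ← integral_map hY.measurable.aemeasurable hΦ.aestronglyMeasurable, hX.map_eq hY]

theorem IsGaussianField.integrable_iff [IsFiniteMeasure μ] [IsFiniteMeasure ν] {X : Ω → S → ℝ}
    {Y : Ω' → S → ℝ} {C : Matrix S S ℝ}
    (hX : IsGaussianField μ X C) (hY : IsGaussianField ν Y C) {Φ : (S → ℝ) → ℝ}
    (hΦ : Measurable Φ) : Integrable (fun ω => Φ (X ω)) μ ↔ Integrable (fun ω => Φ (Y ω)) ν := by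
  have h1 := integrable_map_measure (μ := μ) (f := X) (g := Φ) hΦ.aestronglyMeasurable
    hX.measurable.aemeasurable
  have h2 := integrable_map_measure (μ := ν) (f := Y) (g := Φ) hΦ.aestronglyMeasurable
    hY.measurable.aemeasurable
  rw [hX.map_eq hY, h2] at h1
  exact h1.symm

/-- Transport along a reindexing followed by a multiplication. -/
theorem IsGaussianField.pullback {X : Ω → S → ℝ} {C : Matrix S S ℝ}
    (hX : IsGaussianField μ X C) (p : T → S) (r : T → ℝ) :
    IsGaussianField μ (fun ω a => r a * X ω (p a)) (Matrix.of fun a b => r a * r b * C (p a) (p b)) := by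
  classical
  refine ⟨?_, ?_, fun c => ?_⟩
  · have := hX.measurable
    refine measurable_pi_iff.2 fun a => ?_
    exact ((measurable_pi_apply (p a)).comp this).const_mul _
  · have h1 := (hX.posSemidef.submatrix p).mul_mul_conjTranspose_same (Matrix.diagonal r)
    convert h1 using 1
    ext a b
    simp [Matrix.mul_diagonal, Matrix.diagonal_mul]
    ring
  -- A linear form in the pulled-back field is a linear form in `X`, with coefficients summed over
  -- the fibres of `p`.
  · set d : S → ℝ := fun σ => ∑ a with p a = σ, c a * r a with hd
    have e : ∀ f : S → ℝ, ∑ a, c a * (r a * f (p a)) = ∑ σ, d σ * f σ := by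
      intro f
      rw [← Finset.sum_fiberwise (s := Finset.univ) (g := p)]
      refine Finset.sum_congr rfl fun σ _ => ?_
      rw [hd, Finset.sum_mul]
      refine Finset.sum_congr rfl fun a ha => ?_
      rw [(Finset.mem_filter.1 ha).2]
      ring
    have e2 : ∑ a, ∑ b, c a * c b * (Matrix.of fun a b => r a * r b * C (p a) (p b)) a b =
        ∑ σ, ∑ τ, d σ * d τ * C σ τ := by
      have h1 : ∀ a, ∑ b, c a * c b * (Matrix.of fun a b => r a * r b * C (p a) (p b)) a b =
          c a * (r a * ∑ τ, d τ * C (p a) τ) := by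
        intro a
        rw [← e, Finset.mul_sum, Finset.mul_sum]
        refine Finset.sum_congr rfl fun b _ => ?_
        simp only [Matrix.of_apply]
        ring
      rw [Finset.sum_congr rfl fun a _ => h1 a, e fun σ => ∑ τ, d τ * C σ τ]
      refine Finset.sum_congr rfl fun σ _ => ?_
      rw [Finset.mul_sum]
      refine Finset.sum_congr rfl fun τ _ => ?_
      ring
    simp only [e, e2]
    exact hX.integral_cexp d

theorem IsGaussianField.smul {X : Ω → S → ℝ} {C : Matrix S S ℝ}
    (hX : IsGaussianField μ X C) (r : ℝ) :
    IsGaussianField μ (fun ω a => r * X ω a) (r ^ 2 • C) := by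
  have h : r ^ 2 • C = Matrix.of fun a b => r * r * C (id a) (id b) := by
    ext a b
    change r ^ 2 * C a b = r * r * C a b
    rw [sq]
  rw [h]
  exact hX.pullback (T := S) id fun _ => r

/-- The sum of two independent Gaussian fields. -/
theorem IsGaussianField.add_prod [IsProbabilityMeasure μ] [IsProbabilityMeasure ν]
    {X : Ω → S → ℝ} {Y : Ω' → S → ℝ}
    {C D : Matrix S S ℝ} (hX : IsGaussianField μ X C) (hY : IsGaussianField ν Y D) :
    IsGaussianField (μ.prod ν) (fun ω σ => X ω.1 σ + Y ω.2 σ) (C + D) := by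
  refine ⟨?_, hX.posSemidef.add hY.posSemidef, fun c => ?_⟩
  · have h1 := hX.measurable
    have h2 := hY.measurable
    refine measurable_pi_iff.2 fun a => ?_
    exact ((measurable_pi_apply a).comp (h1.comp measurable_fst)).add
      ((measurable_pi_apply a).comp (h2.comp measurable_snd))
  · simp only [mul_add, Finset.sum_add_distrib, Complex.ofReal_add, add_mul, Complex.exp_add]
    rw [integral_prod_mul (fun ω => Complex.exp (((∑ σ, c σ * X ω σ : ℝ) : ℂ) * Complex.I))
      (fun ω => Complex.exp (((∑ σ, c σ * Y ω σ : ℝ) : ℂ) * Complex.I)), hX.integral_cexp,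
      hY.integral_cexp, ← Complex.exp_add, ← Complex.ofReal_add]
    congr 2
    simp only [Matrix.add_apply, mul_add, Finset.sum_add_distrib]
    ring

/-- A sum of independent Gaussian fields depending on finitely many coordinates. -/
theorem isGaussianField_infinitePi {ι J : Type*} [Fintype J] {Ω : ι → Type*}
    [∀ i, MeasurableSpace (Ω i)] {ν : ∀ i, Measure (Ω i)} [∀ i, IsProbabilityMeasure (ν i)]
    {e : J → ι} (he : e.Injective) {X : ∀ j, Ω (e j) → S → ℝ} {C : J → Matrix S S ℝ}
    (hX : ∀ j, IsGaussianField (ν (e j)) (X j) (C j)) :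
    IsGaussianField (Measure.infinitePi ν) (fun ω σ => ∑ j, X j (ω (e j)) σ) (∑ j, C j) := by
  have hmeas : ∀ j, Measurable fun ω : ∀ i, Ω i => X j (ω (e j)) := fun j =>
    (hX j).measurable.comp (measurable_pi_apply _)
  refine ⟨?_, Matrix.posSemidef_sum _ fun j _ => (hX j).posSemidef, fun c => ?_⟩
  · refine measurable_pi_iff.2 fun a => ?_
    exact Finset.measurable_sum _ fun j _ => (measurable_pi_apply a).comp (hmeas j)
  · have hind : iIndepFun (fun j (ω : ∀ i, Ω i) => ω (e j)) (Measure.infinitePi ν) :=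
      (iIndepFun_infinitePi (P := ν) (X := fun i x => x) fun i => measurable_id).precomp he
    have hprod := hind.integral_fun_prod_comp
      (f := fun j x => Complex.exp (((∑ σ, c σ * X j x σ : ℝ) : ℂ) * Complex.I))
      (fun j => (measurable_pi_apply _).aemeasurable) (fun j => by
        have := (hX j).measurable
        refine Measurable.aestronglyMeasurable ?_
        refine Complex.measurable_exp.comp (Measurable.mul_const ?_ _)
        refine Complex.measurable_ofReal.comp (Finset.measurable_sum _ fun σ _ => ?_)
        exact ((measurable_pi_apply σ).comp this).const_mul _)
    have e1 : ∀ ω : ∀ i, Ω i,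
        Complex.exp (((∑ σ, c σ * ∑ j, X j (ω (e j)) σ : ℝ) : ℂ) * Complex.I) =
        ∏ j, Complex.exp (((∑ σ, c σ * X j (ω (e j)) σ : ℝ) : ℂ) * Complex.I) := by
      intro ω
      rw [← Complex.exp_sum, ← Finset.sum_mul, ← Complex.ofReal_sum]
      simp only [Finset.mul_sum]
      rw [Finset.sum_comm]
    have e2 : ∀ j, ∫ ω, Complex.exp (((∑ σ, c σ * X j (ω (e j)) σ : ℝ) : ℂ) * Complex.I)
        ∂Measure.infinitePi ν =
        Complex.exp ((-(∑ σ, ∑ τ, c σ * c τ * C j σ τ) / 2 : ℝ) : ℂ) := by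
      intro j
      rw [← (hX j).integral_cexp c]
      have hmp := measurePreserving_eval_infinitePi ν (e j)
      rw [← hmp.map_eq, integral_map hmp.measurable.aemeasurable]
      · rw [hmp.map_eq]
        have := (hX j).measurable
        refine Measurable.aestronglyMeasurable ?_
        refine Complex.measurable_exp.comp (Measurable.mul_const ?_ _)
        refine Complex.measurable_ofReal.comp (Finset.measurable_sum _ fun σ _ => ?_)
        exact ((measurable_pi_apply σ).comp this).const_mul _
    simp only [e1]
    rw [hprod]
    simp only [e2]
    rw [← Complex.exp_sum, ← Complex.ofReal_sum]
    congr 2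
    rw [← Finset.sum_div, Finset.sum_neg_distrib]
    congr 2
    simp only [Matrix.sum_apply, Finset.mul_sum]
    rw [Finset.sum_comm]
    refine Finset.sum_congr rfl fun σ _ => ?_
    rw [Finset.sum_comm]

theorem isGaussianField_gaussianReal (φ : S → ℝ) :
    IsGaussianField (gaussianReal 0 1) (fun x σ => x * φ σ)
      (Matrix.of fun σ τ => φ σ * φ τ) := by
  refine ⟨by fun_prop, ?_, fun c => ?_⟩
  · have := Matrix.posSemidef_vecMulVec_self_star φ
    convert this using 1
    ext σ τ
    simp [Matrix.vecMulVec_apply]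
  · have h := charFun_gaussianReal (μ := 0) (v := 1) (∑ σ, c σ * φ σ)
    rw [charFun_apply_real] at h
    have e : ∀ x : ℝ, ((∑ σ, c σ * (x * φ σ) : ℝ) : ℂ) =
        ((∑ σ, c σ * φ σ : ℝ) : ℂ) * (x : ℂ) := by
      intro x
      rw [← Complex.ofReal_mul, Finset.sum_mul]
      congr 1
      exact Finset.sum_congr rfl fun σ _ => by ring
    simp only [e]
    rw [h]
    congr 1
    have e2 : ∑ σ, ∑ τ, c σ * c τ * (Matrix.of fun σ τ => φ σ * φ τ) σ τ =
        (∑ σ, c σ * φ σ) ^ 2 := by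
      rw [sq, Finset.sum_mul_sum]
      refine Finset.sum_congr rfl fun σ _ => Finset.sum_congr rfl fun τ _ => ?_
      simp only [Matrix.of_apply]
      ring
    rw [e2]
    push_cast
    ring

/-- The covariance of the field with features `φ` and coefficients `a`. -/
def featureCov {S L : Type*} [Fintype L] (φ : L → S → ℝ) (a : L → ℝ) : Matrix S S ℝ :=
  Matrix.of fun σ τ => ∑ l, a l ^ 2 * φ l σ * φ l τ

theorem featureCov_apply {S L : Type*} [Fintype L] (φ : L → S → ℝ) (a : L → ℝ) (σ τ : S) :
    featureCov φ a σ τ = ∑ l, a l ^ 2 * φ l σ * φ l τ := rfl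

theorem isGaussianField_featureField {L : Type*} [Fintype L] (φ : L → S → ℝ) (a : L → ℝ) :
    IsGaussianField (stdGauss L) (featureField 0 φ a) (featureCov φ a) := by
  have h := isGaussianField_infinitePi (ν := fun _ : L => gaussianReal 0 1) (e := fun l : L => l)
    Function.injective_id
    fun l => ((isGaussianField_gaussianReal (φ l)).smul (a l))
  rw [Measure.infinitePi_eq_pi] at h
  convert h using 1
  · ext g σ
    simp [featureField, mul_assoc]
  · ext σ τ
    simp [featureCov, Matrix.sum_apply, mul_assoc]

open scoped MatrixOrder Matrix.Norms.L2Operator in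
/-- A covariance matrix is the covariance of some features. -/
theorem exists_featureCov_eq {C : Matrix S S ℝ} (hC : C.PosSemidef) :
    ∃ φ : S → S → ℝ, ∀ a : ℝ, featureCov φ (fun _ => a) = a ^ 2 • C := by
  classical
  obtain ⟨B, hB⟩ : ∃ B : Matrix S S ℝ, C = star B * B :=
    CStarAlgebra.nonneg_iff_eq_star_mul_self.mp hC.nonneg
  refine ⟨fun k σ => B k σ, fun a => ?_⟩
  ext σ τ
  rw [hB]
  simp [featureCov, Matrix.mul_apply, Matrix.star_eq_conjTranspose, Finset.mul_sum, mul_assoc]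

end SpinGlass

/-! ### Gibbs averages, free energies and Gaussian interpolation. -/

namespace SpinGlass

variable {S T : Type*} [Fintype S] [Fintype T]

/-- The log-partition function of the energies `Y`. -/
def logZ (Y : S → ℝ) : ℝ := Real.log (∑ σ, Real.exp (Y σ))

/-- The Gibbs average of `A` with respect to the weights `exp Y`. -/
def gibbs (Y A : S → ℝ) : ℝ := (∑ σ, A σ * Real.exp (Y σ)) / ∑ σ, Real.exp (Y σ)

theorem sum_exp_pos [Nonempty S] (Y : S → ℝ) : 0 < ∑ σ, Real.exp (Y σ) :=
  Finset.sum_pos (fun _ _ => Real.exp_pos _) Finset.univ_nonempty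

theorem gibbs_add (Y A B : S → ℝ) : gibbs Y (A + B) = gibbs Y A + gibbs Y B := by
  simp [gibbs, add_mul, Finset.sum_add_distrib, add_div]

theorem gibbs_smul (Y A : S → ℝ) (r : ℝ) : gibbs Y (r • A) = r * gibbs Y A := by
  simp only [gibbs, Pi.smul_apply, smul_eq_mul, mul_assoc, ← Finset.mul_sum, mul_div_assoc]

theorem gibbs_sum {L : Type*} (s : Finset L) (Y : S → ℝ) (A : L → S → ℝ) :
    gibbs Y (fun σ => ∑ l ∈ s, A l σ) = ∑ l ∈ s, gibbs Y (A l) := by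
  simp only [gibbs, Finset.sum_mul, ← Finset.sum_div]
  rw [Finset.sum_comm]

theorem gibbs_const_mul (Y A : S → ℝ) (r : ℝ) : gibbs Y (fun σ => r * A σ) = r * gibbs Y A :=
  gibbs_smul Y A r

theorem gibbs_mul_const (Y A : S → ℝ) (r : ℝ) : gibbs Y (fun σ => A σ * r) = gibbs Y A * r := by
  rw [mul_comm, ← gibbs_const_mul]
  simp only [mul_comm]

theorem gibbs_sub (Y A B : S → ℝ) :
    gibbs Y (fun σ => A σ - B σ) = gibbs Y A - gibbs Y B := by
  simp [gibbs, sub_mul, Finset.sum_sub_distrib, sub_div]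

theorem gibbs_const [Nonempty S] (Y : S → ℝ) (r : ℝ) : gibbs Y (fun _ => r) = r := by
  rw [gibbs, ← Finset.mul_sum, mul_div_assoc, div_self (sum_exp_pos Y).ne', mul_one]

theorem gibbs_mono {Y A B : S → ℝ} (h : ∀ σ, A σ ≤ B σ) : gibbs Y A ≤ gibbs Y B := by
  unfold gibbs
  gcongr with σ
  exact h σ

theorem abs_gibbs_le [Nonempty S] {Y A : S → ℝ} {B : ℝ} (h : ∀ σ, |A σ| ≤ B) :
    |gibbs Y A| ≤ B := by
  rw [abs_le]
  constructor
  · rw [← gibbs_const Y (-B)]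
    exact gibbs_mono fun σ => (abs_le.1 (h σ)).1
  · rw [← gibbs_const Y B]
    exact gibbs_mono fun σ => (abs_le.1 (h σ)).2

theorem exists_abs_gibbs_le [Nonempty S] (A : S → ℝ) : ∃ B, ∀ Y, |gibbs Y A| ≤ B :=
  ⟨∑ σ, |A σ|, fun _ => abs_gibbs_le fun σ =>
    Finset.single_le_sum (f := fun σ => |A σ|) (fun _ _ => abs_nonneg _) (Finset.mem_univ σ)⟩

theorem continuous_gibbs [Nonempty S] (A : S → ℝ) : Continuous fun Y => gibbs Y A := by
  unfold gibbs
  exact Continuous.div (by fun_prop) (by fun_prop) fun Y => (sum_exp_pos Y).ne'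

theorem continuous_logZ [Nonempty S] : Continuous (logZ : (S → ℝ) → ℝ) := by
  unfold logZ
  exact Continuous.log (by fun_prop) fun Y => (sum_exp_pos Y).ne'

theorem hasDerivAt_sum_exp {Y : ℝ → S → ℝ} {Y' : S → ℝ} {x : ℝ} (hY : HasDerivAt Y Y' x)
    (A : S → ℝ) :
    HasDerivAt (fun s => ∑ σ, A σ * Real.exp (Y s σ)) (∑ σ, A σ * Y' σ * Real.exp (Y x σ)) x := by
  refine HasDerivAt.fun_sum fun σ _ => ?_
  have := ((hasDerivAt_pi.1 hY σ).exp).const_mul (A σ)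
  refine this.congr_deriv ?_
  ring

theorem hasDerivAt_logZ [Nonempty S] {Y : ℝ → S → ℝ} {Y' : S → ℝ} {x : ℝ}
    (hY : HasDerivAt Y Y' x) : HasDerivAt (fun s => logZ (Y s)) (gibbs (Y x) Y') x := by
  have h := (hasDerivAt_sum_exp hY (fun _ => 1)).log
    (by simpa using (sum_exp_pos (Y x)).ne')
  simpa [logZ, gibbs] using h

theorem hasDerivAt_gibbs [Nonempty S] {Y : ℝ → S → ℝ} {Y' : S → ℝ} {x : ℝ}
    (hY : HasDerivAt Y Y' x) (A : S → ℝ) :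
    HasDerivAt (fun s => gibbs (Y s) A) (gibbs (Y x) (A * Y') - gibbs (Y x) A * gibbs (Y x) Y') x := by
  have h1 := hasDerivAt_sum_exp hY A
  have h2 := hasDerivAt_sum_exp hY (fun _ => 1)
  simp only [one_mul] at h2
  have hpos := (sum_exp_pos (Y x)).ne'
  refine (h1.div h2 hpos).congr_deriv ?_
  simp only [gibbs, Pi.mul_apply]
  field_simp

theorem abs_logZ_le [Nonempty S] (Y : S → ℝ) :
    |logZ Y| ≤ Real.log (Fintype.card S) + ∑ σ, |Y σ| := by
  have hcard : (1 : ℝ) ≤ Fintype.card S := by exact_mod_cast Fintype.card_pos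
  have hl : 0 ≤ Real.log (Fintype.card S) := Real.log_nonneg hcard
  have hle : ∀ σ, |Y σ| ≤ ∑ σ, |Y σ| := fun σ =>
    Finset.single_le_sum (f := fun σ => |Y σ|) (fun _ _ => abs_nonneg _) (Finset.mem_univ σ)
  rw [abs_le]
  constructor
  · obtain ⟨σ⟩ := ‹Nonempty S›
    have h1 : Y σ ≤ logZ Y := by
      rw [logZ, Real.le_log_iff_exp_le (Finset.sum_pos (fun _ _ => Real.exp_pos _) ⟨σ, Finset.mem_univ _⟩)]
      exact Finset.single_le_sum (f := fun σ => Real.exp (Y σ)) (fun _ _ => (Real.exp_pos _).le)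
        (Finset.mem_univ σ)
    have := hle σ
    have := neg_abs_le (Y σ)
    linarith
  · have h1 : ∑ σ, Real.exp (Y σ) ≤ Fintype.card S * Real.exp (∑ σ, |Y σ|) := by
      have : ∑ σ, Real.exp (Y σ) ≤ ∑ _σ : S, Real.exp (∑ σ, |Y σ|) :=
        Finset.sum_le_sum fun σ _ => Real.exp_le_exp.2 ((le_abs_self _).trans (hle σ))
      simpa using this
    rw [logZ]
    refine (Real.log_le_log (sum_exp_pos Y) h1).trans ?_
    rw [Real.log_mul (by positivity) (Real.exp_pos _).ne', Real.log_exp]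

/-- The first derivative of `logZ` is a Gibbs mean and the second is the Gibbs variance of the
direction; both are bounded because `S` is finite. -/
theorem hasBoundedDerivs_logZ [Nonempty S] :
    HasBoundedDerivs (S := S) logZ (fun v Y => gibbs Y v)
      (fun v Y => gibbs Y (v * v) - gibbs Y v * gibbs Y v) where
  deriv₁ Y Y' x hY := hasDerivAt_logZ hY
  deriv₂ v Y x := by
    refine hasDerivAt_gibbs (Y := fun s : ℝ => Y + s • v) ?_ v
    simpa using ((hasDerivAt_id x).smul_const v).const_add Y
  add v w Y := gibbs_add Y v w
  smul r v Y := gibbs_smul Y v r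
  cont := continuous_logZ
  cont₁ := continuous_gibbs
  cont₂ v := (continuous_gibbs _).sub ((continuous_gibbs _).mul (continuous_gibbs _))
  growth := by
    refine ⟨Real.log (Fintype.card S) + 1, fun Y => (abs_logZ_le Y).trans ?_⟩
    have hcard : (1 : ℝ) ≤ Fintype.card S := by exact_mod_cast Fintype.card_pos
    have hl : 0 ≤ Real.log (Fintype.card S) := Real.log_nonneg hcard
    have hs : 0 ≤ ∑ σ, |Y σ| := Finset.sum_nonneg fun _ _ => abs_nonneg _
    nlinarith [mul_nonneg hl hs]
  bdd₁ := exists_abs_gibbs_le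
  bdd₂ v := by
    obtain ⟨B, hB⟩ := exists_abs_gibbs_le (v * v)
    obtain ⟨B', hB'⟩ := exists_abs_gibbs_le v
    refine ⟨B + B' * B', fun Y => (abs_sub _ _).trans (add_le_add (hB Y) ?_)⟩
    rw [abs_mul]
    exact mul_le_mul (hB' Y) (hB' Y) (abs_nonneg _) ((abs_nonneg _).trans (hB' Y))

/-- The second derivative of `⟨A⟩²` in the direction `v`. -/
def gibbsSq₂ (A v Y : S → ℝ) : ℝ :=
  2 * ((gibbs Y (A * v) - gibbs Y A * gibbs Y v) * (gibbs Y (A * v) - gibbs Y A * gibbs Y v) +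
    gibbs Y A * ((gibbs Y (A * v * v) - gibbs Y (A * v) * gibbs Y v) -
      ((gibbs Y (A * v) - gibbs Y A * gibbs Y v) * gibbs Y v +
        gibbs Y A * (gibbs Y (v * v) - gibbs Y v * gibbs Y v))))

theorem abs_gibbsSq₂_le [Nonempty S] {A v : S → ℝ} {a b : ℝ} (hA : ∀ σ, |A σ| ≤ a)
    (hv : ∀ σ, |v σ| ≤ b) (Y : S → ℝ) : |gibbsSq₂ A v Y| ≤ 20 * a ^ 2 * b ^ 2 := by
  obtain ⟨σ₀⟩ := ‹Nonempty S›
  have ha : 0 ≤ a := (abs_nonneg _).trans (hA σ₀)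
  have hb : 0 ≤ b := (abs_nonneg _).trans (hv σ₀)
  have : Nonempty S := ⟨σ₀⟩
  have hAv : ∀ σ, |(A * v) σ| ≤ a * b := fun σ => by
    rw [Pi.mul_apply, abs_mul]
    exact mul_le_mul (hA σ) (hv σ) (abs_nonneg _) ha
  have hAvv : ∀ σ, |(A * v * v) σ| ≤ a * b * b := fun σ => by
    rw [Pi.mul_apply, abs_mul]
    exact mul_le_mul (hAv σ) (hv σ) (abs_nonneg _) (mul_nonneg ha hb)
  have hvv : ∀ σ, |(v * v) σ| ≤ b * b := fun σ => by
    rw [Pi.mul_apply, abs_mul]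
    exact mul_le_mul (hv σ) (hv σ) (abs_nonneg _) hb
  have g1 := abs_gibbs_le (Y := Y) hA
  have g2 := abs_gibbs_le (Y := Y) hv
  have g3 := abs_gibbs_le (Y := Y) hAv
  have g4 := abs_gibbs_le (Y := Y) hAvv
  have g5 := abs_gibbs_le (Y := Y) hvv
  have mulb : ∀ {x y p q : ℝ}, |x| ≤ p → |y| ≤ q → |x * y| ≤ p * q := fun {x y p q} hx hy => by
    rw [abs_mul]
    exact mul_le_mul hx hy (abs_nonneg _) ((abs_nonneg _).trans hx)
  have subb : ∀ {x y p q : ℝ}, |x| ≤ p → |y| ≤ q → |x - y| ≤ p + q := fun hx hy =>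
    (abs_sub _ _).trans (add_le_add hx hy)
  have addb : ∀ {x y p q : ℝ}, |x| ≤ p → |y| ≤ q → |x + y| ≤ p + q := fun hx hy =>
    (abs_add_le _ _).trans (add_le_add hx hy)
  have d := subb g3 (mulb g1 g2)
  have h2 : |(2 : ℝ)| ≤ 2 := by norm_num
  -- The covariance term `d` is at most `2ab`, so its square contributes `4a²b²`. The bracket
  -- multiplied by `⟨A⟩` has three groups of size `2ab²`, contributing `6a²b²`. The leading factor
  -- `2` gives `20`.
  refine (mulb h2 (addb (mulb d d) (mulb g1 (subb (subb g4 (mulb g3 g2))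
    (addb (mulb d g2) (mulb g1 (subb g5 (mulb g2 g2)))))))).trans (le_of_eq ?_)
  ring

theorem hasBoundedDerivs_gibbs_sq [Nonempty S] (A : S → ℝ) :
    HasBoundedDerivs (S := S) (fun Y => gibbs Y A ^ 2)
      (fun v Y => 2 * (gibbs Y A * (gibbs Y (A * v) - gibbs Y A * gibbs Y v)))
      (gibbsSq₂ A) where
  deriv₁ Y Y' x hY := by
    refine ((hasDerivAt_gibbs hY A).pow 2).congr_deriv ?_
    simp
    ring
  deriv₂ v Y x := by
    have hY : HasDerivAt (fun s : ℝ => Y + s • v) v x := by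
      simpa using ((hasDerivAt_id x).smul_const v).const_add Y
    have hA := hasDerivAt_gibbs hY A
    have hv := hasDerivAt_gibbs hY v
    have hAv := hasDerivAt_gibbs hY (A * v)
    exact (hA.mul (hAv.sub (hA.mul hv))).const_mul 2
  add v w Y := by
    rw [mul_add A v w, gibbs_add, gibbs_add]
    ring
  smul r v Y := by
    rw [mul_smul_comm, gibbs_smul, gibbs_smul]
    ring
  cont := (continuous_gibbs A).pow 2
  cont₁ v := continuous_const.mul ((continuous_gibbs _).mul
    ((continuous_gibbs _).sub ((continuous_gibbs _).mul (continuous_gibbs _))))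
  cont₂ v := by
    have h1 := continuous_gibbs A
    have h2 := continuous_gibbs v
    have h3 := continuous_gibbs (A * v)
    have h4 := continuous_gibbs (A * v * v)
    have h5 := continuous_gibbs (v * v)
    unfold gibbsSq₂
    fun_prop
  growth := by
    obtain ⟨B, hB⟩ := exists_abs_gibbs_le A
    refine ⟨B ^ 2, fun Y => ?_⟩
    have hs : 0 ≤ ∑ σ, |Y σ| := Finset.sum_nonneg fun _ _ => abs_nonneg _
    rw [abs_pow]
    have := pow_le_pow_left₀ (abs_nonneg _) (hB Y) 2
    nlinarith [sq_nonneg B, mul_nonneg (sq_nonneg B) hs]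
  bdd₁ v := by
    obtain ⟨B, hB⟩ := exists_abs_gibbs_le A
    obtain ⟨B', hB'⟩ := exists_abs_gibbs_le v
    obtain ⟨B'', hB''⟩ := exists_abs_gibbs_le (A * v)
    refine ⟨2 * (B * (B'' + B * B')), fun Y => ?_⟩
    have hB0 : 0 ≤ B := (abs_nonneg _).trans (hB Y)
    rw [abs_mul, abs_mul, abs_two]
    gcongr
    · exact hB Y
    · refine (abs_sub _ _).trans (add_le_add (hB'' Y) ?_)
      rw [abs_mul]
      exact mul_le_mul (hB Y) (hB' Y) (abs_nonneg _) hB0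
  bdd₂ v := ⟨_, fun Y => abs_gibbsSq₂_le
    (fun σ => Finset.single_le_sum (f := fun σ => |A σ|) (fun _ _ => abs_nonneg _)
      (Finset.mem_univ σ))
    (fun σ => Finset.single_le_sum (f := fun σ => |v σ|) (fun _ _ => abs_nonneg _)
      (Finset.mem_univ σ)) Y⟩

/-- The average of `log ∑_σ exp (b_σ + x_σ)` for a centered Gaussian field `x` with covariance
`C`. -/
def freeEnergy [DecidableEq S] (b : S → ℝ) (C : Matrix S S ℝ) : ℝ :=
  ∫ x : EuclideanSpace ℝ S, logZ (fun σ => b σ + x σ) ∂multivariateGaussian 0 C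

section

variable [Nonempty S] {Ω : Type*} [MeasurableSpace Ω] {μ : Measure Ω}
  [IsProbabilityMeasure μ]

theorem IsGaussianField.integrable_logZ {X : Ω → S → ℝ} {C : Matrix S S ℝ}
    (hX : IsGaussianField μ X C) (b : S → ℝ) :
    Integrable (fun ω => logZ (fun σ => b σ + X ω σ)) μ := by
  obtain ⟨φ, hφ⟩ := exists_featureCov_eq hX.posSemidef
  have h := isGaussianField_featureField φ fun _ => 1
  rw [hφ, one_pow, one_smul] at h
  refine (hX.integrable_iff h (Φ := fun x => logZ fun σ => b σ + x σ)
    (continuous_logZ.comp (by fun_prop)).measurable).2 ?_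
  convert hasBoundedDerivs_logZ.integrable_featureField b φ fun _ => 1 using 3 with g
  ext σ
  simp [featureField]

/-- With two replicas, `⟨φ²⟩ - ⟨φ⟩²` is the average of `φ(σ)φ(σ) - φ(σ)φ(τ)`. Summing over the
features leaves the covariance alone, and only through the combination `C σ σ - C σ τ`. -/
theorem sum_gibbs_variance (Y : S → ℝ) {L : Type*} [Fintype L] (φ : L → S → ℝ) :
    ∑ l, (gibbs Y (φ l * φ l) - gibbs Y (φ l) * gibbs Y (φ l)) =
      gibbs Y fun σ => gibbs Y fun τ =>
        featureCov φ (fun _ => 1) σ σ - featureCov φ (fun _ => 1) σ τ := by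
  have h : ∀ l, gibbs Y (φ l * φ l) - gibbs Y (φ l) * gibbs Y (φ l) =
      gibbs Y fun σ => gibbs Y fun τ => φ l σ * φ l σ - φ l σ * φ l τ := by
    intro l
    simp only [gibbs_sub, gibbs_const, gibbs_const_mul, gibbs_mul_const]
    rfl
  rw [Finset.sum_congr rfl fun l _ => h l, ← gibbs_sum]
  congr 1 with σ
  rw [← gibbs_sum]
  congr 1 with τ
  simp [featureCov_apply]

variable [DecidableEq S]

theorem IsGaussianField.integral_logZ {X : Ω → S → ℝ} {C : Matrix S S ℝ}
    (hX : IsGaussianField μ X C) (b : S → ℝ) :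
    ∫ ω, logZ (fun σ => b σ + X ω σ) ∂μ = freeEnergy b C :=
  hX.integral_eq (isGaussianField_multivariateGaussian hX.posSemidef)
    (Φ := fun x => logZ fun σ => b σ + x σ)
    (continuous_logZ.comp (by fun_prop)).measurable

theorem integral_logZ_featureField {L : Type*} [Fintype L] (b : S → ℝ) (φ : L → S → ℝ)
    (a : L → ℝ) : ∫ g, logZ (featureField b φ a g) ∂stdGauss L = freeEnergy b (featureCov φ a) := by
  rw [← (isGaussianField_featureField φ a).integral_logZ b]
  congr 1 with g
  congr 1 with σ
  simp [featureField]

/-- Comparison of free energies by interpolation between the covariances. -/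
theorem freeEnergy_le {C D : Matrix S S ℝ} (hC : C.PosSemidef) (hD : D.PosSemidef) (b : S → ℝ)
    {c : ℝ} (h : ∀ σ τ, (C σ σ - C σ τ) - (D σ σ - D σ τ) ≤ c) :
    freeEnergy b C ≤ freeEnergy b D + c / 2 := by
  obtain ⟨φ, hφ⟩ := exists_featureCov_eq hC
  obtain ⟨ψ, hψ⟩ := exists_featureCov_eq hD
  -- The path of covariances `sin² θ • C + cos² θ • D` runs from `D` at `0` to `C` at `π/2`.
  -- Trigonometric coefficients stay smooth at the end points, unlike square roots of an affine
  -- parameter.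
  set a : ℝ → S ⊕ S → ℝ := fun θ => Sum.elim (fun _ => Real.sin θ) fun _ => Real.cos θ with ha
  set a' : ℝ → S ⊕ S → ℝ := fun θ => Sum.elim (fun _ => Real.cos θ) fun _ => -Real.sin θ with ha'
  set χ : S ⊕ S → S → ℝ := Sum.elim φ ψ with hχ
  set U : ℝ → ℝ := fun θ => ∫ g, logZ (featureField b χ (a θ) g) ∂stdGauss (S ⊕ S) with hU
  have hcov : ∀ θ, featureCov χ (a θ) = Real.sin θ ^ 2 • C + Real.cos θ ^ 2 • D := by
    intro θ
    rw [← hφ, ← hψ]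
    ext σ τ
    simp [featureCov, hχ, ha]
  have hderiv := fun θ => hasBoundedDerivs_logZ.hasDerivAt_integral b χ a a' θ 1
    (Filter.Eventually.of_forall fun θ l => by
      rcases l with l | l
      · exact ⟨by simpa [ha, ha'] using Real.hasDerivAt_sin θ,
          by simpa [ha'] using Real.abs_cos_le_one θ⟩
      · exact ⟨by simpa [ha, ha'] using Real.hasDerivAt_cos θ,
          by simpa [ha'] using Real.abs_sin_le_one θ⟩)
  have hint : ∀ θ (f : S → S → ℝ) l, Integrable (fun g =>
      gibbs (featureField b χ (a θ) g) (f l * f l) - gibbs (featureField b χ (a θ) g) (f l) *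
        gibbs (featureField b χ (a θ) g) (f l)) (stdGauss (S ⊕ S)) := by
    intro θ f l
    obtain ⟨B, hB⟩ := (hasBoundedDerivs_logZ (S := S)).bdd₂ (f l)
    refine Integrable.of_bound (C := B) ?_ (Filter.Eventually.of_forall fun g => hB _)
    exact ((hasBoundedDerivs_logZ.cont₂ (f l)).comp
      (continuous_featureField b χ _)).aestronglyMeasurable
  have hvar : ∀ (f : S → S → ℝ) (E : Matrix S S ℝ), (∀ r : ℝ, featureCov f (fun _ => r) = r ^ 2 • E) →
      ∀ Y : S → ℝ, ∑ l, (gibbs Y (f l * f l) - gibbs Y (f l) * gibbs Y (f l)) =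
        gibbs Y fun σ => gibbs Y fun τ => E σ σ - E σ τ := by
    intro f E hf Y
    rw [sum_gibbs_variance, hf, one_pow, one_smul]
  have hle : ∀ θ ∈ Set.Ioo 0 (Real.pi / 2), deriv U θ ≤ Real.sin θ * Real.cos θ * c := by
    intro θ hθ
    have hs : 0 ≤ Real.sin θ * Real.cos θ :=
      mul_nonneg (Real.sin_nonneg_of_nonneg_of_le_pi hθ.1.le (by linarith [hθ.2, Real.pi_pos]))
        (Real.cos_nonneg_of_neg_pi_div_two_le_of_le (by linarith [hθ.1, Real.pi_pos]) hθ.2.le)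
    rw [(hderiv θ).deriv, Fintype.sum_sum_type]
    simp only [ha, ha', hχ, Sum.elim_inl, Sum.elim_inr]
    rw [← Finset.mul_sum, ← Finset.mul_sum, ← integral_finsetSum _ fun l _ => hint θ φ l,
      ← integral_finsetSum _ fun l _ => hint θ ψ l,
      show ∀ x y : ℝ, Real.sin θ * Real.cos θ * x + Real.cos θ * -Real.sin θ * y =
        Real.sin θ * Real.cos θ * (x - y) by intros; ring,
      ← integral_sub (integrable_finsetSum _ fun l _ => hint θ φ l)
        (integrable_finsetSum _ fun l _ => hint θ ψ l)]
    refine mul_le_mul_of_nonneg_left ?_ hs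
    have : c = ∫ _g, c ∂stdGauss (S ⊕ S) := by simp
    rw [this]
    refine integral_mono ((integrable_finsetSum _ fun l _ => hint θ φ l).sub
      (integrable_finsetSum _ fun l _ => hint θ ψ l)) (integrable_const _) fun g => ?_
    simp only
    rw [hvar φ C hφ, hvar ψ D hψ, ← gibbs_sub]
    refine (gibbs_mono (B := fun _ => c) fun σ => ?_).trans_eq (gibbs_const _ c)
    rw [← gibbs_sub]
    exact (gibbs_mono (B := fun _ => c) fun τ => h σ τ).trans_eq (gibbs_const _ c)
  -- The bound `sin θ cos θ * c` on the derivative is itself the derivative of `c/2 * sin² θ`, whose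
  -- total increase is `c/2`.
  have hV : AntitoneOn (fun θ => U θ - c / 2 * Real.sin θ ^ 2) (Set.Icc 0 (Real.pi / 2)) := by
    have hd : ∀ θ, HasDerivAt (fun θ => U θ - c / 2 * Real.sin θ ^ 2)
        (deriv U θ - Real.sin θ * Real.cos θ * c) θ := by
      intro θ
      have h1 := (((Real.hasDerivAt_sin θ).pow 2).const_mul (c / 2))
      refine ((hderiv θ).differentiableAt.hasDerivAt.sub h1).congr_deriv ?_
      simp only [hU]
      ring
    refine antitoneOn_of_deriv_nonpos (convex_Icc _ _)
      (fun θ _ => (hd θ).continuousAt.continuousWithinAt)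
      (fun θ _ => (hd θ).differentiableAt.differentiableWithinAt) fun θ hθ => ?_
    rw [interior_Icc] at hθ
    rw [(hd θ).deriv]
    linarith [hle θ hθ]
  have hfin := hV (Set.left_mem_Icc.2 (by positivity)) (Set.right_mem_Icc.2 (by positivity))
    (by positivity : (0 : ℝ) ≤ Real.pi / 2)
  simp only [hU, integral_logZ_featureField, hcov, Real.sin_zero, Real.cos_zero,
    Real.sin_pi_div_two, Real.cos_pi_div_two] at hfin
  norm_num at hfin
  linarith

/-- Interpolation sees only `C σ σ - C σ τ`. In particular a constant may be added to a covariance: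
it amounts to a centered Gaussian shift common to all configurations. -/
theorem freeEnergy_congr {C D : Matrix S S ℝ} (hC : C.PosSemidef) (hD : D.PosSemidef) (b : S → ℝ)
    (h : ∀ σ τ, C σ σ - C σ τ = D σ σ - D σ τ) : freeEnergy b C = freeEnergy b D := by
  apply le_antisymm
  · simpa using freeEnergy_le hC hD b (c := 0) fun σ τ => by rw [h, sub_self]
  · simpa using freeEnergy_le hD hC b (c := 0) fun σ τ => by rw [h, sub_self]

theorem freeEnergy_reindex [DecidableEq T] [Nonempty T] {C : Matrix S S ℝ} (hC : C.PosSemidef)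
    (b : S → ℝ) (e : T ≃ S) : freeEnergy (b ∘ e) (C.submatrix e e) = freeEnergy b C := by
  have h := isGaussianField_multivariateGaussian hC
  have h' := h.pullback e fun _ => 1
  have e1 : (Matrix.of fun a b => (1 : ℝ) * 1 * C (e a) (e b)) = C.submatrix e e := by
    ext; simp
  rw [e1] at h'
  rw [← h'.integral_logZ, ← h.integral_logZ]
  congr 1 with x
  simp only [logZ, Function.comp_apply, one_mul]
  rw [Equiv.sum_comp e fun σ => Real.exp (b σ + x σ)]

end

/-- The free energy of two independent systems. -/
theorem freeEnergy_prod [DecidableEq S] [Nonempty S] [DecidableEq T] [Nonempty T]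
    {C : Matrix S S ℝ} {D : Matrix T T ℝ} (hC : C.PosSemidef) (hD : D.PosSemidef) (b : S → ℝ)
    (d : T → ℝ) : freeEnergy (fun p : S × T => b p.1 + d p.2)
      (Matrix.of fun p p' => C p.1 p'.1 + D p.2 p'.2) = freeEnergy b C + freeEnergy d D := by
  have h1 := isGaussianField_multivariateGaussian hC
  have h2 := isGaussianField_multivariateGaussian hD
  have h := (h1.pullback (T := S × T) Prod.fst fun _ => 1).add_prod
    (h2.pullback (T := S × T) Prod.snd fun _ => 1)
  have e1 : ((Matrix.of fun a b => (1 : ℝ) * 1 * C (Prod.fst a) (Prod.fst b)) +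
      Matrix.of fun a b => (1 : ℝ) * 1 * D (Prod.snd a) (Prod.snd b)) =
      Matrix.of fun p p' : S × T => C p.1 p'.1 + D p.2 p'.2 := by
    ext; simp
  rw [e1] at h
  rw [← h.integral_logZ, ← h1.integral_logZ, ← h2.integral_logZ]
  have hsplit : ∀ ω : EuclideanSpace ℝ S × EuclideanSpace ℝ T,
      logZ (fun p : S × T => b p.1 + d p.2 + (1 * ω.1 p.1 + 1 * ω.2 p.2)) =
      logZ (fun σ => b σ + ω.1 σ) + logZ (fun τ => d τ + ω.2 τ) := by
    intro ω
    rw [logZ, logZ, logZ, ← Real.log_mul (sum_exp_pos _).ne' (sum_exp_pos _).ne',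
      Finset.sum_mul_sum, ← Fintype.sum_prod_type']
    congr 1
    refine Finset.sum_congr rfl fun p _ => ?_
    rw [← Real.exp_add]
    congr 1
    ring
  simp only [hsplit]
  have i1 := h1.integrable_logZ b
  have i2 := h2.integrable_logZ d
  rw [integral_add (i1.comp_fst _) (i2.comp_snd _),
    integral_fun_fst (fun ω : EuclideanSpace ℝ S => logZ fun σ => b σ + ω σ),
    integral_fun_snd (fun ω : EuclideanSpace ℝ T => logZ fun σ => d σ + ω σ)]
  simp

end SpinGlass

/-! ### Site-dependent weights and the transfer of weight between two sites. -/

namespace SpinGlass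

theorem spin_mul_self (s : ℤˣ) : spin s * spin s = 1 := by
  rcases Int.units_eq_one_or s with h | h <;> simp [spin, h]

theorem abs_spin (s : ℤˣ) : |spin s| = 1 := by
  rcases Int.units_eq_one_or s with h | h <;> simp [spin, h]

theorem spin_neg (s : ℤˣ) : spin (-s) = -spin s := by simp [spin]

/-- The contribution of the external field to the exponent. -/
def fieldTerm (N : ℕ) (H : ℝ) (σ : Config N) : ℝ := H * ∑ i, spin (σ i)

/-- The covariance of a model in which the coupling of the site `i` is multiplied by `√w_i`. -/
def weightedCov {N : ℕ} (w : Fin N → ℝ) : Matrix (Config N) (Config N) ℝ :=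
  Matrix.of fun σ τ => (∑ i, w i * (spin (σ i) * spin (τ i))) ^ 2 / (2 * N)

theorem weightedCov_apply {N : ℕ} (w : Fin N → ℝ) (σ τ : Config N) :
    weightedCov w σ τ = (∑ i, w i * (spin (σ i) * spin (τ i))) ^ 2 / (2 * N) := rfl

theorem posSemidef_featureCov {S L : Type*} [Fintype S] [Fintype L] (φ : L → S → ℝ) (a : L → ℝ) :
    (featureCov φ a).PosSemidef := (isGaussianField_featureField φ a).posSemidef

theorem posSemidef_weightedCov {N : ℕ} {w : Fin N → ℝ} (hw : ∀ i, 0 ≤ w i) :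
    (weightedCov w).PosSemidef := by
  have : weightedCov w = featureCov (fun (p : Fin N × Fin N) (σ : Config N) =>
      spin (σ p.1) * spin (σ p.2)) fun p => √(w p.1 * w p.2 / (2 * N)) := by
    ext σ τ
    rw [weightedCov_apply, featureCov_apply, sq, Finset.sum_mul_sum, Fintype.sum_prod_type,
      Finset.sum_div]
    refine Finset.sum_congr rfl fun i _ => ?_
    rw [Finset.sum_div]
    refine Finset.sum_congr rfl fun j _ => ?_
    rw [Real.sq_sqrt (div_nonneg (mul_nonneg (hw i) (hw j)) (by positivity))]
    ring
  rw [this]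
  exact posSemidef_featureCov _ _

theorem integral_gibbs_variance {S L : Type*} [Fintype S] [Nonempty S] [Fintype L] (b : S → ℝ)
    (φ : L → S → ℝ) (a : L → ℝ) {A : S → ℝ} (hA : ∀ σ, A σ * A σ = 1) :
    ∫ g, (gibbs (featureField b φ a g) (A * A) -
      gibbs (featureField b φ a g) A * gibbs (featureField b φ a g) A) ∂stdGauss L =
      1 - ∫ g, gibbs (featureField b φ a g) A ^ 2 ∂stdGauss L := by
  have h1 : A * A = fun _ => 1 := funext hA
  simp only [h1, gibbs_const, ← sq]
  rw [integral_sub (integrable_const _)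
    ((hasBoundedDerivs_gibbs_sq A).integrable_featureField _ _ _)]
  simp

/-- The exchange of two sites. -/
def swapSites {N : ℕ} (i j : Fin N) : Config N ≃ Config N :=
  (Equiv.swap i j).arrowCongr (Equiv.refl _)

theorem swapSites_apply {N : ℕ} (i j : Fin N) (σ : Config N) (l : Fin N) :
    swapSites i j σ l = σ (Equiv.swap i j l) := by
  simp [swapSites, Equiv.arrowCongr]

section exchange

variable {N : ℕ} (w : Fin N → ℝ) (i j : Fin N) (t : ℝ)

/-- The overlap weighted by `w`. -/
def weightedOverlap (σ τ : Config N) : ℝ := ∑ l, w l * (spin (σ l) * spin (τ l))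

/-- Covariances that interpolate between different weights of the sites `i` and `j`. -/
def exchangeCov (u : ℝ) : Matrix (Config N) (Config N) ℝ :=
  Matrix.of fun σ τ => (weightedOverlap w σ τ ^ 2 +
    t ^ 2 * (spin (σ i) * spin (τ i) + spin (σ j) * spin (τ j)) ^ 2 +
    2 * weightedOverlap w σ τ *
      ((t + u) * (spin (σ i) * spin (τ i)) + (t - u) * (spin (σ j) * spin (τ j)))) / (2 * N)

/-- The part of `exchangeCov` that does not depend on `u` is positive semidefinite and has fixed
features `ψ`. The rest is affine in `u` and is carried by the features `σ_i σ_l` and `σ_j σ_l`, of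
variances proportional to `t + u` and `t - u`. The coefficients are differentiable in `u` only
inside `(-t, t)`. -/
theorem exists_exchangeFeatures (hw : ∀ l, 0 ≤ w l) :
    ∃ ψ : Config N → Config N → ℝ, ∀ u ∈ Set.Ioo (-t) t,
      exchangeCov w i j t u = featureCov
        (Sum.elim ψ (Sum.elim (fun l σ => spin (σ i) * spin (σ l))
          fun l σ => spin (σ j) * spin (σ l)))
        (Sum.elim (fun _ => 1) (Sum.elim (fun l => √(w l / N) * √(t + u))
          fun l => √(w l / N) * √(t - u))) := by
  -- As spins square to one, `(σ_i τ_i + σ_j τ_j)² = 2 + 2 (σ_i σ_j)(τ_i τ_j)`. Times `t²/(2N)`,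
  -- this is the covariance of the two features `1` and `σ_i σ_j`, each with variance `t²/N`.
  set C₀ : Matrix (Config N) (Config N) ℝ := weightedCov w +
    featureCov (L := Option Unit)
      (fun o σ => o.elim 1 fun _ => spin (σ i) * spin (σ j)) (fun _ => √(t ^ 2 / N)) with hC₀
  have hpsd : C₀.PosSemidef := (posSemidef_weightedCov hw).add (posSemidef_featureCov _ _)
  obtain ⟨ψ, hψ⟩ := exists_featureCov_eq hpsd
  refine ⟨ψ, fun u hu => ?_⟩
  have hψ1 := hψ 1
  rw [one_pow, one_smul] at hψ1
  ext σ τ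
  have h1 := congrFun (congrFun hψ1 σ) τ
  rw [featureCov_apply, hC₀, Matrix.add_apply, featureCov_apply, weightedCov_apply] at h1
  simp only [Fintype.sum_option, Finset.univ_unique, Finset.sum_singleton, Option.elim_none,
    Option.elim_some] at h1
  rw [Real.sq_sqrt (by positivity)] at h1
  rw [featureCov_apply, Fintype.sum_sum_type, Fintype.sum_sum_type]
  simp only [Sum.elim_inl, Sum.elim_inr]
  rw [h1]
  have e1 : ∀ (v : ℝ) (hv : 0 ≤ v) (k : Fin N), ∑ l, (√(w l / N) * √v) ^ 2 *
      (spin (σ k) * spin (σ l)) * (spin (τ k) * spin (τ l)) =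
      v * (spin (σ k) * spin (τ k)) * weightedOverlap w σ τ / N := by
    intro v hv k
    rw [weightedOverlap, Finset.mul_sum, Finset.sum_div]
    refine Finset.sum_congr rfl fun l _ => ?_
    rw [mul_pow, Real.sq_sqrt (div_nonneg (hw l) (by positivity)), Real.sq_sqrt hv]
    ring
  rw [e1 _ (by linarith [hu.1]), e1 _ (by linarith [hu.2])]
  change (weightedOverlap w σ τ ^ 2 + _ + _) / _ = weightedOverlap w σ τ ^ 2 / _ + _ + _
  have hxy : (spin (σ i) * spin (τ i) + spin (σ j) * spin (τ j)) ^ 2 =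
      2 + 2 * (spin (σ i) * spin (σ j)) * (spin (τ i) * spin (τ j)) := by
    have a1 := spin_mul_self (σ i)
    have a2 := spin_mul_self (τ i)
    have a3 := spin_mul_self (σ j)
    have a4 := spin_mul_self (τ j)
    linear_combination (spin (τ i) * spin (τ i)) * a1 + a2 + (spin (τ j) * spin (τ j)) * a3 + a4
  rw [hxy]
  ring

/-- This symmetry makes the free energy even in `u`. It is the reason for using `exchangeCov`,
affine in `u`, together with equal base weights at `i` and `j`. -/
theorem exchangeCov_submatrix_swap (hij : w i = w j) (u : ℝ) :
    (exchangeCov w i j t u).submatrix (swapSites i j) (swapSites i j) =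
      exchangeCov w i j t (-u) := by
  have hw : ∀ l, w (Equiv.swap i j l) = w l := by
    intro l
    by_cases h1 : l = i
    · subst h1; simp [hij]
    · by_cases h2 : l = j
      · subst h2; simp [hij]
      · rw [Equiv.swap_apply_of_ne_of_ne h1 h2]
  ext σ τ
  have hR : weightedOverlap w (swapSites i j σ) (swapSites i j τ) = weightedOverlap w σ τ := by
    simp only [weightedOverlap, swapSites_apply]
    rw [← Equiv.sum_comp (Equiv.swap i j) fun l => w l * (spin (σ l) * spin (τ l))]
    exact Finset.sum_congr rfl fun l _ => by rw [hw]
  simp only [exchangeCov, Matrix.submatrix_apply, Matrix.of_apply, hR, swapSites_apply,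
    Equiv.swap_apply_left, Equiv.swap_apply_right]
  ring

theorem fieldTerm_comp_swapSites (H : ℝ) : fieldTerm N H ∘ swapSites i j = fieldTerm N H := by
  ext σ
  simp only [fieldTerm, Function.comp_apply, swapSites_apply]
  rw [Equiv.sum_comp (Equiv.swap i j) fun l => spin (σ l)]

set_option maxHeartbeats 1000000 in
/-- The free energy varies quadratically under a transfer of weight between two sites. -/
theorem freeEnergy_exchangeCov_le (H : ℝ) (hw : ∀ l, 0 ≤ w l) (hij : w i = w j) {W s : ℝ}
    (hW : ∑ l, w l / N ≤ W) (hs : 0 ≤ s) (hst : s < t) :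
    freeEnergy (fieldTerm N H) (exchangeCov w i j t s) ≤
      freeEnergy (fieldTerm N H) (exchangeCov w i j t 0) + 10 * W ^ 2 * s ^ 2 := by
  obtain ⟨ψ, hψ⟩ := exists_exchangeFeatures w i j t hw
  set χ : Config N ⊕ (Fin N ⊕ Fin N) → Config N → ℝ :=
    Sum.elim ψ (Sum.elim (fun l σ => spin (σ i) * spin (σ l))
      fun l σ => spin (σ j) * spin (σ l)) with hχ
  set a : ℝ → Config N ⊕ (Fin N ⊕ Fin N) → ℝ := fun u =>
    Sum.elim (fun _ => 1) (Sum.elim (fun l => √(w l / N) * √(t + u))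
      fun l => √(w l / N) * √(t - u)) with ha
  set a' : ℝ → Config N ⊕ (Fin N ⊕ Fin N) → ℝ := fun u =>
    Sum.elim (fun _ => 0) (Sum.elim (fun l => √(w l / N) * (1 / (2 * √(t + u))))
      fun l => √(w l / N) * (-1 / (2 * √(t - u)))) with ha'
  have hW0 : 0 ≤ W := (Finset.sum_nonneg fun l _ => div_nonneg (hw l) (by positivity)).trans hW
  have ht : 0 < t := hs.trans_lt hst
  have hpath : ∀ u₀ ∈ Set.Ioo (-t) t, ∃ A, ∀ᶠ u in 𝓝 u₀, ∀ l,
      HasDerivAt (fun u => a u l) (a' u l) u ∧ |a' u l| ≤ A := by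
    intro u₀ hu₀
    have hc : ∀ l, ContinuousAt (fun u => a' u l) u₀ := by
      have h1 : √(t + u₀) ≠ 0 := (Real.sqrt_pos.2 (by linarith [hu₀.1])).ne'
      have h2 : √(t - u₀) ≠ 0 := (Real.sqrt_pos.2 (by linarith [hu₀.2])).ne'
      rintro (l | l | l)
      · simpa [ha'] using continuousAt_const
      · simp only [ha', Sum.elim_inl, Sum.elim_inr]
        exact continuousAt_const.mul (ContinuousAt.div continuousAt_const (by fun_prop)
          (by positivity))
      · simp only [ha', Sum.elim_inr]
        exact continuousAt_const.mul (ContinuousAt.div continuousAt_const (by fun_prop)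
          (by positivity))
    refine ⟨∑ l, (|a' u₀ l| + 1), ?_⟩
    have hb : ∀ᶠ u in 𝓝 u₀, ∀ l, |a' u l| < |a' u₀ l| + 1 := by
      rw [eventually_all]
      exact fun l => (hc l).abs.eventually_lt_const (by linarith)
    filter_upwards [hb, isOpen_Ioo.mem_nhds hu₀] with u hu hu' l
    refine ⟨?_, (hu l).le.trans (Finset.single_le_sum (f := fun l => |a' u₀ l| + 1)
      (fun _ _ => by positivity) (Finset.mem_univ l))⟩
    rcases l with l | l | l
    · simpa [ha, ha'] using hasDerivAt_const u (1 : ℝ)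
    · simp only [ha, ha', Sum.elim_inl, Sum.elim_inr]
      exact (((hasDerivAt_id u).const_add t).sqrt (by simp only [id]; linarith [hu'.1])).const_mul _
    · simp only [ha, ha', Sum.elim_inr]
      exact (((hasDerivAt_id u).const_sub t).sqrt (by simp only [id]; linarith [hu'.2])).const_mul _
  -- The squared coefficients are `w_l (t ± u)/N`, so `a * a'`, half the derivative of the square,
  -- is `± w_l/(2N)` for every `u`.
  have haa : ∀ u ∈ Set.Ioo (-t) t, ∀ f : Config N ⊕ (Fin N ⊕ Fin N) → ℝ,
      ∑ l, a u l * a' u l * f l =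
        ∑ l, w l / N / 2 * (f (Sum.inr (Sum.inl l)) - f (Sum.inr (Sum.inr l))) := by
    intro u hu f
    have h1 : √(t + u) ≠ 0 := (Real.sqrt_pos.2 (by linarith [hu.1])).ne'
    have h2 : √(t - u) ≠ 0 := (Real.sqrt_pos.2 (by linarith [hu.2])).ne'
    rw [Fintype.sum_sum_type, Fintype.sum_sum_type]
    simp only [ha, ha', Sum.elim_inl, Sum.elim_inr, mul_zero, zero_mul, Finset.sum_const_zero,
      zero_add]
    rw [← Finset.sum_add_distrib]
    refine Finset.sum_congr rfl fun l _ => ?_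
    have h3 : √(w l / N) * √(w l / N) = w l / N :=
      Real.mul_self_sqrt (div_nonneg (hw l) (by positivity))
    generalize √(w l / N) = r at h3 ⊢
    rw [← h3]
    field_simp
    ring
  set f : ℝ → ℝ := fun u => ∫ g, logZ (featureField (fieldTerm N H) χ (a u) g) ∂stdGauss _ with hf
  have hfF : ∀ u ∈ Set.Ioo (-t) t,
      f u = freeEnergy (fieldTerm N H) (exchangeCov w i j t u) := by
    intro u hu
    rw [hψ u hu]
    exact integral_logZ_featureField _ _ _
  set G : (Config N → ℝ) → ℝ → ℝ := fun A u =>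
    ∫ g, gibbs (featureField (fieldTerm N H) χ (a u) g) A ^ 2 ∂stdGauss _ with hG
  have hsq : ∀ (k l : Fin N) (σ : Config N),
      (spin (σ k) * spin (σ l)) * (spin (σ k) * spin (σ l)) = 1 := fun k l σ => by
    have a1 := spin_mul_self (σ k)
    have a2 := spin_mul_self (σ l)
    linear_combination (spin (σ l) * spin (σ l)) * a1 + a2
  set ψi : Fin N → Config N → ℝ := fun l σ => spin (σ i) * spin (σ l) with hψi
  set ψj : Fin N → Config N → ℝ := fun l σ => spin (σ j) * spin (σ l) with hψj
  have hχi : ∀ l, χ (Sum.inr (Sum.inl l)) = ψi l := fun _ => rfl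
  have hχj : ∀ l, χ (Sum.inr (Sum.inr l)) = ψj l := fun _ => rfl
  set f' : ℝ → ℝ := fun u => ∑ l, w l / N / 2 * (G (ψj l) u - G (ψi l) u) with hf'
  have hgi : ∀ u (A : Config N → ℝ),
      Integrable (fun g => gibbs (featureField (fieldTerm N H) χ (a u) g) A ^ 2) (stdGauss _) :=
    fun u A => (hasBoundedDerivs_gibbs_sq A).integrable_featureField _ _ _
  have hfd : ∀ u ∈ Set.Ioo (-t) t, HasDerivAt f (f' u) u := by
    intro u hu
    obtain ⟨A, hA⟩ := hpath u hu
    refine (hasBoundedDerivs_logZ.hasDerivAt_integral (fieldTerm N H) χ a a' u A hA).congr_deriv ?_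
    rw [haa u hu]
    refine Finset.sum_congr rfl fun l _ => ?_
    rw [hχi, hχj, integral_gibbs_variance _ _ _ (hsq i l), integral_gibbs_variance _ _ _ (hsq j l)]
    ring
  -- The second derivative of `⟨A⟩²` in a direction bounded by `1` is at most `20`. The two
  -- directions attached to `l` contribute `w_l/(2N) * 40`, and summation over `l` gives `20 W`.
  have hGlip : ∀ A : Config N → ℝ, (∀ σ, |A σ| ≤ 1) → ∀ u ∈ Set.Ioo (-t) t,
      |G A u - G A 0| ≤ 20 * W * |u| := by
    intro A hA u hu
    have hd : ∀ v ∈ Set.Ioo (-t) t, HasDerivWithinAt (G A)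
        (∑ l, w l / N / 2 *
          ((∫ g, gibbsSq₂ A (ψi l) (featureField (fieldTerm N H) χ (a v) g) ∂stdGauss _) -
          ∫ g, gibbsSq₂ A (ψj l) (featureField (fieldTerm N H) χ (a v) g) ∂stdGauss _))
        (Set.Ioo (-t) t) v := by
      intro v hv
      obtain ⟨B, hB⟩ := hpath v hv
      refine ((hasBoundedDerivs_gibbs_sq A).hasDerivAt_integral
        (fieldTerm N H) χ a a' v B hB).hasDerivWithinAt.congr_deriv ?_
      rw [haa v hv]
      exact Finset.sum_congr rfl fun l _ => by rw [hχi, hχj]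
    have hb : ∀ (k l : Fin N) v, |∫ g, gibbsSq₂ A (fun σ => spin (σ k) * spin (σ l))
        (featureField (fieldTerm N H) χ (a v) g) ∂stdGauss _| ≤ 20 := by
      intro k l v
      have := norm_integral_le_of_norm_le_const (μ := stdGauss (Config N ⊕ (Fin N ⊕ Fin N)))
        (f := fun g => gibbsSq₂ A (fun σ => spin (σ k) * spin (σ l))
          (featureField (fieldTerm N H) χ (a v) g)) (C := 20)
        (Filter.Eventually.of_forall fun g => by
          refine (abs_gibbsSq₂_le hA (b := 1) (fun σ => ?_) _).trans (by norm_num)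
          rw [abs_mul, abs_spin, abs_spin, one_mul])
      simpa using this
    have := (convex_Ioo (-t) t).norm_image_sub_le_of_norm_hasDerivWithin_le (C := 20 * W) hd
      (fun v hv => ?_) (⟨by linarith, ht⟩ : (0 : ℝ) ∈ Set.Ioo (-t) t) hu
    · simpa using this
    · rw [Real.norm_eq_abs]
      refine (Finset.abs_sum_le_sum_abs _ _).trans ?_
      have : ∀ l, |w l / N / 2 *
          ((∫ g, gibbsSq₂ A (ψi l) (featureField (fieldTerm N H) χ (a v) g) ∂stdGauss _) -
          ∫ g, gibbsSq₂ A (ψj l) (featureField (fieldTerm N H) χ (a v) g) ∂stdGauss _)| ≤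
          20 * (w l / N) := by
        intro l
        have h0 : 0 ≤ w l / N := div_nonneg (hw l) (by positivity)
        rw [abs_mul, abs_of_nonneg (by positivity)]
        have := (abs_sub _ _).trans (add_le_add (hb i l v) (hb j l v))
        nlinarith
      refine (Finset.sum_le_sum fun l _ => this l).trans ?_
      rw [← Finset.mul_sum]
      linarith
  have hψ1 : ∀ (k l : Fin N) (σ : Config N), |spin (σ k) * spin (σ l)| ≤ 1 := fun k l σ => by
    rw [abs_mul, abs_spin, abs_spin, one_mul]
  -- A second summation against `w_l/(2N)`, with two functions `G` for each `l`, gives another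
  -- factor `W`. Integrating `20 W² u` later gives `10 W² s²`.
  have hf'lip : ∀ u ∈ Set.Ioo (-t) t, |f' u - f' 0| ≤ 20 * W ^ 2 * |u| := by
    intro u hu
    rw [hf']
    simp only
    rw [← Finset.sum_sub_distrib]
    refine (Finset.abs_sum_le_sum_abs _ _).trans ?_
    have : ∀ l, |w l / N / 2 * (G (ψj l) u - G (ψi l) u) -
        w l / N / 2 * (G (ψj l) 0 - G (ψi l) 0)| ≤ 20 * W * |u| * (w l / N) := by
      intro l
      have h0 : 0 ≤ w l / N := div_nonneg (hw l) (by positivity)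
      rw [← mul_sub, abs_mul, abs_of_nonneg (by positivity)]
      have h1 := hGlip (ψj l) (hψ1 j l) u hu
      have h2 := hGlip (ψi l) (hψ1 i l) u hu
      have h3 : |G (ψj l) u - G (ψi l) u - (G (ψj l) 0 - G (ψi l) 0)| ≤ 2 * (20 * W * |u|) := by
        rw [show G (ψj l) u - G (ψi l) u - (G (ψj l) 0 - G (ψi l) 0) =
          (G (ψj l) u - G (ψj l) 0) - (G (ψi l) u - G (ψi l) 0) by ring]
        exact ((abs_sub _ _).trans (add_le_add h1 h2)).trans_eq (by ring)
      nlinarith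
    refine (Finset.sum_le_sum fun l _ => this l).trans ?_
    rw [← Finset.mul_sum]
    have : 0 ≤ 20 * W * |u| := by positivity
    nlinarith [mul_le_mul_of_nonneg_left hW this]
  have hpsd : ∀ u ∈ Set.Ioo (-t) t, (exchangeCov w i j t u).PosSemidef := by
    intro u hu
    rw [hψ u hu]
    exact posSemidef_featureCov _ _
  have h0 : (0 : ℝ) ∈ Set.Ioo (-t) t := ⟨by linarith, ht⟩
  have heven : ∀ u ∈ Set.Ioo (-t) t, f (-u) = f u := by
    intro u hu
    have hu' : -u ∈ Set.Ioo (-t) t := ⟨by linarith [hu.2], by linarith [hu.1]⟩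
    rw [hfF u hu, hfF _ hu', ← exchangeCov_submatrix_swap w i j t hij,
      ← freeEnergy_reindex (hpsd u hu) (fieldTerm N H) (swapSites i j), fieldTerm_comp_swapSites]
  -- The derivative at `0` of an even function vanishes: no first order term in `s` survives.
  have hf'0 : f' 0 = 0 := by
    have h1 := hfd 0 h0
    have h2 : HasDerivAt (fun u => f (-u)) (-f' 0) 0 := by
      have h3 := HasDerivAt.comp (x := (0 : ℝ)) (h₂ := f) (h := fun u : ℝ => -u) (h₂' := f' 0)
        (h' := -1) (by simpa using h1) (hasDerivAt_neg 0)
      simpa [Function.comp_def] using h3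
    have h3 : HasDerivAt (fun u => f (-u)) (f' 0) 0 :=
      h1.congr_of_eventuallyEq (by
        filter_upwards [isOpen_Ioo.mem_nhds h0] with u hu using heven u hu)
    have := h2.unique h3
    linarith
  have hsub : Set.Icc 0 s ⊆ Set.Ioo (-t) t := fun u hu => ⟨by linarith [hu.1], by linarith [hu.2]⟩
  have hanti : AntitoneOn (fun u => f u - 10 * W ^ 2 * u ^ 2) (Set.Icc 0 s) := by
    have hd : ∀ u ∈ Set.Icc 0 s, HasDerivAt (fun u => f u - 10 * W ^ 2 * u ^ 2)
        (f' u - 20 * W ^ 2 * u) u := by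
      intro u hu
      refine ((hfd u (hsub hu)).sub (((hasDerivAt_id u).pow 2).const_mul (10 * W ^ 2))).congr_deriv ?_
      simp
      ring
    refine antitoneOn_of_deriv_nonpos (convex_Icc _ _)
      (fun u hu => (hd u hu).continuousAt.continuousWithinAt)
      (fun u hu => (hd u (interior_subset hu)).differentiableAt.differentiableWithinAt)
      fun u hu => ?_
    have hu := interior_subset hu
    rw [(hd u hu).deriv]
    have := hf'lip u (hsub hu)
    rw [hf'0, sub_zero, abs_of_nonneg hu.1] at this
    linarith [le_abs_self (f' u)]
  have := hanti (Set.left_mem_Icc.2 hs) (Set.right_mem_Icc.2 hs) hs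
  rw [← hfF s (hsub (Set.right_mem_Icc.2 hs)), ← hfF 0 h0]
  simp only at this
  nlinarith

end exchange

/-- Replacing the weights of two sites by their average. -/
theorem freeEnergy_weightedCov_single_le {N : ℕ} (w : Fin N → ℝ) (i j : Fin N) (H : ℝ)
    (hw : ∀ l, 0 ≤ w l) (hij : w i = w j) {W s t : ℝ} (hW : ∑ l, w l / N ≤ W) (hs : 0 ≤ s)
    (hst : s < t) :
    freeEnergy (fieldTerm N H) (weightedCov (w + Pi.single i (t + s) + Pi.single j (t - s))) ≤
      freeEnergy (fieldTerm N H) (weightedCov (w + Pi.single i t + Pi.single j t)) +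
        10 * W ^ 2 * s ^ 2 := by
  have hsum : ∀ (p q : ℝ) (σ τ : Config N),
      ∑ l, (w + Pi.single i p + Pi.single j q : Fin N → ℝ) l * (spin (σ l) * spin (τ l)) =
      weightedOverlap w σ τ + p * (spin (σ i) * spin (τ i)) + q * (spin (σ j) * spin (τ j)) := by
    intro p q σ τ
    simp [weightedOverlap, add_mul, Finset.sum_add_distrib, Pi.single_apply]
  have h0 : exchangeCov w i j t 0 = weightedCov (w + Pi.single i t + Pi.single j t) := by
    ext σ τ
    rw [weightedCov_apply, hsum]
    simp only [exchangeCov, Matrix.of_apply]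
    ring
  rw [← h0]
  refine le_trans ?_ (freeEnergy_exchangeCov_le w i j t H hw hij hW hs hst)
  have hpos : ∀ l, 0 ≤ (w + Pi.single i (t + s) + Pi.single j (t - s) : Fin N → ℝ) l := by
    intro l
    have h1 : 0 ≤ (Pi.single i (t + s) : Fin N → ℝ) l := by
      rw [Pi.single_apply]; split_ifs <;> linarith
    have h2 : 0 ≤ (Pi.single j (t - s) : Fin N → ℝ) l := by
      rw [Pi.single_apply]; split_ifs <;> linarith
    have := hw l
    simp only [Pi.add_apply]
    linarith
  obtain ⟨ψ, hψ⟩ := exists_exchangeFeatures w i j t hw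
  have hpsd : (exchangeCov w i j t s).PosSemidef := by
    rw [hψ s ⟨by linarith, hst⟩]
    exact posSemidef_featureCov _ _
  -- The true weighted covariance exceeds the affine one by a nonnegative square that vanishes on
  -- the diagonal. It therefore decreases `C σ σ - C σ τ`, and with it the free energy.
  have hdiff : ∀ σ τ, weightedCov (w + Pi.single i (t + s) + Pi.single j (t - s)) σ τ -
      exchangeCov w i j t s σ τ =
      s ^ 2 * (spin (σ i) * spin (τ i) - spin (σ j) * spin (τ j)) ^ 2 / (2 * N) := by
    intro σ τ
    rw [weightedCov_apply, hsum]
    simp only [exchangeCov, Matrix.of_apply]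
    rw [← sub_div]
    congr 1
    have a1 := spin_mul_self (σ i)
    have a2 := spin_mul_self (τ i)
    have a3 := spin_mul_self (σ j)
    have a4 := spin_mul_self (τ j)
    linear_combination 2 * t * s * (spin (τ i) * spin (τ i)) * a1 + 2 * t * s * a2 -
      2 * t * s * (spin (τ j) * spin (τ j)) * a3 - 2 * t * s * a4
  have := freeEnergy_le (posSemidef_weightedCov hpos) hpsd (fieldTerm N H) (c := 0)
    fun σ τ => by
      have h1 := hdiff σ σ
      have h2 := hdiff σ τ
      have h3 : 0 ≤ s ^ 2 * (spin (σ i) * spin (τ i) - spin (σ j) * spin (τ j)) ^ 2 / (2 * N) := by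
        positivity
      rw [spin_mul_self, spin_mul_self] at h1
      norm_num at h1
      linarith
  simpa using this

end SpinGlass

/-! ### The free energy of the model: superadditivity and almost midpoint concavity. -/

namespace SpinGlass

/-- The product of the spins of a couple of sites. -/
def couplePair (N : ℕ) (p : Couple N) (σ : Config N) : ℝ := spin (σ p.1.1) * spin (σ p.1.2)

/-- The exponent of the Boltzmann weights. -/
def skExponent (N : ℕ) (t H : ℝ) (J : Couplings N) : Config N → ℝ :=
  featureField (fieldTerm N H) (couplePair N) (fun _ => t / √N) J

theorem skExponent_apply (N : ℕ) (β h : ℝ) (J : Couplings N) (σ : Config N) :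
    skExponent N β (β * h) J σ = -β * hamiltonian N h J σ := by
  simp only [skExponent, featureField, Pi.add_apply, Finset.sum_apply, Pi.smul_apply, smul_eq_mul,
    fieldTerm, couplePair, hamiltonian]
  have e : ∑ p, β / √N * J p * (spin (σ p.1.1) * spin (σ p.1.2)) =
      β / √N * ∑ p, J p * spin (σ p.1.1) * spin (σ p.1.2) := by
    rw [Finset.mul_sum]
    exact Finset.sum_congr rfl fun p _ => by ring
  rw [e]
  ring

/-- The average of the log-partition function. -/
def skFree (N : ℕ) (t H : ℝ) : ℝ := ∫ J, logZ (skExponent N t H J) ∂couplingLaw N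

/-- The average of the squared overlap. -/
def skOverlap (N : ℕ) (t H : ℝ) : ℝ :=
  ∫ J, gibbs (skExponent N t H J) (fun σ => gibbs (skExponent N t H J)
    fun τ => overlap σ τ ^ 2) ∂couplingLaw N

theorem log_partitionFunction (N : ℕ) (β h : ℝ) (J : Couplings N) :
    Real.log (partitionFunction N β h J) = logZ (skExponent N β (β * h) J) := by
  simp only [partitionFunction, logZ, skExponent_apply]

theorem boltzmann_eq_gibbs (N : ℕ) (β h : ℝ) (J : Couplings N) (A : Config N → ℝ) :
    boltzmann N β h J A = gibbs (skExponent N β (β * h) J) A := by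
  simp only [boltzmann, gibbs, partitionFunction, skExponent_apply]
  rw [div_eq_inv_mul]

theorem alphaN_eq (N : ℕ) (β h : ℝ) : alphaN N β h = skFree N β (β * h) / N := by
  simp only [alphaN, skFree, log_partitionFunction]
  rw [div_eq_inv_mul]

theorem meanSqOverlap_eq (N : ℕ) (β h : ℝ) : meanSqOverlap N β h = skOverlap N β (β * h) := by
  simp only [meanSqOverlap, skOverlap, boltzmann_eq_gibbs]

theorem sum_sq_eq_add_sum_couple {N : ℕ} (x : Fin N → ℝ) :
    (∑ i, x i) ^ 2 = ∑ i, x i ^ 2 + 2 * ∑ p : Couple N, x p.1.1 * x p.1.2 := by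
  have h1 : ∑ p : Couple N, x p.1.1 * x p.1.2 =
      ∑ p : Fin N × Fin N, if p.1 < p.2 then x p.1 * x p.2 else 0 := by
    rw [← Finset.sum_filter]
    exact (Finset.sum_subtype (p := fun p : Fin N × Fin N => p.1 < p.2) _ (by simp)
      fun p : Fin N × Fin N => x p.1 * x p.2).symm
  have h2 : ∑ p : Couple N, x p.1.1 * x p.1.2 =
      ∑ p : Fin N × Fin N, if p.2 < p.1 then x p.1 * x p.2 else 0 := by
    rw [h1, ← Equiv.sum_comp (Equiv.prodComm _ _)]
    refine Finset.sum_congr rfl fun p _ => ?_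
    simp [mul_comm]
  have h3 : ∑ i, x i ^ 2 = ∑ p : Fin N × Fin N, if p.1 = p.2 then x p.1 * x p.2 else 0 := by
    rw [Fintype.sum_prod_type]
    simp [sq]
  rw [two_mul]
  nth_rw 1 [h1]
  rw [h2, h3, ← Finset.sum_add_distrib, ← Finset.sum_add_distrib, sq, Finset.sum_mul_sum,
    ← Fintype.sum_prod_type']
  refine Finset.sum_congr rfl fun p _ => ?_
  rcases lt_trichotomy p.1 p.2 with h | h | h
  · simp [h, h.ne, h.not_gt]
  · simp [h]
  · simp [h, h.ne', h.not_gt]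

theorem sum_couplePair {N : ℕ} (σ τ : Config N) :
    ∑ p, couplePair N p σ * couplePair N p τ =
      ((∑ i, spin (σ i) * spin (τ i)) ^ 2 - N) / 2 := by
  have h := sum_sq_eq_add_sum_couple fun i => spin (σ i) * spin (τ i)
  have h1 : ∑ i, (spin (σ i) * spin (τ i)) ^ 2 = N := by
    have : ∀ i, (spin (σ i) * spin (τ i)) ^ 2 = 1 := fun i => by
      rw [mul_pow, sq, sq, spin_mul_self, spin_mul_self, one_mul]
    simp [this]
  rw [h1] at h
  rw [h, add_sub_cancel_left, mul_div_cancel_left₀ _ two_ne_zero]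
  exact Finset.sum_congr rfl fun p _ => by simp only [couplePair]; ring

theorem isGaussianField_skCoupling (N : ℕ) (t : ℝ) :
    IsGaussianField (couplingLaw N) (featureField 0 (couplePair N) fun _ => t / √N)
      (featureCov (couplePair N) fun _ => t / √N) := isGaussianField_featureField _ _

theorem skFree_eq_freeEnergy_featureCov (N : ℕ) (t H : ℝ) :
    skFree N t H = freeEnergy (fieldTerm N H) (featureCov (couplePair N) fun _ => t / √N) :=
  integral_logZ_featureField _ _ _

theorem posSemidef_weightedCov_const {N : ℕ} (t : ℝ) :
    (weightedCov fun _ : Fin N => t).PosSemidef := by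
  have : (weightedCov fun _ : Fin N => t) = weightedCov fun _ : Fin N => |t| := by
    ext σ τ
    simp only [weightedCov_apply, ← Finset.mul_sum, mul_pow, sq_abs]
  rw [this]
  exact posSemidef_weightedCov fun _ => abs_nonneg t

theorem skCov_apply {N : ℕ} (t : ℝ) (σ τ : Config N) :
    featureCov (couplePair N) (fun _ => t / √N) σ τ =
      t ^ 2 / N * (((∑ i, spin (σ i) * spin (τ i)) ^ 2 - N) / 2) := by
  rw [← sum_couplePair, featureCov_apply, Finset.mul_sum, div_pow, Real.sq_sqrt (by positivity)]
  exact Finset.sum_congr rfl fun p _ => by ring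

/-- Summing over couples `i < j` instead of all ordered pairs, diagonal included, changes the
covariance by the constant `t²/2`, which the free energy does not see. The perfect square that
remains makes comparisons algebraic. -/
theorem skFree_eq_freeEnergy (N : ℕ) (t H : ℝ) :
    skFree N t H = freeEnergy (fieldTerm N H) (weightedCov fun _ : Fin N => t) := by
  rw [skFree_eq_freeEnergy_featureCov]
  refine freeEnergy_congr (posSemidef_featureCov _ _) (posSemidef_weightedCov_const t) _
    fun σ τ => ?_
  simp only [skCov_apply, weightedCov_apply, ← Finset.mul_sum, mul_pow]
  ring

theorem sum_spin_mul_self {N : ℕ} (σ : Config N) : ∑ i, spin (σ i) * spin (σ i) = N := by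
  simp [spin_mul_self]

theorem fieldTerm_append {m n : ℕ} (H : ℝ) (p : Config m × Config n) :
    fieldTerm (m + n) H (Fin.append p.1 p.2) = fieldTerm m H p.1 + fieldTerm n H p.2 := by
  simp [fieldTerm, Fin.sum_univ_add, mul_add]

theorem weightedCov_append {m n : ℕ} (s t : ℝ) (p q : Config m × Config n) :
    weightedCov (Fin.append (fun _ : Fin m => s) fun _ : Fin n => t) (Fin.append p.1 p.2)
      (Fin.append q.1 q.2) = (s * ∑ i, spin (p.1 i) * spin (q.1 i) +
        t * ∑ i, spin (p.2 i) * spin (q.2 i)) ^ 2 / (2 * (m + n)) := by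
  simp [weightedCov_apply, Fin.sum_univ_add, Finset.mul_sum]

/-- Two uncoupled systems compared with the coupled system with two species of sites. -/
theorem skFree_add_le {m n : ℕ} (hm : m ≠ 0) (hn : n ≠ 0) {s t : ℝ} (hs : 0 ≤ s) (ht : 0 ≤ t)
    (H : ℝ) : skFree m s H + skFree n t H ≤ freeEnergy (fieldTerm (m + n) H)
      (weightedCov (Fin.append (fun _ : Fin m => s) fun _ : Fin n => t)) +
        m * n / (4 * (m + n)) * (s - t) ^ 2 := by
  have hpsd : (weightedCov (Fin.append (fun _ : Fin m => s) fun _ : Fin n => t)).PosSemidef :=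
    posSemidef_weightedCov fun i => by
      refine Fin.addCases (fun i => ?_) (fun i => ?_) i
      · simpa using hs
      · simpa using ht
  rw [skFree_eq_freeEnergy, skFree_eq_freeEnergy,
    ← freeEnergy_prod (posSemidef_weightedCov_const s) (posSemidef_weightedCov_const t),
    ← freeEnergy_reindex hpsd _ (Fin.appendEquiv m n)]
  have hb : (fieldTerm (m + n) H ∘ Fin.appendEquiv m n : Config m × Config n → ℝ) =
      fun p => fieldTerm m H p.1 + fieldTerm n H p.2 := funext fun p => fieldTerm_append H p
  rw [hb]
  have hpsd' : (Matrix.of fun p p' : Config m × Config n =>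
      weightedCov (fun _ : Fin m => s) p.1 p'.1 +
        weightedCov (fun _ : Fin n => t) p.2 p'.2).PosSemidef := by
    exact ((posSemidef_weightedCov_const s).submatrix Prod.fst).add
      ((posSemidef_weightedCov_const t).submatrix Prod.snd)
  have hm' : (0 : ℝ) < m := by positivity
  have hn' : (0 : ℝ) < n := by positivity
  have h := freeEnergy_le hpsd' (hpsd.submatrix (Fin.appendEquiv m n))
    (fun p => fieldTerm m H p.1 + fieldTerm n H p.2)
    (c := m * n / (2 * (m + n)) * (s - t) ^ 2) fun p q => by
      -- With `A` and `B` the weighted overlap sums, `A²/m + B²/n - (A+B)²/(m+n) = (nA -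
      -- mB)²/(mn(m+n))`. The off-diagonal value is nonnegative and may be dropped. On the diagonal
      -- `A = sm` and `B = tn`, which leaves the constant in `(s - t)²`.
      have e : ∀ q : Config m × Config n, (Matrix.of fun p p' : Config m × Config n =>
          weightedCov (fun _ : Fin m => s) p.1 p'.1 +
            weightedCov (fun _ : Fin n => t) p.2 p'.2) p q -
          (weightedCov (Fin.append (fun _ : Fin m => s) fun _ : Fin n => t)).submatrix
            (Fin.appendEquiv m n) (Fin.appendEquiv m n) p q =
          (n * (s * ∑ i, spin (p.1 i) * spin (q.1 i)) - m * (t * ∑ i, spin (p.2 i) * spin (q.2 i))) ^ 2 /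
            (2 * m * n * (m + n)) := by
        intro q
        have := weightedCov_append s t p q
        simp only [Matrix.submatrix_apply, Matrix.of_apply, Fin.appendEquiv, Equiv.coe_fn_mk] at this ⊢
        rw [this]
        simp only [weightedCov_apply, ← Finset.mul_sum]
        field_simp
        ring
      have e1 := e p
      have e2 := e q
      rw [sum_spin_mul_self, sum_spin_mul_self] at e1
      have e3 : 0 ≤ (n * (s * ∑ i, spin (p.1 i) * spin (q.1 i)) -
          m * (t * ∑ i, spin (p.2 i) * spin (q.2 i))) ^ 2 / (2 * m * n * (m + n)) := by positivity
      have e4 : ((n : ℝ) * (s * m) - m * (t * n)) ^ 2 / (2 * m * n * (m + n)) =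
          m * n / (2 * (m + n)) * (s - t) ^ 2 := by
        field_simp
      linarith
  refine h.trans (le_of_eq ?_)
  congr 1
  field_simp
  ring

theorem skFree_zero (t H : ℝ) : skFree 0 t H = 0 := by
  have : ∀ J : Couplings 0, logZ (skExponent 0 t H J) = 0 := fun J => by
    simp [logZ, skExponent, featureField, fieldTerm]
  simp [skFree, this]

theorem skFree_abs (N : ℕ) (t H : ℝ) : skFree N |t| H = skFree N t H := by
  rw [skFree_eq_freeEnergy, skFree_eq_freeEnergy]
  congr 1
  ext σ τ
  simp only [weightedCov_apply, ← Finset.mul_sum, mul_pow, sq_abs]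

theorem append_const {m n : ℕ} (t : ℝ) :
    Fin.append (fun _ : Fin m => t) (fun _ : Fin n => t) = fun _ => t := by
  ext i
  refine Fin.addCases (fun i => ?_) (fun i => ?_) i <;> simp

theorem append_add_single {m n : ℕ} (f : Fin m → ℝ) (g : Fin n → ℝ) (i : Fin m) (j : Fin n)
    (p q : ℝ) : Fin.append f g + Pi.single (Fin.castAdd n i) p + Pi.single (Fin.natAdd m j) q =
      Fin.append (f + Pi.single i p) (g + Pi.single j q) := by
  have hne : ∀ (i : Fin m) (j : Fin n), Fin.castAdd n i ≠ Fin.natAdd m j := fun i j h => by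
    have := congrArg Fin.val h
    simp at this
    omega
  ext k
  refine Fin.addCases (fun k => ?_) (fun k => ?_) k
  · simp [Pi.single_apply, hne]
  · simp [Pi.single_apply, (hne _ _).symm]

/-- Superadditivity of the free energy. -/
theorem skFree_superadditive (m n : ℕ) (t H : ℝ) :
    skFree m t H + skFree n t H ≤ skFree (m + n) t H := by
  rcases eq_or_ne m 0 with rfl | hm
  · simp [skFree_zero]
  rcases eq_or_ne n 0 with rfl | hn
  · simp [skFree_zero]
  have := skFree_add_le hm hn (abs_nonneg t) (abs_nonneg t) H
  rw [append_const, ← skFree_eq_freeEnergy] at this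
  simpa [skFree_abs] using this

/-- The free energy is almost midpoint concave in the inverse temperature. -/
theorem skFree_add_skFree_le (n : ℕ) {s t : ℝ} (hs : 0 ≤ s) (hst : s < t) (H : ℝ) :
    skFree n (t + s) H + skFree n (t - s) H ≤
      skFree (n + n) t H + n * ((1 / 2 + 40 * t ^ 2) * s ^ 2) := by
  rcases eq_or_ne n 0 with rfl | hn
  · simp [skFree_zero]
  have hn' : (0 : ℝ) < n := by positivity
  -- The weights differ by `2s`, so joining the systems costs `n²/(8n) * (2s)² = n s²/2`.
  have h1 := skFree_add_le hn hn (s := t + s) (t := t - s) (by linarith) (by linarith) H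
  -- After `k` steps the first `k` pairs, one site from each species, have both weights equal to
  -- `t`.
  set wt : ℕ → Fin (n + n) → ℝ := fun k => Fin.append
    (fun i : Fin n => if (i : ℕ) < k then t else t + s)
    (fun i : Fin n => if (i : ℕ) < k then t else t - s) with hwt
  have hstep : ∀ k ≤ n, freeEnergy (fieldTerm (n + n) H) (weightedCov (wt 0)) ≤
      freeEnergy (fieldTerm (n + n) H) (weightedCov (wt k)) + k * (10 * (2 * t) ^ 2 * s ^ 2) := by
    intro k
    induction k with
    | zero => simp
    | succ k ih =>
      intro hk
      refine (ih (by omega)).trans ?_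
      set i₀ : Fin n := ⟨k, hk⟩ with hi₀
      -- The weights of the current pair are set to zero here and restored by `Pi.single`; this
      -- gives the equal base weights that the exchange symmetry requires.
      set w : Fin (n + n) → ℝ := Fin.append
        (fun i : Fin n => if i = i₀ then 0 else if (i : ℕ) < k then t else t + s)
        (fun i : Fin n => if i = i₀ then 0 else if (i : ℕ) < k then t else t - s) with hw
      have hlt : ∀ i : Fin n, i ≠ i₀ → ((i : ℕ) < k + 1 ↔ (i : ℕ) < k) := by
        intro i hi
        have : (i : ℕ) ≠ k := fun h => hi (Fin.ext h)
        omega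
      have e1 : wt k = w + Pi.single (Fin.castAdd n i₀) (t + s) +
          Pi.single (Fin.natAdd n i₀) (t - s) := by
        rw [hw, append_add_single]
        simp only [hwt]
        congr 1 <;> ext i <;> by_cases hi : i = i₀
        · subst hi; simp [hi₀]
        · simp [hi]
        · subst hi; simp [hi₀]
        · simp [hi]
      have e2 : wt (k + 1) = w + Pi.single (Fin.castAdd n i₀) t +
          Pi.single (Fin.natAdd n i₀) t := by
        rw [hw, append_add_single]
        simp only [hwt]
        congr 1 <;> ext i <;> by_cases hi : i = i₀
        · subst hi; simp [hi₀]
        · simp only [Pi.add_apply, Pi.single_apply, hi, hlt i hi, if_false, add_zero]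
        · subst hi; simp [hi₀]
        · simp only [Pi.add_apply, Pi.single_apply, hi, hlt i hi, if_false, add_zero]
      have hw0 : ∀ l, 0 ≤ w l ∧ w l ≤ 2 * t := by
        intro l
        refine Fin.addCases (fun i => ?_) (fun i => ?_) l
        · simp only [hw, Fin.append_left]
          split_ifs <;> constructor <;> linarith
        · simp only [hw, Fin.append_right]
          split_ifs <;> constructor <;> linarith
      -- All weights are at most `t + s < 2t`, hence `W = 2t` and a cost `10 (2t)² s² = 40 t² s²`
      -- per pair.
      have hW : ∑ l, w l / ((n + n : ℕ) : ℝ) ≤ 2 * t := by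
        rw [← Finset.sum_div, div_le_iff₀ (by positivity)]
        refine (Finset.sum_le_sum fun l _ => (hw0 l).2).trans (le_of_eq ?_)
        simp
        ring
      have := freeEnergy_weightedCov_single_le w (Fin.castAdd n i₀) (Fin.natAdd n i₀) H
        (fun l => (hw0 l).1) (by simp only [hw, Fin.append_left, Fin.append_right, if_true]) hW hs hst
      rw [← e1, ← e2] at this
      push_cast
      linarith
  have h2 := hstep n le_rfl
  have hw0 : wt 0 = Fin.append (fun _ : Fin n => t + s) fun _ : Fin n => t - s := by simp [hwt]
  have hwn : wt n = fun _ => t := by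
    rw [← append_const]
    simp [hwt]
  rw [hw0, hwn, ← skFree_eq_freeEnergy] at h2
  refine h1.trans ((add_le_add_left h2 _).trans (le_of_eq ?_))
  field_simp
  ring

end SpinGlass

/-! ### Thermodynamic limit, convexity in the temperature, and increments over windows of width `1 /
N`. -/

namespace SpinGlass

theorem isGaussianField_zero {S : Type*} [Fintype S] :
    IsGaussianField (Measure.dirac ()) (fun (_ : Unit) (_ : S) => (0 : ℝ)) 0 :=
  ⟨measurable_const, Matrix.PosSemidef.zero, fun c => by simp⟩

theorem freeEnergy_zero {S : Type*} [Fintype S] [Nonempty S] [DecidableEq S] (b : S → ℝ) :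
    freeEnergy b 0 = logZ b := by
  rw [← isGaussianField_zero.integral_logZ b]
  simp

theorem abs_sum_spin_le {N : ℕ} (σ τ : Config N) : |∑ i, spin (σ i) * spin (τ i)| ≤ N := by
  refine (Finset.abs_sum_le_sum_abs _ _).trans ?_
  simp [abs_mul, abs_spin]

theorem logZ_fieldTerm_le (N : ℕ) (H : ℝ) : logZ (fieldTerm N H) ≤ N * (Real.log 2 + |H|) := by
  have h1 : ∑ σ, Real.exp (fieldTerm N H σ) ≤ 2 ^ N * Real.exp (N * |H|) := by
    have : ∀ σ : Config N, Real.exp (fieldTerm N H σ) ≤ Real.exp (N * |H|) := fun σ => by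
      refine Real.exp_le_exp.2 ((le_abs_self _).trans ?_)
      rw [fieldTerm, abs_mul, mul_comm]
      refine mul_le_mul_of_nonneg_right ?_ (abs_nonneg _)
      refine (Finset.abs_sum_le_sum_abs _ _).trans ?_
      simp [abs_spin]
    refine (Finset.sum_le_sum fun σ _ => this σ).trans (le_of_eq ?_)
    simp
  refine (Real.log_le_log (sum_exp_pos _) h1).trans (le_of_eq ?_)
  rw [Real.log_mul (by positivity) (Real.exp_pos _).ne', Real.log_exp, Real.log_pow]
  ring

theorem skFree_le (N : ℕ) (t H : ℝ) : skFree N t H ≤ N * (Real.log 2 + |H| + t ^ 2 / 4) := by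
  rcases eq_or_ne N 0 with rfl | hN
  · simp [skFree_zero]
  have hN' : (0 : ℝ) < N := by positivity
  rw [skFree_eq_freeEnergy]
  have := freeEnergy_le (posSemidef_weightedCov_const t) Matrix.PosSemidef.zero (fieldTerm N H)
    (c := t ^ 2 * N / 2) fun σ τ => by
      simp only [weightedCov_apply, ← Finset.mul_sum, sum_spin_mul_self, Matrix.zero_apply]
      have : 0 ≤ (t * ∑ i, spin (σ i) * spin (τ i)) ^ 2 / (2 * N) := by positivity
      have e : (t * N) ^ 2 / (2 * N) = t ^ 2 * N / 2 := by field_simp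
      linarith
  rw [freeEnergy_zero] at this
  linarith [logZ_fieldTerm_le N H]

/-- The limiting free energy per site. -/
def skLimit (t H : ℝ) : ℝ := ⨆ N : ℕ, skFree (N + 1) t H / (N + 1 : ℕ)

/-- Fekete's lemma applied to `-skFree`; the comparison with zero covariance in `skFree_le` supplies
the bound, and the Fekete limit is the supremum. -/
theorem tendsto_skFree (t H : ℝ) :
    Tendsto (fun N : ℕ => skFree N t H / N) atTop (𝓝 (skLimit t H)) := by
  have hsub : Subadditive fun N => -skFree N t H := fun m n => by
    linarith [skFree_superadditive m n t H]
  have hbdd : BddBelow (Set.range fun N : ℕ => -skFree N t H / N) := by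
    refine ⟨-(Real.log 2 + |H| + t ^ 2 / 4), ?_⟩
    rintro _ ⟨N, rfl⟩
    rcases eq_or_ne N 0 with rfl | hN
    · have : 0 ≤ Real.log 2 := Real.log_nonneg one_le_two
      have : 0 ≤ Real.log 2 + |H| + t ^ 2 / 4 := by positivity
      simpa only [Nat.cast_zero, div_zero] using neg_nonpos.2 this
    · have hN' : (0 : ℝ) < N := by positivity
      beta_reduce
      rw [neg_div]
      refine neg_le_neg ((div_le_iff₀ hN').2 ?_)
      linarith [skFree_le N t H]
  have hlim : Tendsto (fun N : ℕ => skFree N t H / N) atTop (𝓝 (-hsub.lim)) := by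
    have := (hsub.tendsto_lim hbdd).neg
    simpa [neg_div] using this
  have hle : ∀ N : ℕ, skFree (N + 1) t H / (N + 1 : ℕ) ≤ -hsub.lim := fun N => by
    have := hsub.lim_le_div hbdd (Nat.succ_ne_zero N)
    rw [neg_div] at this
    exact le_neg.1 this
  have hval : skLimit t H = -hsub.lim := by
    apply le_antisymm
    · exact ciSup_le hle
    · refine le_of_tendsto' ((tendsto_add_atTop_iff_nat 1).2 hlim) fun N => ?_
      exact le_ciSup (f := fun N : ℕ => skFree (N + 1) t H / (N + 1 : ℕ))
        ⟨-hsub.lim, by rintro _ ⟨N, rfl⟩; exact hle N⟩ N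
  rwa [hval]

theorem alpha_eq (β h : ℝ) : alpha β h = skLimit β (β * h) := by
  simp only [alpha, skLimit, alphaN_eq]

/-- The finite-size concavity estimate divided by `n`; the system of `2n` sites has the same limit
per site, which accounts for the factor `2`. Negative `t` is handled by evenness. -/
theorem skLimit_add_le {s t : ℝ} (hs : 0 ≤ s) (hst : s < |t|) (H : ℝ) :
    skLimit (t + s) H + skLimit (t - s) H - 2 * skLimit t H ≤ (1 / 2 + 40 * t ^ 2) * s ^ 2 := by
  have hpos : ∀ {t : ℝ}, s < t →
      skLimit (t + s) H + skLimit (t - s) H - 2 * skLimit t H ≤ (1 / 2 + 40 * t ^ 2) * s ^ 2 := by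
    intro t hst
    have h2 : Tendsto (fun n : ℕ => 2 * (skFree (n + n) t H / (n + n : ℕ))) atTop
        (𝓝 (2 * skLimit t H)) :=
      ((tendsto_skFree t H).comp (tendsto_atTop_mono (fun n : ℕ => Nat.le_add_left n n)
        tendsto_id)).const_mul 2
    refine le_of_tendsto (((tendsto_skFree (t + s) H).add (tendsto_skFree (t - s) H)).sub h2) ?_
    filter_upwards [eventually_gt_atTop 0] with n hn
    have hn' : (0 : ℝ) < n := by exact_mod_cast hn
    have := skFree_add_skFree_le n hs hst H
    have e : skFree n (t + s) H / n + skFree n (t - s) H / n -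
        2 * (skFree (n + n) t H / (n + n : ℕ)) =
        (skFree n (t + s) H + skFree n (t - s) H - skFree (n + n) t H) / n := by
      push_cast
      field_simp
      ring
    rw [e, div_le_iff₀ hn']
    linarith
  have habs : ∀ u, skLimit |u| H = skLimit u H := fun u => by simp only [skLimit, skFree_abs]
  rcases le_or_gt 0 t with ht | ht
  · rw [abs_of_nonneg ht] at hst
    exact hpos hst
  · have h := hpos hst
    rw [abs_of_neg ht] at h hst
    rw [← habs (-t + s), ← habs (-t - s), ← habs (-t),
      show -t + s = -(t - s) by ring, show -t - s = -(t + s) by ring] at h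
    simp only [abs_neg, habs] at h
    linarith [neg_sq t]

/-- The Gibbs variational inequality: `logZ` lies above its tangents. It is Jensen's inequality for
the exponential under the Gibbs measure of `Y`, obtained by integrating `1 + z ≤ exp z`. -/
theorem logZ_add_gibbs_le {S : Type*} [Fintype S] [Nonempty S] (Y X : S → ℝ) :
    logZ Y + gibbs Y (fun σ => X σ - Y σ) ≤ logZ X := by
  set m := gibbs Y fun σ => X σ - Y σ with hm
  rw [logZ, logZ, Real.le_log_iff_exp_le (sum_exp_pos X), Real.exp_add, Real.exp_log (sum_exp_pos Y)]
  have h1 : ∑ σ, Real.exp (Y σ) * (Real.exp m * (1 + (X σ - Y σ) - m)) =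
      (∑ σ, Real.exp (Y σ)) * Real.exp m := by
    have h2 : m * ∑ σ, Real.exp (Y σ) = ∑ σ, (X σ - Y σ) * Real.exp (Y σ) := by
      rw [hm, gibbs, div_mul_cancel₀ _ (sum_exp_pos Y).ne']
    have h3 : ∀ σ, Real.exp (Y σ) * (Real.exp m * (1 + (X σ - Y σ) - m)) =
        Real.exp m * Real.exp (Y σ) + Real.exp m * ((X σ - Y σ) * Real.exp (Y σ)) -
          Real.exp m * m * Real.exp (Y σ) := fun σ => by ring
    rw [Finset.sum_congr rfl fun σ _ => h3 σ, Finset.sum_sub_distrib, Finset.sum_add_distrib,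
      ← Finset.mul_sum, ← Finset.mul_sum, ← Finset.mul_sum, ← h2]
    ring
  rw [← h1]
  refine Finset.sum_le_sum fun σ _ => ?_
  have h4 : Real.exp (X σ) = Real.exp (Y σ) * (Real.exp m * Real.exp (X σ - Y σ - m)) := by
    rw [← Real.exp_add, ← Real.exp_add]
    congr 1
    ring
  rw [h4]
  have := Real.add_one_le_exp (X σ - Y σ - m)
  gcongr
  linarith

theorem convexOn_logZ {S : Type*} [Fintype S] [Nonempty S] :
    ConvexOn ℝ Set.univ (logZ : (S → ℝ) → ℝ) := by
  refine ⟨convex_univ, fun X _ Y _ a b ha hb hab => ?_⟩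
  have h1 := logZ_add_gibbs_le (a • X + b • Y) X
  have h2 := logZ_add_gibbs_le (a • X + b • Y) Y
  rw [gibbs_sub] at h1 h2
  have h3 : gibbs (a • X + b • Y) (fun σ => (a • X + b • Y) σ) =
      a * gibbs (a • X + b • Y) (fun σ => X σ) + b * gibbs (a • X + b • Y) (fun σ => Y σ) := by
    rw [← gibbs_const_mul, ← gibbs_const_mul]
    exact gibbs_add _ (fun σ => a * X σ) (fun σ => b * Y σ)
  rw [h3] at h1 h2
  simp only [smul_eq_mul]
  have := add_le_add (mul_le_mul_of_nonneg_left h1 ha) (mul_le_mul_of_nonneg_left h2 hb)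
  obtain rfl : b = 1 - a := by linarith
  nlinarith

theorem integrable_skExponent (N : ℕ) (t H : ℝ) :
    Integrable (fun J => logZ (skExponent N t H J)) (couplingLaw N) :=
  hasBoundedDerivs_logZ.integrable_featureField _ _ _

theorem isProbabilityMeasure_couplingLaw (N : ℕ) : IsProbabilityMeasure (couplingLaw N) := by
  unfold couplingLaw
  infer_instance

/-- For fixed noise and fixed `H` the exponent is affine in `t`, and `logZ` is convex. Keeping `H`
separate from `t` is essential: only the coupling strength varies. -/
theorem convexOn_skFree (N : ℕ) (H : ℝ) : ConvexOn ℝ Set.univ fun t => skFree N t H := by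
  refine ⟨convex_univ, fun s _ t _ a b ha hb hab => ?_⟩
  simp only [skFree, smul_eq_mul]
  rw [← integral_const_mul, ← integral_const_mul, ← integral_add
    ((integrable_skExponent N s H).const_mul a) ((integrable_skExponent N t H).const_mul b)]
  refine integral_mono (integrable_skExponent _ _ _)
    (((integrable_skExponent N s H).const_mul a).add ((integrable_skExponent N t H).const_mul b))
    fun J => ?_
  have h := convexOn_logZ.2 (Set.mem_univ (skExponent N s H J)) (Set.mem_univ (skExponent N t H J))
    ha hb hab
  refine (le_of_eq ?_).trans h
  congr 1
  simp only [skExponent, featureField, smul_add, Finset.smul_sum, smul_smul]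
  rw [add_add_add_comm, ← add_smul, hab, one_smul, ← Finset.sum_add_distrib]
  congr 1
  refine Finset.sum_congr rfl fun p _ => ?_
  rw [← add_smul]
  congr 1
  ring

theorem sum_gibbs_couplePair_sq {N : ℕ} (hN : N ≠ 0) (Y : Config N → ℝ) :
    ∑ p, gibbs Y (couplePair N p) ^ 2 =
      N ^ 2 / 2 * gibbs Y (fun σ => gibbs Y fun τ => overlap σ τ ^ 2) - N / 2 := by
  have hN' : (0 : ℝ) < N := by positivity
  have e1 : ∀ p, gibbs Y (couplePair N p) ^ 2 =
      gibbs Y fun σ => gibbs Y fun τ => couplePair N p σ * couplePair N p τ := fun p => by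
    simp only [gibbs_const_mul, gibbs_mul_const, sq]
  have e2 : ∀ σ τ : Config N, ∑ p, couplePair N p σ * couplePair N p τ =
      N ^ 2 / 2 * overlap σ τ ^ 2 - N / 2 := fun σ τ => by
    rw [sum_couplePair, overlap]
    field_simp
  rw [Finset.sum_congr rfl fun p _ => e1 p, ← gibbs_sum]
  have e3 : ∀ σ, ∑ p, gibbs Y (fun τ => couplePair N p σ * couplePair N p τ) =
      N ^ 2 / 2 * gibbs Y (fun τ => overlap σ τ ^ 2) - N / 2 := fun σ => by
    rw [← gibbs_sum]
    simp only [e2, gibbs_sub, gibbs_const, gibbs_const_mul]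
  rw [funext e3, gibbs_sub, gibbs_const, gibbs_const_mul]

/-- Each couple contributes `t/N * (1 - E⟨σ_i σ_j⟩²)`. There are `(N² - N)/2` couples, and the
squares sum to `N²/2 * ⟨q²⟩ - N/2`, so the terms of order `N` cancel. -/
theorem hasDerivAt_skFree {N : ℕ} (hN : N ≠ 0) (t H : ℝ) :
    HasDerivAt (fun t => skFree N t H) (t * N / 2 * (1 - skOverlap N t H)) t := by
  have hN' : (0 : ℝ) < N := by positivity
  have h := hasBoundedDerivs_logZ.hasDerivAt_integral (fieldTerm N H) (couplePair N)
    (fun t _ => t / √N) (fun _ _ => 1 / √N) t (1 / √N)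
    (Filter.Eventually.of_forall fun u p => ⟨by simpa using (hasDerivAt_id u).div_const (√N),
      by rw [abs_of_nonneg (by positivity)]⟩)
  refine h.congr_deriv ?_
  have hsq : ∀ p (σ : Config N), couplePair N p σ * couplePair N p σ = 1 := fun p σ => by
    have a1 := spin_mul_self (σ p.1.1)
    have a2 := spin_mul_self (σ p.1.2)
    simp only [couplePair]
    linear_combination (spin (σ p.1.2) * spin (σ p.1.2)) * a1 + a2
  have hint : ∀ p, Integrable (fun J => gibbs (skExponent N t H J) (couplePair N p) ^ 2)
      (couplingLaw N) := fun p =>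
    (hasBoundedDerivs_gibbs_sq (couplePair N p)).integrable_featureField _ _ _
  have h1 : ∀ p, ∫ g, (gibbs (featureField (fieldTerm N H) (couplePair N) (fun _ => t / √N) g)
      (couplePair N p * couplePair N p) -
      gibbs (featureField (fieldTerm N H) (couplePair N) (fun _ => t / √N) g) (couplePair N p) *
      gibbs (featureField (fieldTerm N H) (couplePair N) (fun _ => t / √N) g) (couplePair N p))
        ∂stdGauss (Couple N) =
      1 - ∫ J, gibbs (skExponent N t H J) (couplePair N p) ^ 2 ∂couplingLaw N := fun p =>
    integral_gibbs_variance _ _ _ (hsq p)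
  have hg := sum_gibbs_couplePair_sq hN
  have hcard : ∑ _p : Couple N, (1 : ℝ) = (N ^ 2 - N) / 2 := by
    have := sum_couplePair (fun _ => 1 : Config N) fun _ => 1
    simpa [couplePair, spin] using this
  have hov : ∑ p, ∫ J, gibbs (skExponent N t H J) (couplePair N p) ^ 2 ∂couplingLaw N =
      N ^ 2 / 2 * skOverlap N t H - N / 2 := by
    have := isProbabilityMeasure_couplingLaw N
    rw [← integral_finsetSum _ fun p _ => hint p, skOverlap]
    have hi := integrable_finsetSum Finset.univ fun p (_ : p ∈ Finset.univ) => hint p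
    simp only [hg] at hi ⊢
    have hi2 : Integrable (fun J => (N : ℝ) ^ 2 / 2 * gibbs (skExponent N t H J)
        (fun σ => gibbs (skExponent N t H J) fun τ => overlap σ τ ^ 2)) (couplingLaw N) := by
      simpa only [Pi.add_def, sub_add_cancel] using hi.add (integrable_const ((N : ℝ) / 2))
    rw [integral_sub hi2 (integrable_const _), integral_const_mul]
    simp
  simp only [h1]
  rw [← Finset.mul_sum, Finset.sum_sub_distrib, hov, hcard]
  have : √(N : ℝ) * √N = N := Real.mul_self_sqrt hN'.le
  have e : t / √(N : ℝ) * (1 / √N) = t / N := by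
    rw [div_mul_div_comm, this, mul_one]
  rw [e]
  field_simp
  ring

/-- A convex function near a point, compared with its tangent. -/
theorem convexOn_sub_tangent_mem {f : ℝ → ℝ} (hf : ConvexOn ℝ Set.univ f) {t d : ℝ}
    (hd : HasDerivAt f d t) {s u : ℝ} (hs : 0 < s) (hu : |u - t| ≤ s) :
    0 ≤ f u - f t - (u - t) * d ∧
      f u - f t - (u - t) * d ≤ |u - t| / s * (f (t + s) + f (t - s) - 2 * f t) := by
  have hsupp : ∀ x, 0 ≤ f x - f t - (x - t) * d := by
    intro x
    rcases lt_trichotomy t x with h | h | h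
    · have := hf.le_slope_of_hasDerivAt (Set.mem_univ t) (Set.mem_univ x) h hd
      rw [slope_def_field, le_div_iff₀ (by linarith)] at this
      linarith
    · subst h; simp
    · have := hf.slope_le_of_hasDerivAt (Set.mem_univ x) (Set.mem_univ t) h hd
      rw [slope_def_field, div_le_iff₀ (by linarith)] at this
      linarith
  refine ⟨hsupp u, ?_⟩
  have h1 := hsupp (t + s)
  have h2 := hsupp (t - s)
  -- The excess over the tangent is convex, nonnegative and zero at `t`, so at distance `r` it is at
  -- most `r/s` times its value at distance `s`. The excesses at `t + s` and `t - s` add up to the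
  -- second difference, so each is bounded by it.
  have key : ∀ ε : ℝ, (ε = 1 ∨ ε = -1) → ∀ r, 0 ≤ r → r ≤ s →
      f (t + ε * r) - f t - (ε * r) * d ≤ r / s * (f (t + ε * s) - f t - (ε * s) * d) := by
    intro ε _ r hr hrs
    obtain ⟨_, hf2⟩ := hf
    have hc := @hf2 t (Set.mem_univ t) (t + ε * s) (Set.mem_univ _) (1 - r / s) (r / s) (by rw [sub_nonneg, div_le_one hs]; exact hrs)
      (by positivity) (by ring)
    have e : (1 - r / s) • t + (r / s) • (t + ε * s) = t + ε * r := by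
      simp only [smul_eq_mul]
      field_simp
      ring
    rw [e] at hc
    simp only [smul_eq_mul] at hc
    have e2 : r / s * (ε * s * d) = ε * r * d := by field_simp
    nlinarith
  have hr : 0 ≤ |u - t| / s := by positivity
  rcases abs_cases (u - t) with ⟨h, h'⟩ | ⟨h, h'⟩
  · have := key 1 (Or.inl rfl) |u - t| (abs_nonneg _) hu
    rw [one_mul, one_mul, h, show t + (u - t) = u by ring] at this
    rw [h] at hr ⊢
    refine this.trans (mul_le_mul_of_nonneg_left ?_ hr)
    linarith
  · have := key (-1) (Or.inr rfl) |u - t| (abs_nonneg _) hu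
    rw [show t + -1 * |u - t| = u by rw [h]; ring, show -1 * |u - t| = u - t by rw [h]; ring,
      show t + -1 * s = t - s by ring] at this
    refine this.trans (mul_le_mul_of_nonneg_left ?_ hr)
    linarith

/-- Increments of the free energy over windows of width `1 / N`. -/
theorem tendsto_skFree_sub {t H Q ℓ : ℝ} (ht : t ≠ 0)
    (hQ : Tendsto (fun N => skOverlap N t H) atTop (𝓝 Q)) {u : ℕ → ℝ}
    (hℓ : Tendsto (fun N : ℕ => N * (u N - t)) atTop (𝓝 ℓ)) :
    Tendsto (fun N => skFree N (u N) H - skFree N t H) atTop (𝓝 (ℓ * (t / 2 * (1 - Q)))) := by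
  have hmain : Tendsto (fun N : ℕ => N * (u N - t) * (t / 2 * (1 - skOverlap N t H))) atTop
      (𝓝 (ℓ * (t / 2 * (1 - Q)))) := hℓ.mul ((hQ.const_sub 1).const_mul _)
  have hrem : Tendsto (fun N : ℕ => skFree N (u N) H - skFree N t H -
      N * (u N - t) * (t / 2 * (1 - skOverlap N t H))) atTop (𝓝 0) := by
    have hu : Tendsto (fun N => u N - t) atTop (𝓝 0) := by
      have := hℓ.mul (tendsto_inv_atTop_nhds_zero_nat (𝕜 := ℝ))
      rw [mul_zero] at this
      refine this.congr' ?_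
      filter_upwards [eventually_gt_atTop 0] with N hN
      have : (0 : ℝ) < N := by exact_mod_cast hN
      field_simp
    rw [Metric.tendsto_nhds]
    intro ε hε
    -- The limiting error is at most `|ℓ|/s * (1/2 + 40 t²) s² ≤ C s`. The step `s` is fixed before
    -- `N` grows, small enough that `C s ≤ ε/2` and `s < |t|`.
    set C : ℝ := (|ℓ| + 1) * (1 / 2 + 40 * t ^ 2) with hC
    have hCpos : 0 < C := by positivity
    set s : ℝ := min (|t| / 2) (ε / (2 * C)) with hs
    have hs0 : 0 < s := lt_min (by positivity) (by positivity)
    have hst : s < |t| := (min_le_left _ _).trans_lt (half_lt_self (abs_pos.2 ht))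
    have hCs : C * s ≤ ε / 2 := by
      have : s ≤ ε / (2 * C) := min_le_right _ _
      calc C * s ≤ C * (ε / (2 * C)) := by gcongr
        _ = ε / 2 := by field_simp
    have hb : Tendsto (fun N : ℕ => |N * (u N - t)| / s *
        (skFree N (t + s) H / N + skFree N (t - s) H / N - 2 * (skFree N t H / N))) atTop
        (𝓝 (|ℓ| / s * (skLimit (t + s) H + skLimit (t - s) H - 2 * skLimit t H))) :=
      (hℓ.abs.div_const s).mul (((tendsto_skFree (t + s) H).add (tendsto_skFree (t - s) H)).sub
        ((tendsto_skFree t H).const_mul 2))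
    have hlim : |ℓ| / s * (skLimit (t + s) H + skLimit (t - s) H - 2 * skLimit t H) < ε := by
      have h1 := mul_le_mul_of_nonneg_left (skLimit_add_le hs0.le hst H)
        (by positivity : 0 ≤ |ℓ| / s)
      refine h1.trans_lt ?_
      have e : |ℓ| / s * ((1 / 2 + 40 * t ^ 2) * s ^ 2) = |ℓ| * (1 / 2 + 40 * t ^ 2) * s := by
        field_simp
      rw [e]
      have : |ℓ| * (1 / 2 + 40 * t ^ 2) * s ≤ C * s := by
        rw [hC]
        gcongr
        linarith
      linarith
    filter_upwards [hb.eventually_lt_const hlim, eventually_gt_atTop 0,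
      (Metric.tendsto_nhds.1 hu) s hs0] with N hN hN0 huN
    have hN' : (0 : ℝ) < N := by exact_mod_cast hN0
    rw [Real.dist_0_eq_abs] at huN ⊢
    obtain ⟨h1, h2⟩ := convexOn_sub_tangent_mem (convexOn_skFree N H)
      (hasDerivAt_skFree hN0.ne' t H) hs0 huN.le
    have e1 : N * (u N - t) * (t / 2 * (1 - skOverlap N t H)) =
        (u N - t) * (t * N / 2 * (1 - skOverlap N t H)) := by ring
    rw [e1, abs_of_nonneg h1]
    refine h2.trans_lt (lt_of_eq_of_lt ?_ hN)
    rw [abs_mul, abs_of_pos hN']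
    field_simp
  simpa using hrem.add hmain

end SpinGlass

/-! ### Gaussian moments and the free energy near infinite temperature. -/

namespace SpinGlass

section moments

variable {Ω S : Type*} [MeasurableSpace Ω] [Fintype S] {μ : Measure Ω} [IsProbabilityMeasure μ]
  {X : Ω → S → ℝ} {C : Matrix S S ℝ}

theorem IsGaussianField.map_sum_eq (hX : IsGaussianField μ X C) (c : S → ℝ) :
    μ.map (fun ω => ∑ σ, c σ * X ω σ) =
      gaussianReal 0 (∑ σ, ∑ τ, c σ * c τ * C σ τ).toNNReal := by
  have hm : Measurable fun ω => ∑ σ, c σ * X ω σ :=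
    Finset.measurable_sum _ fun σ _ => ((measurable_pi_apply σ).comp hX.measurable).const_mul _
  have hnn : 0 ≤ ∑ σ, ∑ τ, c σ * c τ * C σ τ := by
    have := hX.posSemidef.dotProduct_mulVec_nonneg c
    simp only [dotProduct, Matrix.mulVec, Finset.mul_sum, Pi.star_apply, star_trivial] at this
    refine this.trans_eq (Finset.sum_congr rfl fun σ _ => Finset.sum_congr rfl fun τ _ => ?_)
    ring
  apply Measure.ext_of_charFun
  ext t
  rw [charFun_gaussianReal, charFun_apply_real, integral_map hm.aemeasurable (by fun_prop)]
  have h := hX.integral_cexp fun σ => t * c σ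
  have e1 : ∀ ω, ((∑ σ, t * c σ * X ω σ : ℝ) : ℂ) = t * ((∑ σ, c σ * X ω σ : ℝ) : ℂ) := by
    intro ω
    rw [← Complex.ofReal_mul, Finset.mul_sum]
    simp only [mul_assoc]
  have e2 : ∑ σ, ∑ τ, t * c σ * (t * c τ) * C σ τ = t ^ 2 * ∑ σ, ∑ τ, c σ * c τ * C σ τ := by
    simp only [Finset.mul_sum]
    refine Finset.sum_congr rfl fun σ _ => Finset.sum_congr rfl fun τ _ => ?_
    ring
  simp only [e1, e2] at h
  rw [h]
  congr 1
  rw [Real.coe_toNNReal _ hnn]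
  push_cast
  ring

theorem IsGaussianField.integrable_exp_sum (hX : IsGaussianField μ X C) (c : S → ℝ) :
    Integrable (fun ω => Real.exp (∑ σ, c σ * X ω σ)) μ := by
  have hm : Measurable fun ω => ∑ σ, c σ * X ω σ :=
    Finset.measurable_sum _ fun σ _ => ((measurable_pi_apply σ).comp hX.measurable).const_mul _
  have h := integrable_exp_mul_gaussianReal (μ := 0)
    (v := (∑ σ, ∑ τ, c σ * c τ * C σ τ).toNNReal) 1
  rw [← hX.map_sum_eq c] at h
  simpa [Function.comp_def] using h.comp_measurable hm

theorem IsGaussianField.integral_exp_sum (hX : IsGaussianField μ X C) (c : S → ℝ) :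
    ∫ ω, Real.exp (∑ σ, c σ * X ω σ) ∂μ = Real.exp ((∑ σ, ∑ τ, c σ * c τ * C σ τ) / 2) := by
  have hnn : 0 ≤ ∑ σ, ∑ τ, c σ * c τ * C σ τ := by
    have := hX.posSemidef.dotProduct_mulVec_nonneg c
    simp only [dotProduct, Matrix.mulVec, Finset.mul_sum, Pi.star_apply, star_trivial] at this
    refine this.trans_eq (Finset.sum_congr rfl fun σ _ => Finset.sum_congr rfl fun τ _ => ?_)
    ring
  have := mgf_gaussianReal (hX.map_sum_eq c) 1
  simp only [mgf, one_mul] at this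
  rw [this, Real.coe_toNNReal _ hnn]
  simp

theorem IsGaussianField.integral_sum_sq (hX : IsGaussianField μ X C) (c : S → ℝ) :
    Integrable (fun ω => (∑ σ, c σ * X ω σ) ^ 2) μ ∧
      ∫ ω, (∑ σ, c σ * X ω σ) ^ 2 ∂μ = ∑ σ, ∑ τ, c σ * c τ * C σ τ := by
  have hm : Measurable fun ω => ∑ σ, c σ * X ω σ :=
    Finset.measurable_sum _ fun σ _ => ((measurable_pi_apply σ).comp hX.measurable).const_mul _
  have hnn : 0 ≤ ∑ σ, ∑ τ, c σ * c τ * C σ τ := by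
    have := hX.posSemidef.dotProduct_mulVec_nonneg c
    simp only [dotProduct, Matrix.mulVec, Finset.mul_sum, Pi.star_apply, star_trivial] at this
    refine this.trans_eq (Finset.sum_congr rfl fun σ _ => Finset.sum_congr rfl fun τ _ => ?_)
    ring
  have hmap := hX.map_sum_eq c
  have h1 : Integrable (fun x : ℝ => x ^ 2)
      (gaussianReal 0 (∑ σ, ∑ τ, c σ * c τ * C σ τ).toNNReal) :=
    (memLp_id_gaussianReal 2).integrable_sq
  have h2 : ∫ x, x ^ 2 ∂gaussianReal 0 (∑ σ, ∑ τ, c σ * c τ * C σ τ).toNNReal =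
      ∑ σ, ∑ τ, c σ * c τ * C σ τ := by
    have := variance_fun_id_gaussianReal (μ := 0) (v := (∑ σ, ∑ τ, c σ * c τ * C σ τ).toNNReal)
    rw [variance_eq_integral aemeasurable_id'] at this
    simpa [integral_id_gaussianReal, hnn] using this
  constructor
  · rw [← hmap] at h1
    exact h1.comp_measurable hm
  · rw [← hmap, integral_map hm.aemeasurable (by fun_prop)] at h2
    exact h2

end moments

/-- A pointwise lower bound of the logarithm adapted to second moment estimates. -/
theorem sub_sub_le_log {x y g : ℝ} (hx : 0 ≤ x) (hy : 0 < y) (hg : g - x / 2 ≤ Real.log y) :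
    (y - 1) - (2 + 2 * x) * (y - 1) ^ 2 - |g| ≤ Real.log y := by
  -- For `y ≥ 1/2` the bound comes from `log y ≥ 1 - 1/y = (y-1) - (y-1)²/y`. For `y < 1/2` one has
  -- `(y-1)² ≥ 1/4`, and the coefficient `2 + 2x` is just large enough for the quadratic term to
  -- absorb the `x/2` of the a priori bound.
  rcases le_or_gt (1 / 2) y with h | h
  · have h1 := Real.one_sub_inv_le_log_of_pos hy
    have h2 : (y - 1) - 2 * (y - 1) ^ 2 ≤ 1 - y⁻¹ := by
      have h3 : y⁻¹ ≤ 2 := by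
        rw [inv_le_comm₀ hy two_pos]
        linarith
      have h4 : 1 - y⁻¹ - (y - 1) = -((y - 1) ^ 2 * y⁻¹) := by
        field_simp
        ring
      nlinarith [mul_le_mul_of_nonneg_left h3 (sq_nonneg (y - 1))]
    nlinarith [abs_nonneg g, mul_nonneg hx (sq_nonneg (y - 1))]
  · have h1 : 1 / 4 ≤ (y - 1) ^ 2 := by nlinarith
    nlinarith [neg_abs_le g, mul_le_mul_of_nonneg_left h1 hx]

/-- Flipping the first spin of the couple changes the sign of the product. -/
theorem gibbs_zero_couplePair {N : ℕ} (p : Couple N) : gibbs 0 (couplePair N p) = 0 := by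
  classical
  have hflip : Function.Involutive fun σ : Config N => Function.update σ p.1.1 (-σ p.1.1) := by
    intro σ
    simp
  have h : ∑ σ : Config N, couplePair N p σ = -∑ σ : Config N, couplePair N p σ := by
    nth_rw 1 [← Equiv.sum_comp hflip.toPerm]
    rw [← Finset.sum_neg_distrib]
    refine Finset.sum_congr rfl fun σ _ => ?_
    have hne : p.1.2 ≠ p.1.1 := p.2.ne'
    simp [couplePair, Function.Involutive.toPerm, Function.update_of_ne hne, spin_neg]
  have h0 : ∑ σ : Config N, couplePair N p σ = 0 := by linarith
  simp [gibbs, h0]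

theorem gibbs_zero_overlap_sq {N : ℕ} (hN : N ≠ 0) :
    gibbs 0 (fun σ : Config N => gibbs 0 fun τ => overlap σ τ ^ 2) = 1 / N := by
  have hN' : (0 : ℝ) < N := by positivity
  have h := sum_gibbs_couplePair_sq hN (0 : Config N → ℝ)
  simp only [gibbs_zero_couplePair] at h
  field_simp
  simp at h
  field_simp at h
  nlinarith

theorem skExponent_zero (N : ℕ) (J : Couplings N) : skExponent N 0 0 J = 0 := by
  ext σ
  simp [skExponent, featureField, fieldTerm]

theorem skOverlap_zero {N : ℕ} (hN : N ≠ 0) : skOverlap N 0 0 = 1 / N := by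
  have := isProbabilityMeasure_couplingLaw N
  simp [skOverlap, skExponent_zero, gibbs_zero_overlap_sq hN]

theorem gibbs_zero {N : ℕ} (A : Config N → ℝ) : gibbs 0 A = (2 ^ N)⁻¹ * ∑ σ, A σ := by
  simp [gibbs, div_eq_inv_mul]

theorem skFree_zero_zero (N : ℕ) : skFree N 0 0 = Real.log (2 ^ N) := by
  have := isProbabilityMeasure_couplingLaw N
  simp [skFree, skExponent_zero, logZ]

/-- The free energy at infinite temperature, in a window of width `1 / √N`. -/
theorem skFree_sub_zero_bounds {N : ℕ} (hN : N ≠ 0) {x t : ℝ} (hx : 0 ≤ x)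
    (ht : t ^ 2 = 2 * x / N) :
    skFree N t 0 - skFree N 0 0 ≤ x / 2 ∧
      x / 2 - (2 + 2 * x) * (x * Real.exp x / N) - (1 + x) / (2 * √N) ≤
        skFree N t 0 - skFree N 0 0 := by
  have hN' : (0 : ℝ) < N := by positivity
  set C : Matrix (Config N) (Config N) ℝ := weightedCov fun _ : Fin N => t with hC
  have hCq : ∀ σ τ, C σ τ = x * overlap σ τ ^ 2 := fun σ τ => by
    rw [hC, weightedCov_apply, ← Finset.mul_sum, mul_pow, ht, overlap]
    field_simp
  have hq1 : ∀ σ : Config N, overlap σ σ = 1 := fun σ => by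
    rw [overlap, sum_spin_mul_self, inv_mul_cancel₀ hN'.ne']
  have hb : fieldTerm N 0 = 0 := by ext; simp [fieldTerm]
  have hpsd : C.PosSemidef := posSemidef_weightedCov_const t
  have hF : skFree N t 0 = freeEnergy 0 C := by rw [skFree_eq_freeEnergy, hb]
  have hz : logZ (0 : Config N → ℝ) = Real.log (2 ^ N) := by simp [logZ]
  constructor
  · have := freeEnergy_le hpsd Matrix.PosSemidef.zero 0 (c := x) fun σ τ => by
      rw [hCq, hCq, hq1]
      simp
      positivity
    rw [freeEnergy_zero, hz] at this
    rw [hF, skFree_zero_zero]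
    linarith
  · have hX := isGaussianField_multivariateGaussian hpsd
    set P := multivariateGaussian 0 C
    -- `Y` is the partition function divided by its mean, since every `X σ` has variance `x`. `G` is
    -- the uniform average of the field, and `G - x/2` is the Jensen lower bound for `log Y`.
    set Y : EuclideanSpace ℝ (Config N) → ℝ := fun X =>
      (2 ^ N)⁻¹ * ∑ σ, Real.exp (X σ - x / 2) with hY
    set G : EuclideanSpace ℝ (Config N) → ℝ := fun X => ∑ σ, (2 ^ N)⁻¹ * X σ with hG
    have hYpos : ∀ X, 0 < Y X := fun X => mul_pos (by positivity)
      (Finset.sum_pos (fun _ _ => Real.exp_pos _) Finset.univ_nonempty)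
    have hlogY : ∀ X : EuclideanSpace ℝ (Config N), Real.log (Y X) =
        logZ (fun σ => (0 : Config N → ℝ) σ + X σ) - Real.log (2 ^ N) - x / 2 := by
      intro X
      have e : ∑ σ, Real.exp (X σ - x / 2) = (∑ σ, Real.exp (X σ)) * Real.exp (-(x / 2)) := by
        rw [Finset.sum_mul]
        exact Finset.sum_congr rfl fun σ _ => by rw [← Real.exp_add, sub_eq_add_neg]
      simp only [hY, e]
      rw [Real.log_mul (by positivity) (by have := sum_exp_pos (fun σ => X σ); positivity),
        Real.log_mul (sum_exp_pos (fun σ => X σ)).ne' (Real.exp_pos _).ne', Real.log_exp,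
        Real.log_inv]
      simp only [logZ, Pi.zero_apply, zero_add]
      ring
    have hlow : ∀ X, (Y X - 1) - (2 + 2 * x) * (Y X - 1) ^ 2 -
        (1 / √N + √N * G X ^ 2) / 2 ≤ Real.log (Y X) := by
      intro X
      have h1 : G X - x / 2 ≤ Real.log (Y X) := by
        have h2 := logZ_add_gibbs_le (0 : Config N → ℝ) fun σ => X σ
        rw [hz, gibbs_zero] at h2
        rw [hlogY]
        simp only [Pi.zero_apply, zero_add, sub_zero, hG, ← Finset.mul_sum] at h2 ⊢
        linarith
      have h2 := sub_sub_le_log hx (hYpos X) h1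
      -- The weight `√N` balances the two terms, because `G` has variance `x/N`: both have mean of
      -- order `1/√N`.
      have h3 : |G X| ≤ (1 / √N + √N * G X ^ 2) / 2 := by
        have hs : 0 < √(N : ℝ) := Real.sqrt_pos.2 hN'
        have : 0 ≤ (1 - √N * |G X|) ^ 2 / √N := by positivity
        have e : (1 - √N * |G X|) ^ 2 / √N = 1 / √N - 2 * |G X| + √N * G X ^ 2 := by
          rw [← sq_abs (G X)]
          field_simp
          ring
        linarith
      linarith
    have hsingle : ∀ σ : Config N, Integrable (fun X : EuclideanSpace ℝ (Config N) =>
        Real.exp (X σ - x / 2)) P ∧ ∫ X, Real.exp (X σ - x / 2) ∂P = 1 := by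
      intro σ
      have e : ∀ X : EuclideanSpace ℝ (Config N), Real.exp (X σ - x / 2) =
          Real.exp (∑ σ', (Pi.single σ 1 : Config N → ℝ) σ' * X σ') * Real.exp (-(x / 2)) := by
        intro X
        rw [← Real.exp_add]
        simp [Pi.single_apply, sub_eq_add_neg]
      simp only [e]
      refine ⟨(hX.integrable_exp_sum _).mul_const _, ?_⟩
      rw [integral_mul_const, hX.integral_exp_sum, ← Real.exp_add, Real.exp_eq_one_iff]
      simp [Pi.single_apply, hCq, hq1]
    have hpair : ∀ σ τ : Config N, Integrable (fun X : EuclideanSpace ℝ (Config N) =>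
        Real.exp (X σ - x / 2) * Real.exp (X τ - x / 2)) P ∧
        ∫ X, Real.exp (X σ - x / 2) * Real.exp (X τ - x / 2) ∂P =
          Real.exp (x * overlap σ τ ^ 2) := by
      intro σ τ
      have e : ∀ X : EuclideanSpace ℝ (Config N),
          Real.exp (X σ - x / 2) * Real.exp (X τ - x / 2) =
          Real.exp (∑ σ', (Pi.single σ 1 + Pi.single τ 1 : Config N → ℝ) σ' * X σ') *
            Real.exp (-x) := by
        intro X
        rw [← Real.exp_add, ← Real.exp_add]
        congr 1
        simp [Pi.single_apply, add_mul, Finset.sum_add_distrib]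
        ring
      have hsym : overlap τ σ = overlap σ τ := by simp [overlap, mul_comm]
      simp only [e]
      refine ⟨(hX.integrable_exp_sum _).mul_const _, ?_⟩
      rw [integral_mul_const, hX.integral_exp_sum, ← Real.exp_add]
      congr 1
      simp [Pi.single_apply, hCq, hq1, add_mul, mul_add, Finset.sum_add_distrib, hsym]
      ring
    have hcard : ((2 : ℝ) ^ N)⁻¹ * ∑ _σ : Config N, (1 : ℝ) = 1 := by simp
    have hYi : Integrable Y P := (integrable_finsetSum _ fun σ _ => (hsingle σ).1).const_mul _
    have hYe : ∫ X, Y X ∂P = 1 := by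
      simp only [hY]
      rw [integral_const_mul, integral_finsetSum _ fun σ _ => (hsingle σ).1]
      simp only [(hsingle _).2]
      exact hcard
    have hY2 : ∀ X, Y X ^ 2 = (2 ^ N)⁻¹ * ∑ σ, (2 ^ N)⁻¹ * ∑ τ,
        Real.exp (X σ - x / 2) * Real.exp (X τ - x / 2) := by
      intro X
      simp only [hY, ← Finset.mul_sum, ← Finset.sum_mul]
      ring
    have hY2i : Integrable (fun X => Y X ^ 2) P := by
      simp only [hY2]
      exact (integrable_finsetSum _ fun σ _ =>
        (integrable_finsetSum _ fun τ _ => (hpair σ τ).1).const_mul _).const_mul _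
    have hY2e : ∫ X, Y X ^ 2 ∂P ≤ 1 + x * Real.exp x / N := by
      simp only [hY2]
      rw [integral_const_mul, integral_finsetSum _ fun σ _ =>
        (integrable_finsetSum _ fun τ _ => (hpair σ τ).1).const_mul _]
      have e1 : ∀ σ : Config N, ∫ X : EuclideanSpace ℝ (Config N), (2 ^ N)⁻¹ * ∑ τ,
          Real.exp (X σ - x / 2) * Real.exp (X τ - x / 2) ∂P =
          gibbs 0 fun τ : Config N => Real.exp (x * overlap σ τ ^ 2) := by
        intro σ
        rw [integral_const_mul, integral_finsetSum _ fun τ _ => (hpair σ τ).1, gibbs_zero]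
        simp only [(hpair _ _).2]
      rw [Finset.sum_congr rfl fun σ _ => e1 σ, ← gibbs_zero]
      -- Linearising in `q²`, which lies in `[0, 1]`, reduces the second moment of `Y` to the
      -- uniform average of `q²`, namely `1/N`.
      have hq : ∀ σ τ : Config N, Real.exp (x * overlap σ τ ^ 2) ≤
          1 + x * Real.exp x * overlap σ τ ^ 2 := by
        intro σ τ
        have h0 : overlap σ τ ^ 2 ≤ 1 := by
          rw [sq_le_one_iff_abs_le_one, overlap, abs_mul, abs_of_pos (by positivity),
            inv_mul_le_iff₀ hN', mul_one]
          exact abs_sum_spin_le σ τ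
        set y := x * overlap σ τ ^ 2 with hy
        have hy0 : 0 ≤ y := by positivity
        have hyx : y ≤ x := mul_le_of_le_one_right hx h0
        have h1 : Real.exp y - 1 ≤ y * Real.exp y := by
          have := Real.add_one_le_exp (-y)
          have h2 : Real.exp (-y) * Real.exp y = 1 := by rw [← Real.exp_add]; simp
          nlinarith [Real.exp_pos y]
        have h2 : y * Real.exp y ≤ y * Real.exp x :=
          mul_le_mul_of_nonneg_left (Real.exp_le_exp.2 hyx) hy0
        have h3 : y * Real.exp x = x * Real.exp x * overlap σ τ ^ 2 := by rw [hy]; ring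
        linarith
      refine (gibbs_mono fun σ => gibbs_mono fun τ => hq σ τ).trans (le_of_eq ?_)
      have e2 : ∀ σ : Config N, (gibbs 0 fun τ : Config N =>
          1 + x * Real.exp x * overlap σ τ ^ 2) =
          1 + x * Real.exp x * gibbs 0 fun τ : Config N => overlap σ τ ^ 2 := by
        intro σ
        rw [← gibbs_const_mul]
        exact (gibbs_add 0 (fun _ => 1) _).trans (by rw [gibbs_const])
      rw [funext e2]
      refine (gibbs_add 0 (fun _ => 1) _).trans ?_
      rw [gibbs_const, gibbs_const_mul, gibbs_zero_overlap_sq hN]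
      ring
    obtain ⟨hGi, hGe⟩ := hX.integral_sum_sq fun _ => (2 ^ N)⁻¹
    have hGe' : ∫ X, G X ^ 2 ∂P = x / N := by
      refine hGe.trans ?_
      have h := gibbs_zero_overlap_sq hN
      simp only [gibbs_zero, Finset.mul_sum] at h
      have e : ∀ σ τ : Config N, ((2 : ℝ) ^ N)⁻¹ * (2 ^ N)⁻¹ * C σ τ =
          x * ((2 ^ N)⁻¹ * ((2 ^ N)⁻¹ * overlap σ τ ^ 2)) := fun σ τ => by rw [hCq]; ring
      simp only [e, ← Finset.mul_sum] at h ⊢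
      rw [h]
      ring
    have hLi : Integrable (fun X => Real.log (Y X)) P := by
      simp only [hlogY]
      exact ((hX.integrable_logZ 0).sub (integrable_const _)).sub (integrable_const _)
    have hLe : ∫ X, Real.log (Y X) ∂P = skFree N t 0 - skFree N 0 0 - x / 2 := by
      have i1 : Integrable (fun X : EuclideanSpace ℝ (Config N) =>
          logZ (fun σ => (0 : Config N → ℝ) σ + X σ) - Real.log (2 ^ N)) P :=
        (hX.integrable_logZ 0).sub (integrable_const _)
      simp only [hlogY]
      rw [integral_sub i1 (integrable_const _),
        integral_sub (hX.integrable_logZ 0) (integrable_const _), hX.integral_logZ, hF,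
        skFree_zero_zero]
      simp
    have hsqi : Integrable (fun X => (Y X - 1) ^ 2) P := by
      have : ∀ X, (Y X - 1) ^ 2 = Y X ^ 2 - 2 * Y X + 1 := fun X => by ring
      simp only [this]
      exact (hY2i.sub (hYi.const_mul 2)).add (integrable_const _)
    have hsqe : ∫ X, (Y X - 1) ^ 2 ∂P ≤ x * Real.exp x / N := by
      have : ∀ X, (Y X - 1) ^ 2 = Y X ^ 2 - 2 * Y X + 1 := fun X => by ring
      simp only [this]
      have i2 : Integrable (fun X => Y X ^ 2 - 2 * Y X) P := hY2i.sub (hYi.const_mul 2)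
      rw [integral_add i2 (integrable_const _),
        integral_sub hY2i (hYi.const_mul 2), integral_const_mul, hYe]
      simp
      linarith
    have hi1 : Integrable (fun X => Y X - 1) P := hYi.sub (integrable_const _)
    have hi2 : Integrable (fun X => (1 / √N + √N * G X ^ 2) / 2) P :=
      ((integrable_const _).add (hGi.const_mul _)).div_const _
    have i3 : Integrable (fun X => Y X - 1 - (2 + 2 * x) * (Y X - 1) ^ 2) P :=
      hi1.sub (hsqi.const_mul _)
    have hGi' : Integrable (fun X => √N * G X ^ 2) P := hGi.const_mul _
    have key := integral_mono (i3.sub hi2) hLi hlow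
    simp only [Pi.sub_apply] at key
    rw [integral_sub i3 hi2,
      integral_sub hi1 (hsqi.const_mul (2 + 2 * x)), integral_const_mul, integral_div,
      integral_add (integrable_const _) hGi', integral_const_mul, hGe', hLe,
      integral_sub hYi (integrable_const _), hYe] at key
    simp only [integral_const, probReal_univ, smul_eq_mul, one_mul, sub_self, zero_sub] at key
    have hs : √(N : ℝ) * (x / N) = x / √N := by
      have : √(N : ℝ) * √N = N := Real.mul_self_sqrt hN'.le
      nth_rw 2 [← this]
      field_simp
    rw [hs, ← add_div, div_div, mul_comm (√(N : ℝ))] at key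
    nlinarith [mul_le_mul_of_nonneg_left hsqe (by positivity : 0 ≤ 2 + 2 * x)]

theorem tendsto_skFree_sub_zero {x : ℝ} (hx : 0 ≤ x) {u : ℕ → ℝ}
    (hu : ∀ N : ℕ, N ≠ 0 → u N ^ 2 = 2 * x / N) :
    Tendsto (fun N => skFree N (u N) 0 - skFree N 0 0) atTop (𝓝 (x / 2)) := by
  have hlow : Tendsto (fun N : ℕ => x / 2 - (2 + 2 * x) * (x * Real.exp x / N) -
      (1 + x) / (2 * √N)) atTop (𝓝 (x / 2)) := by
    have h1 : Tendsto (fun N : ℕ => x * Real.exp x / N) atTop (𝓝 0) :=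
      tendsto_const_div_atTop_nhds_zero_nat _
    have h2 : Tendsto (fun N : ℕ => (1 + x) / (2 * √N)) atTop (𝓝 0) :=
      Tendsto.div_atTop tendsto_const_nhds
        ((Real.tendsto_sqrt_atTop.comp tendsto_natCast_atTop_atTop).const_mul_atTop two_pos)
    simpa using (tendsto_const_nhds.sub (h1.const_mul (2 + 2 * x))).sub h2
  refine tendsto_of_tendsto_of_tendsto_of_le_of_le' hlow tendsto_const_nhds ?_ ?_
  · filter_upwards [eventually_gt_atTop 0] with N hN
    exact (skFree_sub_zero_bounds hN.ne' hx (hu N hN.ne')).2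
  · filter_upwards [eventually_gt_atTop 0] with N hN
    exact (skFree_sub_zero_bounds hN.ne' hx (hu N hN.ne')).1

end SpinGlass

/-! ### Cavity observables as differences of free energies. -/

namespace SpinGlass

/-- The exponent of the spin system made of a cavity of size `K` and of `m` further spins: every
further spin `s j` is coupled to the cavity through the field `η (e j)`. -/
def cavityField {K m : ℕ} (β : ℝ) (e : Fin m → ℕ) (lam μ : ℝ)
    (ω : Couplings K × (ℕ → Field K) × Field K × Field K) (p : Config K × Config m) : ℝ :=
  featureField 0 (couplePair K) (fun _ => β / √K) ω.1 p.1 +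
    ((∑ j, β * spin (p.2 j) * ω.2.1 (e j) p.1) + (lam * ω.2.2.1 p.1 + μ * ω.2.2.2 p.1))

/-- The covariance of `cavityField`, with `x = lam ^ 2 + μ ^ 2`. -/
def cavityCov (K m : ℕ) (β x : ℝ) : Matrix (Config K × Config m) (Config K × Config m) ℝ :=
  Matrix.of fun p q => featureCov (couplePair K) (fun _ => β / √K) p.1 q.1 +
    (β ^ 2 * (∑ j, spin (p.2 j) * spin (q.2 j)) * overlap p.1 q.1 + x * overlap p.1 q.1 ^ 2)

instance isProbabilityMeasure_sampleLaw (K : ℕ) : IsProbabilityMeasure (sampleLaw K) := by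
  have := isProbabilityMeasure_couplingLaw K
  unfold sampleLaw
  infer_instance

/-- Injectivity of `e` gives each further spin its own independent field. The result involves
neither `e` nor `lam` and `μ` separately, which is why gains depend only on `m` and on `lam² + μ²`.
-/
theorem isGaussianField_cavityField {K m : ℕ} (β : ℝ) {e : Fin m → ℕ} (he : e.Injective)
    (lam μ : ℝ) : IsGaussianField (sampleLaw K) (cavityField β e lam μ)
      (cavityCov K m β (lam ^ 2 + μ ^ 2)) := by
  have := isProbabilityMeasure_couplingLaw K
  have hJ := (isGaussianField_skCoupling K β).pullback
    (T := Config K × Config m) Prod.fst fun _ => 1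
  have hη := isGaussianField_infinitePi (ι := ℕ)
    (ν := fun _ => multivariateGaussian 0 (overlapMatrix K)) he
    fun j => (isGaussianField_multivariateGaussian (posSemidef_overlapMatrix K)).pullback
      (T := Config K × Config m) Prod.fst fun p => β * spin (p.2 j)
  have hκ := fun r : ℝ => (isGaussianField_multivariateGaussian
    (posSemidef_sqOverlapMatrix K)).pullback (T := Config K × Config m) Prod.fst fun _ => r
  have h := hJ.add_prod (hη.add_prod ((hκ lam).add_prod (hκ μ)))
  have e1 : cavityField β e lam μ = fun (ω : Couplings K × (ℕ → Field K) × Field K × Field K)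
      (p : Config K × Config m) => 1 * featureField 0 (couplePair K) (fun _ => β / √K) ω.1 p.1 +
        ((∑ j, β * spin (p.2 j) * ω.2.1 (e j) p.1) + (lam * ω.2.2.1 p.1 + μ * ω.2.2.2 p.1)) := by
    ext ω p
    rw [cavityField, one_mul]
  rw [e1, sampleLaw]
  refine cast (congrArg _ ?_) h
  ext p q
  simp only [cavityCov, Matrix.of_apply, Matrix.add_apply, Matrix.sum_apply, overlapMatrix,
    sqOverlapMatrix, Finset.mul_sum, Finset.sum_mul]
  rw [add_mul, one_mul, one_mul]
  congr 1
  congr 1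
  · exact Finset.sum_congr rfl fun j _ => by ring
  · ring

/-- The observable `c_{e 0} ⋯ c_{e (m - 1)} exp (lam κ) exp (μ κ')`. -/
def fieldObs (β h : ℝ) {K m : ℕ} (e : Fin m → ℕ) (lam μ : ℝ) (s : Sample K) (τ : Config K) : ℝ :=
  (∏ j, c β h (e j) s τ) * expκ lam s τ * expκ' μ s τ

theorem sum_exp_spin {m : ℕ} (y : Fin m → ℝ) :
    ∑ s : Config m, Real.exp (∑ j, spin (s j) * y j) = ∏ j, 2 * Real.cosh (y j) := by
  have h : ∀ j, 2 * Real.cosh (y j) = ∑ u : ℤˣ, Real.exp (spin u * y j) := by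
    intro j
    have hu : (Finset.univ : Finset ℤˣ) = {1, -1} := rfl
    rw [hu, Finset.sum_pair (by decide), Real.cosh_eq]
    simp [spin]
    ring
  simp only [h, Finset.prod_univ_sum, Fintype.piFinset_univ, Real.exp_sum]

/-- Each `2 cosh` is expanded as a sum over a new spin in the same external field `h`, so the
observable becomes part of the Boltzmann weight of an enlarged system. -/
theorem log_sum_fieldObs (β h : ℝ) {K m : ℕ} (e : Fin m → ℕ) (lam μ : ℝ)
    (ω : Couplings K × (ℕ → Field K) × Field K × Field K) :
    Real.log (∑ τ, fieldObs β h e lam μ (Sample.ofTuple ω) τ *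
        Real.exp (skExponent K β (β * h) ω.1 τ)) =
      logZ fun p : Config K × Config m =>
        (fieldTerm K (β * h) p.1 + fieldTerm m (β * h) p.2) + cavityField β e lam μ ω p := by
  rw [logZ, Fintype.sum_prod_type]
  congr 1
  refine Finset.sum_congr rfl fun τ _ => ?_
  simp only [fieldObs, c, ← sum_exp_spin, expκ, expκ', Sample.ofTuple, Finset.sum_mul]
  refine Finset.sum_congr rfl fun s _ => ?_
  rw [← Real.exp_add, ← Real.exp_add, ← Real.exp_add]
  congr 1
  have e1 : ∑ j, spin (s j) * (β * (h + ω.2.1 (e j) τ)) =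
      fieldTerm m (β * h) s + ∑ j, β * spin (s j) * ω.2.1 (e j) τ := by
    rw [fieldTerm, Finset.mul_sum, ← Finset.sum_add_distrib]
    exact Finset.sum_congr rfl fun j _ => by ring
  rw [e1]
  simp only [cavityField, skExponent, featureField, Pi.add_apply, Pi.zero_apply]
  ring

theorem fieldObs_pos (β h : ℝ) {K m : ℕ} (e : Fin m → ℕ) (lam μ : ℝ) (s : Sample K)
    (τ : Config K) : 0 < fieldObs β h e lam μ s τ :=
  mul_pos (mul_pos (Finset.prod_pos fun _ _ => mul_pos two_pos (Real.cosh_pos _))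
    (Real.exp_pos _)) (Real.exp_pos _)

/-- The free energy of a cavity of size `K` together with `m` further spins. -/
def cavityFree (K m : ℕ) (β h x : ℝ) : ℝ :=
  freeEnergy (fun p : Config K × Config m => fieldTerm K (β * h) p.1 + fieldTerm m (β * h) p.2)
    (cavityCov K m β x)

/-- The gain of free energy when the `m` further spins and the field `κ` are added. -/
def cavityGain (K m : ℕ) (β h x : ℝ) : ℝ :=
  cavityFree K m β h x - skFree K β (β * h)

theorem log_gibbs {S : Type*} [Fintype S] [Nonempty S] {A : S → ℝ} (hA : ∀ σ, 0 < A σ)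
    (Y : S → ℝ) : Real.log (gibbs Y A) = Real.log (∑ σ, A σ * Real.exp (Y σ)) - logZ Y := by
  rw [gibbs, Real.log_div, logZ]
  · exact (Finset.sum_pos (fun σ _ => mul_pos (hA σ) (Real.exp_pos _)) Finset.univ_nonempty).ne'
  · exact (sum_exp_pos Y).ne'

theorem gibbs_pos {S : Type*} [Fintype S] [Nonempty S] {A : S → ℝ} (hA : ∀ σ, 0 < A σ)
    (Y : S → ℝ) : 0 < gibbs Y A :=
  div_pos (Finset.sum_pos (fun σ _ => mul_pos (hA σ) (Real.exp_pos _)) Finset.univ_nonempty)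
    (sum_exp_pos Y)

theorem log_boltzmann_fieldObs (β h : ℝ) {K m : ℕ} (e : Fin m → ℕ) (lam μ : ℝ)
    (ω : Couplings K × (ℕ → Field K) × Field K × Field K) :
    Real.log (cavityState β h K (Sample.ofTuple ω)
        (fieldObs β h e lam μ (Sample.ofTuple ω))) =
      (logZ fun p : Config K × Config m =>
        (fieldTerm K (β * h) p.1 + fieldTerm m (β * h) p.2) + cavityField β e lam μ ω p) -
      logZ (skExponent K β (β * h) ω.1) := by
  rw [cavityState, boltzmann_eq_gibbs, log_gibbs (fieldObs_pos β h e lam μ _), ← log_sum_fieldObs]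
  rfl

theorem integral_log_boltzmann_fieldObs (β h : ℝ) {K m : ℕ} {e : Fin m → ℕ} (he : e.Injective)
    (lam μ : ℝ) :
    Integrable (fun ω => Real.log (cavityState β h K (Sample.ofTuple ω)
        (fieldObs β h e lam μ (Sample.ofTuple ω)))) (sampleLaw K) ∧
      ELog K (cavityState β h K) (fieldObs β h e lam μ) =
        cavityGain K m β h (lam ^ 2 + μ ^ 2) := by
  have := isProbabilityMeasure_couplingLaw K
  have hX := isGaussianField_cavityField (K := K) β he lam μ
  have i1 := hX.integrable_logZ
    fun p : Config K × Config m => fieldTerm K (β * h) p.1 + fieldTerm m (β * h) p.2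
  have hb : ∀ J : Couplings K, skExponent K β (β * h) J = fun σ => fieldTerm K (β * h) σ +
      featureField 0 (couplePair K) (fun _ => β / √K) J σ := by
    intro J
    ext σ
    simp [skExponent, featureField]
  have hY := isGaussianField_skCoupling K β
  have i2 : Integrable (fun J => logZ (skExponent K β (β * h) J)) (couplingLaw K) := by
    simp only [hb]
    exact hY.integrable_logZ _
  have i3 : Integrable (fun ω => logZ (skExponent K β (β * h) ω.1)) (sampleLaw K) :=
    i2.comp_fst _
  simp only [ELog, log_boltzmann_fieldObs]
  refine ⟨i1.sub i3, ?_⟩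
  rw [integral_sub i1 i3, hX.integral_logZ, cavityGain, cavityFree]
  congr 1
  rw [sampleLaw, integral_fun_fst fun J => logZ (skExponent K β (β * h) J)]
  simp [skFree]

/-- The logarithm of the quotient defining the transformed state is a difference of two logarithms
of the untransformed state. -/
theorem ELog_transform_fieldObs (β h : ℝ) {K m n : ℕ} {e : Fin m → ℕ} (he : e.Injective)
    {e' : Fin n → ℕ} (he' : e'.Injective) {lam μ lam' μ' : ℝ} {A : Sample K → Config K → ℝ}
    (hA : fieldObs β h e' lam' μ' * A = fieldObs β h e lam μ) :
    ELog K (transform (fieldObs β h e' lam' μ') (cavityState β h K)) A =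
      cavityGain K m β h (lam ^ 2 + μ ^ 2) - cavityGain K n β h (lam' ^ 2 + μ' ^ 2) := by
  obtain ⟨i1, h1⟩ := integral_log_boltzmann_fieldObs (K := K) β h he lam μ
  obtain ⟨i2, h2⟩ := integral_log_boltzmann_fieldObs (K := K) β h he' lam' μ'
  rw [← h1, ← h2, ELog, ELog, ELog, ← integral_sub i1 i2]
  refine integral_congr_ae (Eventually.of_forall fun ω => ?_)
  have hA' : fieldObs β h e' lam' μ' (Sample.ofTuple ω) * A (Sample.ofTuple ω) =
      fieldObs β h e lam μ (Sample.ofTuple ω) := by rw [← hA]; rfl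
  have hpos : ∀ {k : ℕ} (f : Fin k → ℕ) (r r' : ℝ), 0 < cavityState β h K (Sample.ofTuple ω)
      (fieldObs β h f r r' (Sample.ofTuple ω)) := by
    intro k f r r'
    rw [cavityState, boltzmann_eq_gibbs]
    exact gibbs_pos (fieldObs_pos β h f r r' _) _
  simp only [transform, hA']
  rw [Real.log_div (hpos _ _ _).ne' (hpos _ _ _).ne']

theorem cavityObs_eq_fieldObs (β h : ℝ) (M : ℕ) (lam : ℝ) {K : ℕ} :
    (cavityObs β h M lam : Sample K → Config K → ℝ) =
      fieldObs β h (fun j : Fin M => (j : ℕ) + 1) lam 0 := by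
  ext s τ
  have : ∏ j ∈ Finset.Icc 1 M, c β h j s τ = ∏ j : Fin M, c β h ((j : ℕ) + 1) s τ := by
    rw [Fin.prod_univ_eq_prod_range (fun j => c β h (j + 1) s τ), Finset.range_eq_Ico,
      Finset.prod_Ico_add' (fun j => c β h j s τ)]
    rfl
  simp [cavityObs, fieldObs, expκ', this]

theorem c_eq_fieldObs (β h : ℝ) (j : ℕ) {K : ℕ} :
    (c β h j : Sample K → Config K → ℝ) = fieldObs β h (fun _ : Fin 1 => j) 0 0 := by
  ext s τ
  simp [fieldObs, expκ, expκ']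

theorem expκ_eq_fieldObs (β h lam : ℝ) {K : ℕ} :
    (expκ lam : Sample K → Config K → ℝ) = fieldObs β h (Fin.elim0 : Fin 0 → ℕ) lam 0 := by
  ext s τ
  simp [fieldObs, expκ']

theorem expκ'_eq_fieldObs (β h μ : ℝ) {K : ℕ} :
    (expκ' μ : Sample K → Config K → ℝ) = fieldObs β h (Fin.elim0 : Fin 0 → ℕ) 0 μ := by
  ext s τ
  simp [fieldObs, expκ]

variable (β h : ℝ) (K M : ℕ) (lam μ : ℝ)

theorem ELog_cavityObs : ELog K (cavityState β h K) (cavityObs β h M lam) =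
    cavityGain K M β h (lam ^ 2) := by
  rw [cavityObs_eq_fieldObs, (integral_log_boltzmann_fieldObs β h (fun i j hij => by
    simpa [Fin.ext_iff] using hij) lam 0).2]
  simp

theorem ELog_c (j : ℕ) : ELog K (cavityState β h K) (c β h j) = cavityGain K 1 β h 0 := by
  rw [c_eq_fieldObs, (integral_log_boltzmann_fieldObs β h
    (Function.injective_of_subsingleton _) 0 0).2]
  simp

theorem ELog_expκ : ELog K (cavityState β h K) (expκ lam) = cavityGain K 0 β h (lam ^ 2) := by
  rw [expκ_eq_fieldObs β h, (integral_log_boltzmann_fieldObs β h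
    (Function.injective_of_subsingleton _) lam 0).2]
  simp

theorem ELog_transform_c :
    ELog K (transform (c β h 0) (cavityState β h K)) (cavityObs β h M lam) =
      cavityGain K (M + 1) β h (lam ^ 2) - cavityGain K 1 β h 0 := by
  rw [c_eq_fieldObs, ELog_transform_fieldObs β h (e := fun j : Fin (M + 1) => (j : ℕ))
    Fin.val_injective (Function.injective_of_subsingleton _) (lam := lam) (μ := 0)]
  · simp
  · rw [cavityObs_eq_fieldObs]
    ext s τ
    simp [fieldObs, expκ, expκ', Fin.prod_univ_succ]
    ring

theorem ELog_transform_expκ' :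
    ELog K (transform (expκ' μ) (cavityState β h K)) (cavityObs β h M lam) =
      cavityGain K M β h (lam ^ 2 + μ ^ 2) - cavityGain K 0 β h (μ ^ 2) := by
  rw [expκ'_eq_fieldObs β h, ELog_transform_fieldObs β h (e := fun j : Fin M => (j : ℕ) + 1)
    (fun i j hij => by simpa [Fin.ext_iff] using hij)
    (Function.injective_of_subsingleton _) (lam := lam) (μ := μ)]
  · simp
  · rw [cavityObs_eq_fieldObs]
    ext s τ
    simp [fieldObs, expκ, expκ']
    ring

end SpinGlass

/-! ### Comparison of the cavity with a larger system, and averages over the size. -/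

namespace SpinGlass

theorem posSemidef_cavityCov (K m : ℕ) (β : ℝ) {x : ℝ} (hx : 0 ≤ x) :
    (cavityCov K m β x).PosSemidef := by
  have h := (isGaussianField_cavityField (K := K) β (Fin.val_injective (n := m)) (√x) 0).posSemidef
  simpa [Real.sq_sqrt hx] using h

/-- The constant in the comparison of a cavity with a slightly larger system. -/
def cavityError (m : ℕ) (β x : ℝ) : ℝ :=
  β ^ 2 * m ^ 2 / 2 + 2 * x * m + (β ^ 2 * m + (2 * x + m * β ^ 2)) * m +
    (β ^ 2 + (2 * x + m * β ^ 2)) * m ^ 2 / 2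

/-- Here `a` is the cavity overlap and `B` the overlap sum of the further spins. Renormalising from
`k` to `k + m` sites loses about `mβ² a²/2`, and the field `κ` adds `x a²`. The shift `(2x + mβ²)/(k
+ m)` of the squared temperature accounts for both, so all terms of order `k` and of order one
cancel. -/
theorem abs_cavity_exponent_sub_le {k β x a B : ℝ} {m : ℕ} (hk : 1 ≤ k) (hx : 0 ≤ x)
    (ha : |a| ≤ 1) (hB : |B| ≤ m) :
    |k * β ^ 2 * a ^ 2 / 2 + β ^ 2 * B * a + x * a ^ 2 -
      (β ^ 2 + (2 * x + m * β ^ 2) / (k + m)) * (k * a + B) ^ 2 / (2 * (k + m))| ≤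
      cavityError m β x / (k + m) := by
  have hm : (0 : ℝ) ≤ m := by positivity
  have hn : 0 < k + m := by linarith
  set r := 2 * x + m * β ^ 2 with hr
  have hr0 : 0 ≤ r := by positivity
  have e : k * β ^ 2 * a ^ 2 / 2 + β ^ 2 * B * a + x * a ^ 2 -
      (β ^ 2 + r / (k + m)) * (k * a + B) ^ 2 / (2 * (k + m)) =
      (a ^ 2 * (β ^ 2 * m ^ 2 / 2 * (k / (k + m)) + x * m * (1 + k / (k + m))) +
        a * B * (β ^ 2 * m - r * (k / (k + m))) -
        B ^ 2 * ((β ^ 2 + r / (k + m)) / 2)) / (k + m) := by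
    rw [hr]
    field_simp
    ring
  have hkn : k / (k + m) ≤ 1 := (div_le_one hn).2 (by linarith)
  have hkn0 : 0 ≤ k / (k + m) := by positivity
  have hrn : r / (k + m) ≤ r := div_le_self hr0 (by linarith)
  have hrn0 : 0 ≤ r / (k + m) := by positivity
  have ha2 : a ^ 2 ≤ 1 := (sq_le_one_iff_abs_le_one a).2 ha
  have hB2 : B ^ 2 ≤ m ^ 2 := by rw [← sq_abs B]; gcongr
  have hp0 : 0 ≤ β ^ 2 * m ^ 2 / 2 * (k / (k + m)) + x * m * (1 + k / (k + m)) := by positivity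
  have hp : β ^ 2 * m ^ 2 / 2 * (k / (k + m)) + x * m * (1 + k / (k + m)) ≤
      β ^ 2 * m ^ 2 / 2 * 1 + x * m * (1 + 1) := by gcongr
  have h1 : |a ^ 2 * (β ^ 2 * m ^ 2 / 2 * (k / (k + m)) + x * m * (1 + k / (k + m)))| ≤
      β ^ 2 * m ^ 2 / 2 * 1 + x * m * (1 + 1) := by
    rw [abs_of_nonneg (by positivity)]
    exact (mul_le_of_le_one_left hp0 ha2).trans hp
  have h2 : |a * B * (β ^ 2 * m - r * (k / (k + m)))| ≤ m * (β ^ 2 * m + r) := by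
    rw [abs_mul, abs_mul]
    have h3 : |β ^ 2 * m - r * (k / (k + m))| ≤ β ^ 2 * m + r := by
      have h4 : 0 ≤ r * (k / (k + m)) := by positivity
      have h5 : r * (k / (k + m)) ≤ r := mul_le_of_le_one_right hr0 hkn
      have h6 : 0 ≤ β ^ 2 * m := by positivity
      rw [abs_le]
      constructor <;> linarith
    have h4 : |a| * |B| ≤ 1 * m := mul_le_mul ha hB (abs_nonneg _) zero_le_one
    rw [one_mul] at h4
    exact mul_le_mul h4 h3 (abs_nonneg _) hm
  have h3 : |B ^ 2 * ((β ^ 2 + r / (k + m)) / 2)| ≤ m ^ 2 * ((β ^ 2 + r) / 2) := by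
    rw [abs_of_nonneg (by positivity)]
    gcongr
  rw [e, abs_div, abs_of_pos hn]
  refine div_le_div_of_nonneg_right ?_ hn.le
  refine (abs_sub _ _).trans ?_
  refine (add_le_add_left (abs_add_le _ _) _).trans ?_
  rw [cavityError, ← hr]
  linarith

/-- The cavity together with the `m` further spins and the field `κ` is close to a spin system with
`K + m` sites, at a slightly different temperature. -/
theorem abs_cavityFree_sub_skFree_le {K m : ℕ} (hK : K ≠ 0) (β h : ℝ) {x t : ℝ} (hx : 0 ≤ x)
    (ht : t ^ 2 = β ^ 2 + (2 * x + m * β ^ 2) / (K + m : ℕ)) :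
    |cavityFree K m β h x - skFree (K + m) t (β * h)| ≤ cavityError m β x / (K + m : ℕ) := by
  have hK' : (1 : ℝ) ≤ K := by exact_mod_cast Nat.one_le_iff_ne_zero.2 hK
  have hC := posSemidef_cavityCov K m β hx
  have hD := posSemidef_weightedCov_const (N := K + m) t
  have hb : (fieldTerm (K + m) (β * h) ∘ Fin.appendEquiv K m : Config K × Config m → ℝ) =
      fun p => fieldTerm K (β * h) p.1 + fieldTerm m (β * h) p.2 :=
    funext fun p => fieldTerm_append _ p
  rw [skFree_eq_freeEnergy, ← freeEnergy_reindex hD _ (Fin.appendEquiv K m), hb, cavityFree]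
  have hD' := hD.submatrix (Fin.appendEquiv K m)
  -- The constant `β²/2` restores the diagonal couples missing from the cavity noise. It drops out
  -- of `C p p - C p q`.
  have key : ∀ p q : Config K × Config m, |cavityCov K m β x p q + β ^ 2 / 2 -
      (weightedCov fun _ : Fin (K + m) => t).submatrix (Fin.appendEquiv K m)
        (Fin.appendEquiv K m) p q| ≤ cavityError m β x / (K + m : ℕ) := by
    intro p q
    have ha : |overlap p.1 q.1| ≤ 1 := by
      rw [overlap, abs_mul, abs_of_pos (by positivity), inv_mul_le_iff₀ (by positivity), mul_one]
      exact abs_sum_spin_le _ _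
    have h1 := abs_cavity_exponent_sub_le (β := β) hK' hx ha (abs_sum_spin_le p.2 q.2)
    push_cast at ht ⊢
    rw [← ht] at h1
    refine le_of_eq_of_le (congrArg _ ?_) h1
    have hA : ∑ i, spin (p.1 i) * spin (q.1 i) = K * overlap p.1 q.1 := by
      rw [overlap, mul_inv_cancel_left₀ (by positivity)]
    simp only [cavityCov, Matrix.of_apply, skCov_apply, Matrix.submatrix_apply,
      Fin.appendEquiv, Equiv.coe_fn_mk, weightedCov_apply, ← Finset.mul_sum, Fin.sum_univ_add,
      Fin.append_left, Fin.append_right, hA]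
    push_cast
    field_simp
    ring
  have key' : ∀ p q, _ := fun p q => abs_le.1 (key p q)
  rw [abs_le]
  constructor
  · have := freeEnergy_le hD' hC (fun p => fieldTerm K (β * h) p.1 + fieldTerm m (β * h) p.2)
      (c := 2 * (cavityError m β x / (K + m : ℕ))) fun p q => by
        linarith [(key' p p).1, (key' p q).2]
    linarith
  · have := freeEnergy_le hC hD' (fun p => fieldTerm K (β * h) p.1 + fieldTerm m (β * h) p.2)
      (c := 2 * (cavityError m β x / (K + m : ℕ))) fun p q => by
        linarith [(key' p p).2, (key' p q).1]
    linarith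

theorem tendsto_mul_sqrt_sub {β : ℝ} (hβ : β ≠ 0) {r : ℝ} (hr : 0 ≤ r) :
    Tendsto (fun n : ℕ => n * (β * √(1 + r / β ^ 2 / n) - β)) atTop (𝓝 (r / (2 * β))) := by
  have h1 : Tendsto (fun n : ℕ => r / β / (√(1 + r / β ^ 2 / n) + 1)) atTop
      (𝓝 (r / β / (√(1 + 0) + 1))) :=
    tendsto_const_nhds.div
      (((tendsto_const_div_atTop_nhds_zero_nat (r / β ^ 2)).const_add 1).sqrt.add_const 1)
      (by positivity)
  have e : r / (2 * β) = r / β / (√(1 + 0) + 1) := by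
    rw [add_zero, Real.sqrt_one]
    field_simp
    norm_num
  rw [e]
  refine h1.congr' ?_
  filter_upwards [eventually_gt_atTop 0] with n hn
  have hn' : (0 : ℝ) < n := by exact_mod_cast hn
  have hs : 0 < √(1 + r / β ^ 2 / n) + 1 := by positivity
  have h2 : √(1 + r / β ^ 2 / n) ^ 2 = 1 + r / β ^ 2 / n := Real.sq_sqrt (by positivity)
  rw [div_eq_iff hs.ne']
  have : n * (β * √(1 + r / β ^ 2 / n) - β) * (√(1 + r / β ^ 2 / n) + 1) =
      n * β * (√(1 + r / β ^ 2 / n) ^ 2 - 1) := by ring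
  rw [this, h2]
  field_simp
  ring

/-- The response of the free energy to a small change of temperature. -/
theorem exists_tendsto_skFree_sub {β h Q r : ℝ} (hr : 0 ≤ r)
    (hQ : Tendsto (fun N => skOverlap N β (β * h)) atTop (𝓝 Q)) :
    ∃ u : ℕ → ℝ, (∀ n, n ≠ 0 → u n ^ 2 = β ^ 2 + r / n) ∧
      Tendsto (fun n => skFree n (u n) (β * h) - skFree n β (β * h)) atTop
        (𝓝 (r / 4 * (1 - Q))) := by
  -- At `β = 0` the external term `βh` vanishes too, the spins are uniform and `Q = 0`. Then `u_n =
  -- √(r/n)` lies in a window of width `1/√n`, handled by the second moment bounds.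
  by_cases hβ : β = 0
  · subst hβ
    simp only [zero_mul] at hQ ⊢
    have hQ0 : Tendsto (fun N => skOverlap N 0 0) atTop (𝓝 0) := by
      refine tendsto_one_div_atTop_nhds_zero_nat.congr' ?_
      filter_upwards [eventually_gt_atTop 0] with N hN
      rw [skOverlap_zero hN.ne']
    have hu : ∀ n : ℕ, n ≠ 0 → √(r / n) ^ 2 = 2 * (r / 2) / n := fun n _ => by
      rw [Real.sq_sqrt (by positivity)]
      ring
    refine ⟨fun n => √(r / n), fun n hn => ?_, ?_⟩
    · rw [Real.sq_sqrt (by positivity)]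
      ring
    · rw [tendsto_nhds_unique hQ hQ0]
      have e : r / 4 * (1 - 0) = r / 2 / 2 := by ring
      rw [e]
      exact tendsto_skFree_sub_zero (by positivity) hu
  -- This root has the sign of `β`, so `u_n - β` is of order `1/n`.
  · refine ⟨fun n => β * √(1 + r / β ^ 2 / n), fun n hn => ?_, ?_⟩
    · rw [mul_pow, Real.sq_sqrt (by positivity)]
      field_simp
    · have e : r / 4 * (1 - Q) = r / (2 * β) * (β / 2 * (1 - Q)) := by
        field_simp
        ring
      rw [e]
      exact tendsto_skFree_sub hβ hQ (tendsto_mul_sqrt_sub hβ hr)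

/-- Once the size increment at fixed `β` is removed, only the temperature response at `K + m` sites
remains; this converges for each size, without averaging. -/
theorem tendsto_cavityGain_sub {β h Q x : ℝ} (hx : 0 ≤ x) (m : ℕ)
    (hQ : Tendsto (fun N => skOverlap N β (β * h)) atTop (𝓝 Q)) :
    Tendsto (fun K => cavityGain K m β h x -
        (skFree (K + m) β (β * h) - skFree K β (β * h))) atTop
      (𝓝 ((2 * x + m * β ^ 2) / 4 * (1 - Q))) := by
  obtain ⟨u, hu, hlim⟩ := exists_tendsto_skFree_sub (r := 2 * x + m * β ^ 2) (by positivity) hQ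
  have h1 : Tendsto (fun K => cavityFree K m β h x - skFree (K + m) (u (K + m)) (β * h)) atTop
      (𝓝 0) := by
    refine squeeze_zero_norm' ?_ ((tendsto_add_atTop_iff_nat m).2
      (tendsto_const_div_atTop_nhds_zero_nat (cavityError m β x)))
    filter_upwards [eventually_gt_atTop 0] with K hK
    exact abs_cavityFree_sub_skFree_le hK.ne' β h hx (hu _ (by omega))
  have h2 := h1.add ((tendsto_add_atTop_iff_nat m).2 hlim)
  rw [zero_add] at h2
  refine h2.congr fun K => ?_
  rw [cavityGain]
  ring

theorem sizeAverage_add (F G : ℕ → ℝ) :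
    (sizeAverage fun K => F K + G K) = fun N => sizeAverage F N + sizeAverage G N := by
  ext N
  simp [sizeAverage, Finset.sum_add_distrib, mul_add]

theorem sizeAverage_const_mul (F : ℕ → ℝ) (r : ℝ) :
    (sizeAverage fun K => r * F K) = fun N => r * sizeAverage F N := by
  ext N
  rw [sizeAverage, sizeAverage, ← Finset.mul_sum]
  ring

theorem sizeAverage_sub (F G : ℕ → ℝ) :
    (sizeAverage fun K => F K - G K) = fun N => sizeAverage F N - sizeAverage G N := by
  ext N
  simp [sizeAverage, Finset.sum_sub_distrib, mul_sub]

theorem sizeAverage_eq (F : ℕ → ℝ) (N : ℕ) :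
    sizeAverage F N = (N : ℝ)⁻¹ * ∑ i ∈ Finset.range N, F (i + 1) := by
  rw [sizeAverage, Finset.range_eq_Ico, Finset.sum_Ico_add' F 0 N 1]
  rfl

theorem tendsto_sizeAverage {F : ℕ → ℝ} {ℓ : ℝ} (hF : Tendsto F atTop (𝓝 ℓ)) :
    Tendsto (sizeAverage F) atTop (𝓝 ℓ) :=
  ((tendsto_add_atTop_iff_nat 1).2 hF).cesaro.congr fun N => (sizeAverage_eq F N).symm

/-- Individual increments need not converge, but their averages telescope to boundary terms `F(N + m
+ 1)/N` and `F(m + 1)/N`. This is where the average over the cavity size is needed. -/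
theorem tendsto_sizeAverage_sub {F : ℕ → ℝ} {ℓ : ℝ}
    (hF : Tendsto (fun N : ℕ => F N / N) atTop (𝓝 ℓ)) (m : ℕ) :
    Tendsto (sizeAverage fun K => F (K + m) - F K) atTop (𝓝 (m * ℓ)) := by
  induction m with
  | zero =>
    have : sizeAverage (fun K => F (K + 0) - F K) = fun _ => 0 := by
      ext N
      simp [sizeAverage]
    rw [this]
    simp
  | succ m ih =>
    have e : (fun K => F (K + (m + 1)) - F K) =
        fun K => (F (K + m) - F K) + (F (K + m + 1) - F (K + m)) := by
      ext K
      rw [add_assoc]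
      ring
    rw [e, sizeAverage_add, Nat.cast_add_one, add_one_mul]
    refine ih.add ?_
    have h1 : Tendsto (fun N : ℕ => F (N + (m + 1)) / (N + (m + 1) : ℕ)) atTop (𝓝 ℓ) :=
      (tendsto_add_atTop_iff_nat (m + 1)).2 hF
    have h2 : Tendsto (fun N : ℕ => 1 + ((m + 1 : ℕ) : ℝ) / N) atTop (𝓝 (1 + 0)) :=
      (tendsto_const_div_atTop_nhds_zero_nat _).const_add 1
    have h3 := (h1.mul h2).sub (tendsto_const_div_atTop_nhds_zero_nat (F (m + 1)))
    rw [add_zero, mul_one, sub_zero] at h3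
    refine h3.congr' ?_
    filter_upwards [eventually_gt_atTop 0] with N hN
    have hN' : (0 : ℝ) < N := by exact_mod_cast hN
    have hs := Finset.sum_range_sub (fun i => F (i + (m + 1))) N
    have e2 : ∀ i, F (i + 1 + m + 1) - F (i + 1 + m) =
        F (i + 1 + (m + 1)) - F (i + (m + 1)) := fun i => by
      rw [add_assoc (i + 1), add_assoc i 1 m, add_comm 1 m]
    rw [sizeAverage_eq]
    simp only [e2]
    rw [hs, zero_add]
    push_cast
    field_simp

theorem tendsto_sizeAverage_cavityGain {β h Q x : ℝ} (hx : 0 ≤ x) (m : ℕ)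
    (hQ : Tendsto (fun N => skOverlap N β (β * h)) atTop (𝓝 Q)) :
    Tendsto (sizeAverage fun K => cavityGain K m β h x) atTop
      (𝓝 (m * (alpha β h + β ^ 2 / 4 * (1 - Q)) + x / 2 * (1 - Q))) := by
  have h1 := tendsto_sizeAverage (tendsto_cavityGain_sub hx m hQ)
  have h2 := tendsto_sizeAverage_sub (tendsto_skFree β (β * h)) m
  have h3 := h1.add h2
  simp only [← sizeAverage_add, sub_add_cancel] at h3
  rw [alpha_eq]
  exact h3.trans (le_of_eq (congrArg _ (by ring)))

end SpinGlass

end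

/-! ### The main theorem. -/

theorem mainTheorem1 (β h Q : ℝ)
    (hQ : Tendsto (fun N : ℕ => SpinGlass.meanSqOverlap N β h) atTop (𝓝 Q)) :
    -- `α(β,h)` is the limit of `α_N(β,h)`
    Tendsto (fun N : ℕ => SpinGlass.alphaN N β h) atTop (𝓝 (SpinGlass.alpha β h)) ∧
    ∀ (M : ℕ) (lam : ℝ),
      -- the limit formula
      Tendsto (SpinGlass.sizeAverage fun K =>
          SpinGlass.ELog K (SpinGlass.cavityState β h K) (SpinGlass.cavityObs β h M lam)) atTop
        (𝓝 (M * (SpinGlass.alpha β h + β ^ 2 / 4 * (1 - Q)) + lam ^ 2 / 2 * (1 - Q))) ∧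
      -- factorization of the limiting structure
      Tendsto (SpinGlass.sizeAverage fun K =>
          SpinGlass.ELog K (SpinGlass.cavityState β h K) (SpinGlass.cavityObs β h M lam) -
            ((∑ j ∈ Finset.Icc 1 M,
                SpinGlass.ELog K (SpinGlass.cavityState β h K) (SpinGlass.c β h j)) +
              SpinGlass.ELog K (SpinGlass.cavityState β h K) (SpinGlass.expκ lam))) atTop
        (𝓝 0) ∧
      -- invariance under `Ω ↦ Ω(c_0 ·) / Ω(c_0)`
      Tendsto (SpinGlass.sizeAverage fun K =>
          SpinGlass.ELog K
              (SpinGlass.transform (SpinGlass.c β h 0) (SpinGlass.cavityState β h K))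
              (SpinGlass.cavityObs β h M lam) -
            SpinGlass.ELog K (SpinGlass.cavityState β h K) (SpinGlass.cavityObs β h M lam)) atTop
        (𝓝 0) ∧
      -- invariance under `Ω ↦ Ω(exp(μ κ') ·) / Ω(exp(μ κ'))`
      ∀ μ : ℝ,
        Tendsto (SpinGlass.sizeAverage fun K =>
            SpinGlass.ELog K
                (SpinGlass.transform (SpinGlass.expκ' μ) (SpinGlass.cavityState β h K))
                (SpinGlass.cavityObs β h M lam) -
              SpinGlass.ELog K (SpinGlass.cavityState β h K)
                (SpinGlass.cavityObs β h M lam)) atTop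
          (𝓝 0) := by
  simp only [SpinGlass.meanSqOverlap_eq] at hQ
  have hlim := fun {x : ℝ} (hx : 0 ≤ x) (m : ℕ) =>
    SpinGlass.tendsto_sizeAverage_cavityGain hx m hQ
  refine ⟨?_, fun M lam => ?_⟩
  · simp only [SpinGlass.alphaN_eq, SpinGlass.alpha_eq]
    exact SpinGlass.tendsto_skFree _ _
  -- All four assertions become combinations of averaged gains. Their limits are linear in the
  -- number of spins and in the variance, so the combinations for factorization and invariance
  -- cancel.
  · simp only [SpinGlass.ELog_cavityObs, SpinGlass.ELog_c, SpinGlass.ELog_expκ,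
      SpinGlass.ELog_transform_c, SpinGlass.ELog_transform_expκ', Finset.sum_const,
      Nat.card_Icc, Nat.add_sub_cancel, nsmul_eq_mul, SpinGlass.sizeAverage_sub,
      SpinGlass.sizeAverage_add, SpinGlass.sizeAverage_const_mul]
    refine ⟨hlim (sq_nonneg lam) M, ?_, ?_, fun μ => ?_⟩
    · convert (hlim (sq_nonneg lam) M).sub (((hlim le_rfl 1).const_mul (M : ℝ)).add
        (hlim (sq_nonneg lam) 0)) using 2
      push_cast
      ring
    · convert ((hlim (sq_nonneg lam) (M + 1)).sub (hlim le_rfl 1)).sub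
        (hlim (sq_nonneg lam) M) using 2
      push_cast
      ring
    · convert ((hlim (add_nonneg (sq_nonneg lam) (sq_nonneg μ)) M).sub
        (hlim (sq_nonneg μ) 0)).sub (hlim (sq_nonneg lam) M) using 2
      push_cast
      ring
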